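/- A *surface* is a compact oriented topological $2$-manifold, possibly with boundary and possibly disconnected. A *doodle diagram* $(\Sigma,D)$ consists of a surface $\Sigma$ and of the image $D$, contained in the interior of $\Sigma$, of a continuous locally flat map from a finite disjoint union of oriented circles to $\Sigma$, with finitely many crossing points, all of which are transverse double points. Two doodle diagrams $(\Sigma_1,D_1)$ and $(\Sigma_2,D_2)$ are *geotopic* if there are a surface $\Sigma_3$ and orientation-preserving embeddings $f_i\colon\Sigma_i\to\Sigma_3$ such that $f_1(D_1)=f_2(D_2)$. They are *stably equivalent* if they are connected by a finite chain of doodle diagrams in which consecutive ones are geotopic. The *capped surface* $S(\Sigma)$ is the closed oriented surface obtained from $\Sigma$ by gluing a closed disk to each component of $\partial\Sigma$, with the orientation extending that of $\Sigma$. On doodle diagrams $(\Sigma,D)$ consider the following operations. 1. $h^-$: choose a simple closed curve in $\Sigma\setminus(\partial\Sigma\cup D)$, remove an open regular neighborhood of it (an annulus disjoint from $\partial\Sigma\cup D$), and glue disks to the two new boundary circles. $h^+$: choose two disjoint closed disks in $\Sigma\setminus(\partial\Sigma\cup D)$, remove their interiors, and glue a handle $S^1\times[-1,1]$ to the two new boundary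 circles. In both cases the new surface carries an orientation extending that of the remaining part of $\Sigma$, and $D$ is unchanged. 2. Elimination of connected components of $\Sigma$ that are disjoint from $D$. 3. Replacing $(\Sigma,D)$ by $(h(\Sigma),h(D))$ for an orientation-preserving homeomorphism $h$. **Theorem.** Let $(\Sigma,D)$ and $(\Sigma',D')$ be doodle diagrams. The capped surfaces $S(\Sigma)$ and $S(\Sigma')$ exist, and for every choice of them, $(\Sigma,D)$ and $(\Sigma',D')$ are stably equivalent if and only if $(S(\Sigma),D)$ and $(S(\Sigma'),D')$ are equivalent under the equivalence relation generated by the operations 1–3. This holds both when diagrams are regarded as subsets of their surfaces (so that $f_1(D_1)=f_2(D_2)$ is an equality of sets) and when they are regarded as systems of oriented closed curves (so that all identifications of diagrams respect the orientations of the curves). -/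

import Mathlib

noncomputable section

namespace Doodle

open Set Filter Topology
open scoped Manifold

/-! ### Oriented surfaces

Everything is done in the topological category: a surface is a topological `2`-manifold, possibly
with boundary and possibly disconnected, and an orientation is a (topologically) oriented atlas. -/

/-- The Euclidean plane. -/
abbrev Plane : Type := EuclideanSpace ℝ (Fin 2)

/-- The closed half-plane, the model of a surface with boundary. -/
abbrev HalfPlane : Type := EuclideanHalfSpace 2

/-- The model with corners of surfaces with boundary. It provides the manifold interior and the
manifold boundary of a surface, and the charts with values in the plane. -/
abbrev model : ModelWithCorners ℝ Plane HalfPlane := 𝓡∂ 2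

/-- The unit vector of angle `t`. -/
def unitVec (t : ℝ) : Plane := !₂[Real.cos t, Real.sin t]

/-- A lift to the real line of a self-map of the circle of degree `+1`. -/
def IsDegreeOneLift (θ : ℝ → ℝ) : Prop :=
  Continuous θ ∧ ∀ t, θ (t + 2 * Real.pi) = θ t + 2 * Real.pi

/-- `f` has local degree `+1` at `x`: for all small `r > 0`, the image under `f` of the circle of
radius `r` around `x`, traversed once counterclockwise, has winding number `+1` around `f x`.
The map `f` only matters near `x`, where it is continuous and injective in all uses below; among
such maps, these are the ones preserving the standard orientation of the plane near `x`. -/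
def PreservesOrientationAt (f : Plane → Plane) (x : Plane) : Prop :=
  ∀ᶠ r : ℝ in 𝓝[>] 0, ∃ θ : ℝ → ℝ, IsDegreeOneLift θ ∧
    ∀ t, f (x + r • unitVec t) - f x = ‖f (x + r • unitVec t) - f x‖ • unitVec (θ t)

/-- An oriented compact surface, possibly with boundary, disconnected or empty: a compact Hausdorff
space with an atlas of charts in the half-plane whose changes of charts preserve the orientation
at interior points. -/
structure OrientedSurface where
  carrier : Type
  [topologicalSpace : TopologicalSpace carrier]
  [chartedSpace : ChartedSpace HalfPlane carrier]
  [t2Space : T2Space carrier]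
  [compactSpace : CompactSpace carrier]
  oriented : ∀ e ∈ atlas HalfPlane carrier, ∀ e' ∈ atlas HalfPlane carrier,
    ∀ x ∈ e.source ∩ e'.source, e.extend model x ∈ interior (range model) →
      PreservesOrientationAt (e'.extend model ∘ (e.extend model).symm) (e.extend model x)

instance : CoeSort OrientedSurface Type := ⟨OrientedSurface.carrier⟩

attribute [instance] OrientedSurface.topologicalSpace OrientedSurface.chartedSpace
  OrientedSurface.t2Space OrientedSurface.compactSpace

namespace OrientedSurface

/-- The points of a surface not on its boundary. -/
def inner (X : OrientedSurface) : Set X := model.interior X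

/-- The boundary of a surface. -/
def bdry (X : OrientedSurface) : Set X := model.boundary X

end OrientedSurface

/-- A map of surfaces preserves the orientation on a subset `s` of its source, if in charts it has
local degree `+1` at every point of the (topological) interior of `s` that is not on the boundary
of the surface. (Used for maps that are continuous and injective on `s`.) -/
def OrientationPreservingOn {X Y : OrientedSurface} (f : X → Y) (s : Set X) : Prop :=
  ∀ x ∈ interior s, x ∈ X.inner →
    PreservesOrientationAt (writtenInExtChartAt model model x f) (extChartAt model x x)

/-- Orientation-preserving embeddings of surfaces. -/
def IsOrientedEmbedding {X Y : OrientedSurface} (f : X → Y) : Prop :=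
  IsEmbedding f ∧ OrientationPreservingOn f univ

/-! ### Doodle diagrams -/

/-- A doodle diagram: an oriented compact surface with a generic system of finitely many closed
curves in its interior. The disjoint union of `n` circles is the product `Fin n × Circle`. -/
structure DoodleDiagram where
  /-- the ambient surface -/
  surface : OrientedSurface
  /-- the number of components -/
  n : ℕ
  /-- the parametrization of the curves -/
  curve : Fin n × Circle → surface
  continuous_curve : Continuous curve
  curve_mem_inner : ∀ p, curve p ∈ surface.inner
  /-- there are finitely many crossing points -/
  finite_crossings : {x | ∃ p q, p ≠ q ∧ curve p = x ∧ curve q = x}.Finite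
  /-- there are no triple points -/
  no_triple : ∀ p q r, curve p = curve q → curve q = curve r → p = q ∨ q = r ∨ p = r
  /-- each branch is locally flat: it is a straight line in a suitable topological chart -/
  locally_flat : ∀ p, ∃ φ : OpenPartialHomeomorph surface ℂ, curve p ∈ φ.source ∧
    ∀ᶠ p' in 𝓝 p, (φ (curve p')).im = 0
  /-- crossings are transverse: in a suitable topological chart, the two branches through a
  crossing point lie on the two coordinate axes -/
  transverse : ∀ p q, p ≠ q → curve p = curve q →
    ∃ φ : OpenPartialHomeomorph surface ℂ, curve p ∈ φ.source ∧
      (∀ᶠ p' in 𝓝 p, (φ (curve p')).im = 0) ∧ (∀ᶠ q' in 𝓝 q, (φ (curve q')).re = 0)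

/-- The diagram, as a subset of the ambient surface. -/
def DoodleDiagram.image (A : DoodleDiagram) : Set A.surface := range A.curve

/-- A diagram can be considered as a mere subset of the surface, or together with the orientation
of its components that is induced by the standard orientation of the circle. -/
inductive DiagramKind where
  | unoriented
  | oriented

/-- Equality of the images of two systems of closed curves: as subsets, or as systems of oriented
curves. In the second case, the components of the two systems correspond to each other under a
bijection `e`, and corresponding components differ by an orientation-preserving
homeomorphism of the circle, written as `exp (i t) ↦ exp (i θ(t))`. -/
def SameImage {Z : Type} {m n : ℕ} (α : Fin m × Circle → Z) (β : Fin n × Circle → Z) :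
    DiagramKind → Prop
  | .unoriented => range α = range β
  | .oriented => ∃ e : Fin m ≃ Fin n, ∀ i, ∃ θ : ℝ → ℝ, IsDegreeOneLift θ ∧ StrictMono θ ∧
      ∀ t, α (i, Circle.exp t) = β (e i, Circle.exp (θ t))

/-- The map `f` of ambient surfaces carries the first diagram to the second one. -/
def Carries (k : DiagramKind) (A B : DoodleDiagram) (f : A.surface → B.surface) : Prop :=
  SameImage (f ∘ A.curve) B.curve k

/-! ### Stable equivalence -/

/-- Geotopy: the ambient surfaces embed in a third surface, preserving the orientations, so that
the two diagrams have the same image. -/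
def Geotopic (k : DiagramKind) (A B : DoodleDiagram) : Prop :=
  ∃ (Z : OrientedSurface) (f : A.surface → Z) (g : B.surface → Z),
    IsOrientedEmbedding f ∧ IsOrientedEmbedding g ∧ SameImage (f ∘ A.curve) (g ∘ B.curve) k

/-- Stable equivalence: there is a finite chain of geotopies. -/
def StablyEquivalent (k : DiagramKind) : DoodleDiagram → DoodleDiagram → Prop :=
  Relation.ReflTransGen (Geotopic k)

/-! ### Capped surfaces -/

/-- `B` is the diagram of `A` in the closed surface that is obtained from the ambient surface of
`A` by gluing a closed disk to each component of the boundary: the ambient surface of `B` is closed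
and it is the union of an embedded copy of the ambient surface of `A` and of finitely many pairwise
disjoint closed disks, where the copy meets the disks exactly along its boundary, which is the
union of the boundary circles of the disks. -/
def IsCapping (k : DiagramKind) (A B : DoodleDiagram) : Prop :=
  B.surface.bdry = ∅ ∧
  ∃ (ι : A.surface → B.surface) (m : ℕ) (d : Fin m × ℂ → B.surface),
    IsOrientedEmbedding ι ∧ Carries k A B ι ∧
    ContinuousOn d (univ ×ˢ Metric.closedBall 0 1) ∧
    InjOn d (univ ×ˢ Metric.closedBall 0 1) ∧
    range ι ∪ d '' (univ ×ˢ Metric.closedBall 0 1) = univ ∧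
    Disjoint (range ι) (d '' (univ ×ˢ Metric.ball 0 1)) ∧
    ι '' A.surface.bdry = d '' (univ ×ˢ Metric.sphere 0 1)

/-! ### The operations -/

/-- `B` is obtained from `A` by eliminating a `1`-handle, that is, by surgery along a simple closed
curve `a (Circle × {0})` which meets neither the boundary nor the diagram: the open regular
neighborhood `a (Circle × (-1, 1))` of the curve is removed, and closed disks
`d ({true} × closedBall 0 1)` and `d ({false} × closedBall 0 1)` are glued to the two new boundary
circles `a (Circle × {1})` and `a (Circle × {-1})`. The map `φ` identifies what remains of the
surface of `A` with the complement of the two open disks in the surface of `B`. -/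
def HandleRemoval (k : DiagramKind) (A B : DoodleDiagram) : Prop :=
  ∃ (a : Circle × ℝ → A.surface) (d : Bool × ℂ → B.surface) (φ : A.surface → B.surface),
    IsOpenEmbedding a ∧ range a ⊆ A.surface.inner ∧ Disjoint (range a) A.image ∧
    IsOpenEmbedding d ∧ range d ⊆ B.surface.inner ∧
    ContinuousOn φ (a '' (univ ×ˢ Ioo (-1) 1))ᶜ ∧
    BijOn φ (a '' (univ ×ˢ Ioo (-1) 1))ᶜ (d '' (univ ×ˢ Metric.ball 0 1))ᶜ ∧
    OrientationPreservingOn φ (a '' (univ ×ˢ Ioo (-1) 1))ᶜ ∧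
    (∀ z : Circle, φ (a (z, 1)) = d (true, z) ∧ φ (a (z, -1)) = d (false, z)) ∧
    Carries k A B φ

/-- `B` is obtained from `A` by adding a `1`-handle: the interiors of two disjoint closed disks in
`A`, which meet neither the boundary nor the diagram, are removed, and a handle
`Circle × [-1, 1]` is glued to the two new boundary circles, so that the result is oriented by an
extension of the given orientation. In other words, `A` is obtained from `B` by eliminating
that handle. -/
def HandleAddition (k : DiagramKind) (A B : DoodleDiagram) : Prop := HandleRemoval k B A

/-- `B` is obtained from `A` by eliminating connected components of the ambient surface which are
disjoint from the diagram. (The components of a compact surface are open, so that the unions of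
components are the open and closed subsets; the image of `ι` is closed by compactness.) -/
def ComponentRemoval (k : DiagramKind) (A B : DoodleDiagram) : Prop :=
  ∃ ι : B.surface → A.surface, IsOrientedEmbedding ι ∧ IsOpen (range ι) ∧ Carries k B A ι

/-- An orientation-preserving homeomorphism of the ambient surfaces carries `A` to `B`. -/
def OrientedHomeomorphic (k : DiagramKind) (A B : DoodleDiagram) : Prop :=
  ∃ h : A.surface ≃ₜ B.surface, OrientationPreservingOn h univ ∧ Carries k A B h

/-- One of the operations changes `A` into `B`. -/
def Operation (k : DiagramKind) (A B : DoodleDiagram) : Prop :=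
  HandleAddition k A B ∨ HandleRemoval k A B ∨ ComponentRemoval k A B ∨ OrientedHomeomorphic k A B

/-- The equivalence relation generated by the operations. -/
def OperationEquivalent (k : DiagramKind) : DoodleDiagram → DoodleDiagram → Prop :=
  Relation.EqvGen (Operation k)

end Doodle

end

noncomputable section

namespace Doodle

open Set Filter Topology
open scoped Manifold NNReal

/-! ### Continuous logarithms -/

/-! From operations to stable equivalence. The complement of the open annulus removed in a handle
removal is a compact surface W. It embeds in the surface of A by inclusion and in that of B by `φ`,
so that A, W, B is a chain of two geotopies. An elimination of components, an orientation-preserving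
homeomorphism and a capping are single geotopies.

From stable equivalence to operations. A closed extension of a diagram is a closed surface into
which its ambient surface embeds, the diagrams corresponding to each other. Capping the third
surface of a geotopy gives a common closed extension of both diagrams
(`Geotopic.exists_closedExtension`). By induction on the chain it is enough that any two closed
extensions of one diagram A are related by operations, and for this each of them is compared with
one canonical capping (`Collar.operationEquivalent`). Let Z be a closed extension. Surgery on Z
along a curve parallel to each boundary component of A separates a copy of the capped surface of A
from pieces that do not meet the diagram, and these pieces are eliminated as components. The result
of the surgeries is never computed: a map into Z, defined on the capped surface outside the centers
of the caps, is extended over one center by each surgery (`IsSpreading.exists_surgery`). At the end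
it is an oriented embedding of a closed surface, whose image is open by invariance of domain, which
is exactly an elimination of components.

Everything is topological, and three tools carry the argument.

Local degree. A map f near x is lifted to logarithms: f(x + exp w) = f(x) + exp(F w), with F(w +
2πi) = F w + n·2πi. Existence of F is the lifting property of the exponential. The degree n is
multiplicative and, for injective maps, locally constant; a map of non-zero degree is open at the
point, by a winding number argument. This yields invariance of domain and of the boundary, the
orientation of the surfaces constructed, and the propagation of orientation along connected sets.

Ends. An open part of a surface whose ends are punctured planes can be closed up by one point per
end (`Ends.cap`) or truncated to the complement of the open unit disks (`Ends.core`). Both are given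
oriented atlases by comparing each chart with the original surface (`hasDegree_of_reference`).
Capping and surgery are instances of the former, cutting out an annulus is an instance of the
latter.

Collars. The boundary is a compact 1-manifold, hence a finite union of circles
(`exists_homeomorph_circles`), and it has a collar: an exterior collar is added and the boundary is
pushed through it chart by chart (`OrientedSurface.exists_push`). Collar minus boundary is then a
union of punctured planes, to which the construction of ends applies. -/

theorem isCoveringMap_circleExp : IsCoveringMap (Circle.exp : ℝ → Circle) := by
  have h := (AddCircle.isAddQuotientCoveringMap_coe (2 * Real.pi)).homeomorph_comp
    (AddCircle.homeomorphCircle (T := 2 * Real.pi) (by positivity))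
  convert h.isCoveringMap using 1
  ext t
  simp [AddCircle.homeomorphCircle_apply, AddCircle.toCircle_apply_mk]

/-- A contraction, read backwards, is a homotopy from a constant map to the direction of `g`. The
covering `Circle.exp` lifts it starting from a constant argument, and the final stage of the lift is
a continuous argument of `g`. -/
theorem exists_continuous_log {A : Type*} [TopologicalSpace A] [ContractibleSpace A]
    (g : C(A, ℂ)) (hg : ∀ a, g a ≠ 0) : ∃ L : C(A, ℂ), ∀ a, Complex.exp (L a) = g a := by
  obtain ⟨a₀, ⟨H⟩⟩ := id_nullhomotopic A
  let u : C(A, Circle) :=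
    ⟨fun a => ⟨g a / ‖g a‖, by simp [Submonoid.unitSphere, hg a]⟩, by
      refine Continuous.subtype_mk ?_ _
      exact g.continuous.div (by fun_prop) (fun a => by simpa using hg a)⟩
  let H' : C(unitInterval × A, Circle) := u.comp ⟨H.symm, H.symm.continuous⟩
  obtain ⟨t₀, ht₀⟩ := Circle.exp_surjective (u a₀)
  have h0 : ∀ a, H' (0, a) = Circle.exp ((ContinuousMap.const A t₀ : C(A, ℝ)) a) := by
    intro a; simp [H', ht₀]
  let Θ := isCoveringMap_circleExp.liftHomotopy H' (ContinuousMap.const A t₀) h0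
  have hΘ : ∀ a, Circle.exp (Θ (1, a)) = u a := by
    intro a
    have := congr_fun (isCoveringMap_circleExp.liftHomotopy_lifts H'
      (ContinuousMap.const A t₀) h0) (1, a)
    rw [Function.comp_apply] at this
    rw [this]
    simp [H']
  refine ⟨⟨fun a => (Real.log ‖g a‖ : ℂ) + (Θ (1, a) : ℂ) * Complex.I, ?_⟩, ?_⟩
  · refine Continuous.add ?_ (by fun_prop)
    refine Complex.continuous_ofReal.comp ?_
    exact Continuous.log (by fun_prop) (fun a => by simpa using hg a)
  · intro a
    have h1 := congrArg (Subtype.val) (hΘ a)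
    have h2 : Complex.exp ((Θ (1, a) : ℂ) * Complex.I) = g a / ‖g a‖ := by
      rw [Circle.coe_exp] at h1
      exact h1
    have h3 : (‖g a‖ : ℂ) ≠ 0 := by simpa using hg a
    simp only [ContinuousMap.coe_mk]
    rw [Complex.exp_add, h2, ← Complex.ofReal_exp, Real.exp_log (norm_pos_iff.2 (hg a))]
    field_simp

theorem exists_continuousOn_log {E : Type*} [AddCommGroup E] [Module ℝ E] [TopologicalSpace E]
    [ContinuousAdd E] [ContinuousSMul ℝ E] {s : Set E} (hs : Convex ℝ s) (hne : s.Nonempty)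
    {g : E → ℂ} (hg : ContinuousOn g s) (h0 : ∀ x ∈ s, g x ≠ 0) :
    ∃ L : E → ℂ, ContinuousOn L s ∧ ∀ x ∈ s, Complex.exp (L x) = g x := by
  classical
  have := hs.contractibleSpace hne
  obtain ⟨L, hL⟩ := exists_continuous_log (A := s) ⟨s.domRestrict g, hg.domRestrict⟩
    (fun a => h0 a a.2)
  refine ⟨fun x => if h : x ∈ s then L ⟨x, h⟩ else 0, ?_, ?_⟩
  · rw [continuousOn_iff_continuous_domRestrict]
    convert L.continuous using 1
    ext x
    simp
  · intro x hx
    simp only [hx, dite_true]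
    exact hL ⟨x, hx⟩

/-- The quotient of `D` by 2πi takes integer values. Its image is an interval, and an interval with
two different integers also contains a half-integer. -/
theorem exists_int_of_exp_eq_one {X : Type*} [TopologicalSpace X] {s : Set X}
    (hs : IsPreconnected s) {D : X → ℂ} (hD : ContinuousOn D s)
    (h : ∀ x ∈ s, Complex.exp (D x) = 1) :
    ∃ n : ℤ, ∀ x ∈ s, D x = n * (2 * Real.pi * Complex.I) := by
  have hpi : (2 * Real.pi * Complex.I : ℂ) ≠ 0 := Complex.two_pi_I_ne_zero
  rcases s.eq_empty_or_nonempty with rfl | ⟨a, ha⟩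
  · exact ⟨0, by simp⟩
  have hint : ∀ x ∈ s, ∃ n : ℤ, D x = n * (2 * Real.pi * Complex.I) := fun x hx =>
    Complex.exp_eq_one_iff.1 (h x hx)
  obtain ⟨n, hn⟩ := hint a ha
  refine ⟨n, fun x hx => ?_⟩
  obtain ⟨m, hm⟩ := hint x hx
  let R : X → ℝ := fun y => (D y / (2 * Real.pi * Complex.I)).re
  have hR : ContinuousOn R s := Complex.continuous_re.comp_continuousOn (hD.div_const _)
  have hRv : ∀ y ∈ s, ∀ k : ℤ, D y = k * (2 * Real.pi * Complex.I) → R y = k := by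
    intro y _ k hk
    simp only [R, hk]
    rw [mul_div_cancel_right₀ _ hpi]
    simp
  have hoc := (hs.image R hR).ordConnected
  have key : ∀ p q : ℤ, (p : ℝ) ∈ R '' s → (q : ℝ) ∈ R '' s → p < q → False := by
    intro p q hp hq hpq
    have h1 : ((p : ℝ) + 1 / 2) ∈ Set.Icc (p : ℝ) q := by
      constructor
      · linarith
      · have : (p : ℝ) + 1 ≤ q := by exact_mod_cast hpq
        linarith
    obtain ⟨y, hy, hyy⟩ := hoc.out hp hq h1
    obtain ⟨k, hk⟩ := hint y hy
    rw [hRv y hy k hk] at hyy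
    have : (2 * k : ℝ) = 2 * p + 1 := by linarith
    have : (2 * k : ℤ) = 2 * p + 1 := by exact_mod_cast this
    omega
  have hn' : (n : ℝ) ∈ R '' s := ⟨a, ha, hRv a ha n hn⟩
  have hm' : (m : ℝ) ∈ R '' s := ⟨x, hx, hRv x hx m hm⟩
  have : m = n := by
    rcases lt_trichotomy m n with h | h | h
    · exact (key _ _ hm' hn' h).elim
    · exact h
    · exact (key _ _ hn' hm' h).elim
  rw [hm, this]

theorem exists_int_of_exp_eq {X : Type*} [TopologicalSpace X] {s : Set X}
    (hs : IsPreconnected s) {F G : X → ℂ} (hF : ContinuousOn F s) (hG : ContinuousOn G s)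
    (h : ∀ x ∈ s, Complex.exp (F x) = Complex.exp (G x)) :
    ∃ n : ℤ, ∀ x ∈ s, F x = G x + n * (2 * Real.pi * Complex.I) := by
  obtain ⟨n, hn⟩ := exists_int_of_exp_eq_one hs (hF.sub hG) (fun x hx => by
    rw [Pi.sub_apply, Complex.exp_sub, h x hx, div_self (Complex.exp_ne_zero _)])
  exact ⟨n, fun x hx => by rw [← hn x hx, Pi.sub_apply]; ring⟩

/-! ### Local degrees of maps of the plane -/

/-- The half-plane of logarithms of the points of a punctured disk. -/
def leftPlane (c : ℝ) : Set ℂ := {w | w.re < c}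

theorem convex_leftPlane (c : ℝ) : Convex ℝ (leftPlane c) := convex_halfSpace_re_lt c

theorem nonempty_leftPlane (c : ℝ) : (leftPlane c).Nonempty :=
  ⟨((c - 1 : ℝ) : ℂ), by simp [leftPlane]⟩

/-- The full turn `2πi`. -/
def turn : ℂ := 2 * Real.pi * Complex.I

theorem turn_ne_zero : turn ≠ 0 := Complex.two_pi_I_ne_zero

theorem exp_int_turn (n : ℤ) : Complex.exp (n * turn) = 1 :=
  Complex.exp_eq_one_iff.2 ⟨n, rfl⟩

theorem exp_turn : Complex.exp turn = 1 := by simpa using exp_int_turn 1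

/-- `f` has local degree `n` at `x`, in terms of a lift of `f` to logarithms of punctured
neighborhoods. -/
def HasDegree (f : ℂ → ℂ) (x : ℂ) (n : ℤ) : Prop :=
  ∃ (c : ℝ) (F : ℂ → ℂ), ContinuousOn F (leftPlane c) ∧ ∀ w ∈ leftPlane c,
    f (x + Complex.exp w) = f x + Complex.exp (F w) ∧ F (w + turn) = F w + n * turn

theorem add_turn_mem {c : ℝ} {w : ℂ} (hw : w ∈ leftPlane c) (n : ℤ) :
    w + n * turn ∈ leftPlane c := by
  simpa [leftPlane, turn] using hw

theorem mem_leftPlane_mono {c d : ℝ} (h : c ≤ d) : leftPlane c ⊆ leftPlane d :=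
  fun _ hw => lt_of_lt_of_le hw h

theorem exp_mem_ball {c r : ℝ} (hr : 0 < r) (hc : c ≤ Real.log r) {w : ℂ}
    (hw : w ∈ leftPlane c) (x : ℂ) : x + Complex.exp w ∈ Metric.ball x r := by
  rw [mem_ball_iff_norm, add_sub_cancel_left, Complex.norm_exp]
  exact (Real.lt_log_iff_exp_lt hr).1 (lt_of_lt_of_le hw hc)

theorem HasDegree.mono {f : ℂ → ℂ} {x : ℂ} {n : ℤ} (h : HasDegree f x n) (c₀ : ℝ) :
    ∃ c ≤ c₀, ∃ F : ℂ → ℂ, ContinuousOn F (leftPlane c) ∧ ∀ w ∈ leftPlane c,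
    f (x + Complex.exp w) = f x + Complex.exp (F w) ∧ F (w + turn) = F w + n * turn := by
  obtain ⟨c, F, hF, h⟩ := h
  exact ⟨min c c₀, min_le_right _ _, F, hF.mono (mem_leftPlane_mono (min_le_left _ _)),
    fun w hw => h w (mem_leftPlane_mono (min_le_left _ _) hw)⟩

theorem HasDegree.congr {f g : ℂ → ℂ} {x : ℂ} {n : ℤ} (h : HasDegree f x n)
    (hfg : f =ᶠ[𝓝 x] g) : HasDegree g x n := by
  obtain ⟨r, hr, hb⟩ := Metric.eventually_nhds_iff_ball.1 hfg
  obtain ⟨c, hc, F, hF, h⟩ := h.mono (Real.log r)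
  refine ⟨c, F, hF, fun w hw => ⟨?_, (h w hw).2⟩⟩
  rw [← hb _ (exp_mem_ball hr hc hw x), ← hb x (Metric.mem_ball_self hr)]
  exact (h w hw).1

/-- Two lifts are logarithms of the same function on a connected half-plane, so they differ by a
constant and have the same increment over a full turn. -/
theorem HasDegree.unique {f : ℂ → ℂ} {x : ℂ} {m n : ℤ} (hm : HasDegree f x m)
    (hn : HasDegree f x n) : m = n := by
  obtain ⟨c, F, hF, h⟩ := hm
  obtain ⟨d, hd, G, hG, h'⟩ := hn.mono c
  obtain ⟨k, hk⟩ := exists_int_of_exp_eq (convex_leftPlane d).isPreconnected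
    (hF.mono (mem_leftPlane_mono hd)) hG (fun w hw => by
      have h1 := (h w (mem_leftPlane_mono hd hw)).1
      rw [(h' w hw).1] at h1
      exact (add_left_cancel h1).symm)
  obtain ⟨w, hw⟩ := nonempty_leftPlane d
  have hw' : w + turn ∈ leftPlane d := by simpa using add_turn_mem hw 1
  have h1 := hk w hw
  have h2 := hk _ hw'
  rw [(h w (mem_leftPlane_mono hd hw)).2, (h' w hw).2, h1] at h2
  have h3 : (m : ℂ) * turn = n * turn := by linear_combination h2
  exact_mod_cast mul_right_cancel₀ turn_ne_zero h3

theorem hasDegree_lift_add_int {F : ℂ → ℂ} {c : ℝ} {n : ℤ}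
    (h : ∀ w ∈ leftPlane c, F (w + turn) = F w + n * turn) (k : ℤ) :
    ∀ w ∈ leftPlane c, F (w + k * turn) = F w + (n * k : ℤ) * turn := by
  induction k using Int.induction_on with
  | zero => intro w _; simp
  | succ i ih =>
    intro w hw
    have h1 := h _ (add_turn_mem hw i)
    have h2 := ih w hw
    push_cast at *
    rw [show w + (i + 1) * turn = w + i * turn + turn by ring, h1, h2]
    ring
  | pred i ih =>
    intro w hw
    have h1 := h _ (add_turn_mem hw (-i - 1))
    have h2 := ih w hw
    push_cast at *
    rw [show w + (-(i : ℂ) - 1) * turn + turn = w + -i * turn by ring, h2] at h1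
    linear_combination -h1

/-- The lifts compose: continuity at `x` keeps the values of the inner lift in the domain of the
outer one, and `n` turns of the inner lift give `m * n` turns. -/
theorem HasDegree.comp {f g : ℂ → ℂ} {x : ℂ} {m n : ℤ} (hg : HasDegree g (f x) m)
    (hf : HasDegree f x n) (hc : ContinuousAt f x) : HasDegree (g ∘ f) x (m * n) := by
  obtain ⟨d, G, hG, hG'⟩ := hg
  obtain ⟨r, hr, hb⟩ := Metric.continuousAt_iff.1 hc (Real.exp d) (Real.exp_pos d)
  obtain ⟨c, hc', F, hF, hF'⟩ := hf.mono (Real.log r)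
  have hmap : ∀ w ∈ leftPlane c, F w ∈ leftPlane d := by
    intro w hw
    have h1 := hb (exp_mem_ball hr hc' hw x)
    rw [(hF' w hw).1, dist_eq_norm, add_sub_cancel_left, Complex.norm_exp] at h1
    exact Real.exp_lt_exp.1 h1
  refine ⟨c, G ∘ F, hG.comp hF hmap, fun w hw => ⟨?_, ?_⟩⟩
  · simp only [Function.comp_apply]
    rw [(hF' w hw).1, (hG' _ (hmap w hw)).1]
  · simp only [Function.comp_apply]
    rw [(hF' w hw).2, hasDegree_lift_add_int (fun w hw => (hG' w hw).2) n _ (hmap w hw)]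

theorem hasDegree_id (x : ℂ) : HasDegree id x 1 :=
  ⟨0, id, continuousOn_id, fun w _ => by simp⟩

theorem hasDegree_conj (x : ℂ) : HasDegree (starRingEnd ℂ) x (-1) :=
  ⟨0, starRingEnd ℂ, Complex.continuous_conj.continuousOn, fun w _ => by
    simp [Complex.exp_conj, turn, Complex.conj_ofNat]⟩

/-- The function f(y + exp w) − f(y) has no zeros by injectivity, so it has a logarithm jointly in y
and w over a convex set. Its increment over a turn of w is then a single integer for all centers y.
Radii are halved so that y + exp w stays in the given ball. -/
theorem exists_hasDegree_ball {f : ℂ → ℂ} {x : ℂ} {r : ℝ} (hr : 0 < r)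
    (hf : ContinuousOn f (Metric.ball x r)) (hi : InjOn f (Metric.ball x r)) :
    ∃ n : ℤ, ∀ y ∈ Metric.ball x (r / 2), HasDegree f y n := by
  have hr2 : 0 < r / 2 := by positivity
  let S : Set (ℂ × ℂ) := Metric.ball x (r / 2) ×ˢ leftPlane (Real.log (r / 2))
  have hS : Convex ℝ S := (convex_ball _ _).prod (convex_leftPlane _)
  have hmem : ∀ p ∈ S, p.1 + Complex.exp p.2 ∈ Metric.ball x r ∧ p.1 ∈ Metric.ball x r := by
    rintro ⟨y, w⟩ ⟨hy, hw⟩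
    have h1 := exp_mem_ball hr2 le_rfl hw y
    simp only [Metric.mem_ball] at *
    refine ⟨?_, by linarith⟩
    calc dist (y + Complex.exp w) x ≤ dist (y + Complex.exp w) y + dist y x := dist_triangle _ _ _
      _ < r := by linarith
  obtain ⟨L, hL, hL'⟩ := exists_continuousOn_log hS
    ⟨(x, _), Metric.mem_ball_self hr2, (nonempty_leftPlane _).some_mem⟩
    (g := fun p => f (p.1 + Complex.exp p.2) - f p.1)
    (ContinuousOn.sub
      (hf.comp (by fun_prop) (fun p hp => (hmem p hp).1))
      (hf.comp (by fun_prop) (fun p hp => (hmem p hp).2)))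
    (fun p hp h => by
      have := hi (hmem p hp).1 (hmem p hp).2 (sub_eq_zero.1 h)
      simp [Complex.exp_ne_zero] at this)
  have hT : ∀ p ∈ S, (p.1, p.2 + turn) ∈ S := by
    rintro ⟨y, w⟩ ⟨hy, hw⟩
    exact ⟨hy, by simpa using add_turn_mem hw 1⟩
  obtain ⟨n, hn⟩ := exists_int_of_exp_eq hS.isPreconnected (F := fun p => L (p.1, p.2 + turn))
    (G := L) (hL.comp (by fun_prop) hT) hL (fun p hp => by
      rw [hL' _ hp, hL' _ (hT p hp)]
      simp [Complex.exp_add, exp_turn])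
  refine ⟨n, fun y hy => ⟨Real.log (r / 2), fun w => L (y, w), ?_, fun w hw => ⟨?_, ?_⟩⟩⟩
  · exact hL.comp (by fun_prop) (fun w hw => ⟨hy, hw⟩)
  · rw [hL' (y, w) ⟨hy, hw⟩]; simp
  · exact hn (y, w) ⟨hy, hw⟩

theorem exists_hasDegree_nhds {f : ℂ → ℂ} {x : ℂ} {U : Set ℂ} (hU : U ∈ 𝓝 x)
    (hf : ContinuousOn f U) (hi : InjOn f U) :
    ∃ n : ℤ, ∀ᶠ y in 𝓝 x, HasDegree f y n := by
  obtain ⟨r, hr, hb⟩ := Metric.mem_nhds_iff.1 hU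
  obtain ⟨n, hn⟩ := exists_hasDegree_ball hr (hf.mono hb) (hi.mono hb)
  exact ⟨n, Filter.mem_of_superset (Metric.ball_mem_nhds x (by positivity)) hn⟩

/-- The image of a small circle has winding number `n` around `f x`. Moving the base point along a
segment that stays off this curve does not change the winding number. Around a value omitted on the
whole disk it would be zero. -/
theorem HasDegree.eventually_mem_image {f : ℂ → ℂ} {x : ℂ} {n : ℤ} (h : HasDegree f x n)
    (hn : n ≠ 0) {r : ℝ} (hr : 0 < r) (hf : ContinuousOn f (Metric.closedBall x r)) :
    ∀ᶠ v in 𝓝 (f x), v ∈ f '' Metric.closedBall x r := by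
  obtain ⟨c, hc, F, hF, hF'⟩ := h.mono (Real.log r)
  -- In the coordinate of logarithms this vertical line is a circle around `x` of radius e^(c−1),
  -- which is smaller than `r`.
  let p : ℝ → ℂ := fun t => ((c - 1 : ℝ) : ℂ) + t * Complex.I
  have hp : ∀ t, p t ∈ leftPlane c := fun t => by simp [p, leftPlane]
  have hpc : Continuous p := by fun_prop
  have hpt : ∀ t, p (t + 2 * Real.pi) = p t + turn := fun t => by simp [p, turn]; ring
  have hpb : ∀ t, x + Complex.exp (p t) ∈ Metric.closedBall x r := fun t =>
    Metric.ball_subset_closedBall (exp_mem_ball hr hc (hp t) x)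
  have hγ : Continuous fun t => f (x + Complex.exp (p t)) :=
    hf.comp_continuous (by fun_prop) hpb
  have hbdd : ∃ δ > 0, ∀ t, δ ≤ ‖f (x + Complex.exp (p t)) - f x‖ := by
    have hK : IsCompact (Icc 0 (2 * Real.pi)) := isCompact_Icc
    obtain ⟨t₀, -, ht₀⟩ := hK.exists_isMinOn ⟨0, by simp [Real.pi_pos.le]⟩
      (f := fun t => ‖f (x + Complex.exp (p t)) - f x‖)
      (hγ.sub continuous_const).norm.continuousOn
    refine ⟨‖f (x + Complex.exp (p t₀)) - f x‖, ?_, fun t => ?_⟩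
    · rw [(hF' _ (hp t₀)).1, add_sub_cancel_left]
      exact norm_pos_iff.2 (Complex.exp_ne_zero _)
    · have hper : Function.Periodic (fun t => ‖f (x + Complex.exp (p t)) - f x‖)
          (2 * Real.pi) := fun t => by
        simp only [hpt, Complex.exp_add, exp_turn, mul_one]
      obtain ⟨s, hs, hs'⟩ := hper.exists_mem_Ico₀ Real.two_pi_pos t
      rw [hs']
      exact ht₀ (Ico_subset_Icc_self hs)
  obtain ⟨δ, hδ, hmin⟩ := hbdd
  filter_upwards [Metric.ball_mem_nhds (f x) hδ] with v hv
  by_contra hv'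
  rw [mem_ball_iff_norm] at hv
  -- The first coordinate moves the base point from `f x` to `v`, the second runs along the curve.
  -- The constant `k` below is the winding number of the curve, common to all base points on the
  -- segment.
  let S : Set (ℝ × ℝ) := Icc 0 1 ×ˢ univ
  have hS : Convex ℝ S := (convex_Icc _ _).prod convex_univ
  obtain ⟨L, hL, hL'⟩ := exists_continuousOn_log hS ⟨(0, 0), by simp [S]⟩
    (g := fun q => f (x + Complex.exp (p q.2)) - (f x + q.1 * (v - f x)))
    (Continuous.continuousOn (Continuous.sub (hγ.comp continuous_snd) (by fun_prop)))
    (fun q hq h => by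
      have h1 := hmin q.2
      have h2 : f (x + Complex.exp (p q.2)) - f x = q.1 * (v - f x) := by linear_combination h
      rw [h2, norm_mul] at h1
      have h3 : ‖(q.1 : ℂ)‖ ≤ 1 := by
        rw [Complex.norm_real, Real.norm_eq_abs, abs_le]
        exact ⟨by linarith [hq.1.1], hq.1.2⟩
      have := mul_le_mul_of_nonneg_right h3 (norm_nonneg (v - f x))
      linarith)
  obtain ⟨k, hk⟩ := exists_int_of_exp_eq hS.isPreconnected
    (F := fun q => L (q.1, q.2 + 2 * Real.pi)) (G := L)
    (hL.comp (by fun_prop) (fun q hq => ⟨hq.1, trivial⟩)) hL (fun q hq => by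
      rw [hL' q hq, hL' (q.1, q.2 + 2 * Real.pi) ⟨hq.1, trivial⟩]
      simp only [hpt, Complex.exp_add, exp_turn, mul_one])
  have hk0 : k = n := by
    obtain ⟨m, hm⟩ := exists_int_of_exp_eq isPreconnected_univ (F := fun t => L (0, t))
      (G := fun t => F (p t))
      (hL.comp (Continuous.continuousOn (by fun_prop)) (fun t _ => by simp [S]))
      (hF.comp hpc.continuousOn (fun t _ => hp t)) (fun t _ => by
        rw [hL' _ (by simp [S])]
        simp [(hF' _ (hp t)).1])
    have h1 := hk (0, 0) (by simp [S])
    have h2 := hm 0 trivial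
    have h3 := hm (0 + 2 * Real.pi) trivial
    simp only at h1 h2 h3
    rw [h1, h2, hpt, (hF' _ (hp 0)).2] at h3
    have h4 : (k : ℂ) * turn = n * turn := by unfold turn at *; linear_combination h3
    exact_mod_cast mul_right_cancel₀ turn_ne_zero h4
  -- At the end of the segment, `f - v` has a logarithm on the whole disk, and this returns to its
  -- value after a turn.
  have hk1 : k = 0 := by
    obtain ⟨G, hG, hG'⟩ := exists_continuousOn_log (convex_closedBall x r)
      ⟨x, Metric.mem_closedBall_self hr.le⟩ (g := fun y => f y - v) (hf.sub continuousOn_const)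
      (fun y hy h => hv' ⟨y, hy, sub_eq_zero.1 h⟩)
    obtain ⟨m, hm⟩ := exists_int_of_exp_eq isPreconnected_univ (F := fun t => L (1, t))
      (G := fun t => G (x + Complex.exp (p t)))
      (hL.comp (Continuous.continuousOn (by fun_prop)) (fun t _ => by simp [S]))
      (hG.comp (Continuous.continuousOn (by fun_prop)) (fun t _ => hpb t)) (fun t _ => by
        rw [hL' _ (by simp [S]), hG' _ (hpb t)]
        simp)
    have h1 := hk (1, 0) (by simp [S])
    have h2 := hm 0 trivial
    have h3 := hm (0 + 2 * Real.pi) trivial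
    simp only at h1 h2 h3
    rw [h1, h2, hpt, Complex.exp_add (p 0), exp_turn, mul_one] at h3
    have h4 : (k : ℂ) * turn = (0 : ℤ) * turn := by unfold turn at *; push_cast; linear_combination h3
    exact_mod_cast mul_right_cancel₀ turn_ne_zero h4
  exact hn (hk0.symm.trans hk1)

theorem HasDegree.image_mem_nhds {f : ℂ → ℂ} {x : ℂ} {n : ℤ} (h : HasDegree f x n)
    (hn : n ≠ 0) {U V : Set ℂ} (hU : U ∈ 𝓝 x) (hf : ContinuousOn f U) (hV : V ∈ 𝓝 x) :
    f '' V ∈ 𝓝 (f x) := by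
  obtain ⟨r, hr, hb⟩ := Metric.nhds_basis_closedBall.mem_iff.1 (Filter.inter_mem hU hV)
  refine Filter.mem_of_superset (h.eventually_mem_image hn hr
    (hf.mono (hb.trans inter_subset_left))) ?_
  exact image_mono (hb.trans inter_subset_right)

/-- The increment f(x + exp w) − f(x) is the product of exp w, of the derivative, and of a quotient
that is close to 1. The principal logarithm of this quotient is periodic in w, so only the first
factor contributes to the degree. -/
theorem hasDegree_of_hasDerivAt {f : ℂ → ℂ} {x f' : ℂ} (h : HasDerivAt f f' x) (hf' : f' ≠ 0)
    (hc : ∀ᶠ y in 𝓝 x, ContinuousAt f y) : HasDegree f x 1 := by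
  have hs := hasDerivAt_iff_tendsto_slope.1 h
  have hlim : Tendsto (fun y => slope f x y / f') (𝓝[≠] x) (𝓝 1) := by
    simpa [hf'] using hs.div_const f'
  have h1 : ∀ᶠ y in 𝓝[≠] x, slope f x y / f' ∈ Complex.slitPlane :=
    hlim (Complex.isOpen_slitPlane.mem_nhds (by simp))
  rw [eventually_nhdsWithin_iff] at h1
  obtain ⟨r, hr, hb⟩ := Metric.eventually_nhds_iff_ball.1 (h1.and hc)
  have hne : ∀ w, x + Complex.exp w ≠ x := fun w => by simp [Complex.exp_ne_zero]
  have hsl : ∀ w, slope f x (x + Complex.exp w) =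
      (f (x + Complex.exp w) - f x) / Complex.exp w := fun w => by
    simp [slope_def_field]
  refine ⟨Real.log r, fun w => w + Complex.log f' +
    Complex.log (slope f x (x + Complex.exp w) / f'), ?_, fun w hw => ⟨?_, ?_⟩⟩
  · refine ContinuousOn.add (by fun_prop) (ContinuousOn.clog ?_ ?_)
    · simp_rw [hsl]
      refine ContinuousOn.div_const (ContinuousOn.div (ContinuousOn.sub ?_ continuousOn_const)
        (by fun_prop) (fun w _ => Complex.exp_ne_zero _)) _
      intro w hw
      exact (ContinuousAt.comp (f := fun w => x + Complex.exp w)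
        ((hb _ (exp_mem_ball hr le_rfl hw x)).2) (by fun_prop)).continuousWithinAt
    · exact fun w hw => (hb _ (exp_mem_ball hr le_rfl hw x)).1 (hne w)
  · have h2 := Complex.slitPlane_ne_zero ((hb _ (exp_mem_ball hr le_rfl hw x)).1 (hne w))
    rw [Complex.exp_add, Complex.exp_add, Complex.exp_log hf', Complex.exp_log h2, hsl]
    have := Complex.exp_ne_zero w
    field_simp
    ring
  · simp only [Complex.exp_add, exp_turn, mul_one]
    push_cast
    ring

/-! ### Comparison with the definition of orientation preserving maps -/

/-- The identification of the Euclidean plane with the complex plane. -/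
def toC : Plane ≃ₜ ℂ where
  toFun x := ⟨x 0, x 1⟩
  invFun z := !₂[z.re, z.im]
  left_inv x := by ext i; fin_cases i <;> rfl
  right_inv z := by simp
  continuous_toFun := by
    have : (fun x : Plane => (⟨x 0, x 1⟩ : ℂ)) =
        fun x : Plane => (x 0 : ℂ) + (x 1 : ℂ) * Complex.I := by
      ext x; apply Complex.ext <;> simp
    rw [this]; fun_prop
  continuous_invFun := by
    refine (PiLp.continuous_toLp 2 _).comp (continuous_pi fun i => ?_)
    fin_cases i
    · exact Complex.continuous_re
    · exact Complex.continuous_im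

theorem toC_add (x y : Plane) : toC (x + y) = toC x + toC y := by
  apply Complex.ext <;> simp [toC]

theorem toC_sub (x y : Plane) : toC (x - y) = toC x - toC y := by
  apply Complex.ext <;> simp [toC]

theorem toC_smul (r : ℝ) (x : Plane) : toC (r • x) = r * toC x := by
  apply Complex.ext <;> simp [toC]

theorem toC_unitVec (t : ℝ) : toC (unitVec t) = Complex.exp (t * Complex.I) := by
  apply Complex.ext <;> simp [toC, unitVec, Complex.exp_ofReal_mul_I_re,
    Complex.exp_ofReal_mul_I_im]

theorem norm_toC (x : Plane) : ‖toC x‖ = ‖x‖ := by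
  rw [EuclideanSpace.norm_eq, Complex.norm_eq_sqrt_sq_add_sq]
  simp [toC]

/-- On the vertical line over log r, the imaginary part of the lift is an argument of `f` along the
circle of radius r. -/
theorem HasDegree.preservesOrientationAt {f : Plane → Plane} {x : Plane}
    (h : HasDegree (toC ∘ f ∘ toC.symm) (toC x) 1) : PreservesOrientationAt f x := by
  obtain ⟨c, F, hF, hF'⟩ := h
  filter_upwards [Ioo_mem_nhdsGT (Real.exp_pos c)] with r hr
  have hp : ∀ t : ℝ, (Real.log r : ℂ) + t * Complex.I ∈ leftPlane c := fun t => by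
    simpa [leftPlane] using (Real.log_lt_iff_lt_exp hr.1).2 hr.2
  have hF1 : ∀ t : ℝ, toC (f (x + r • unitVec t) - f x) =
      Complex.exp (F (Real.log r + t * Complex.I)) := fun t => by
    have h1 := (hF' _ (hp t)).1
    have h2 : toC x + Complex.exp (Real.log r + t * Complex.I) = toC (x + r • unitVec t) := by
      rw [toC_add, toC_smul, toC_unitVec, Complex.exp_add, ← Complex.ofReal_exp,
        Real.exp_log hr.1]
    rw [h2] at h1
    simp only [Function.comp_apply, Homeomorph.symm_apply_apply] at h1
    rw [toC_sub, h1, add_sub_cancel_left]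
  refine ⟨fun t => (F (Real.log r + t * Complex.I)).im, ⟨?_, fun t => ?_⟩, fun t => ?_⟩
  · exact Complex.continuous_im.comp (hF.comp_continuous (by fun_prop) hp)
  · have := (hF' _ (hp t)).2
    have h2 : (Real.log r : ℂ) + ((t + 2 * Real.pi : ℝ) : ℂ) * Complex.I =
        Real.log r + t * Complex.I + turn := by simp [turn]; ring
    simp only [h2, this]
    simp [turn]
  · apply toC.injective
    rw [toC_smul, toC_unitVec, ← norm_toC, hF1 t, Complex.norm_exp, Complex.ofReal_exp,
      ← Complex.exp_add, Complex.re_add_im]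

/-- A single radius suffices. The imaginary part of the lift and the given θ are arguments of the
same loop and differ by a constant, so their increments, n·2π and 2π, agree. -/
theorem HasDegree.eq_one_of_preservesOrientationAt {f : Plane → Plane} {x : Plane} {n : ℤ}
    (h : HasDegree (toC ∘ f ∘ toC.symm) (toC x) n) (h' : PreservesOrientationAt f x) : n = 1 := by
  obtain ⟨c, F, hF, hF'⟩ := h
  obtain ⟨r, ⟨θ, ⟨hθ, hθ'⟩, hr'⟩, hr⟩ :=
    (h'.and (Ioo_mem_nhdsGT (Real.exp_pos c))).exists
  have hp : ∀ t : ℝ, (Real.log r : ℂ) + t * Complex.I ∈ leftPlane c := fun t => by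
    simpa [leftPlane] using (Real.log_lt_iff_lt_exp hr.1).2 hr.2
  have hF1 : ∀ t : ℝ, toC (f (x + r • unitVec t) - f x) =
      Complex.exp (F (Real.log r + t * Complex.I)) := fun t => by
    have h1 := (hF' _ (hp t)).1
    have h2 : toC x + Complex.exp (Real.log r + t * Complex.I) = toC (x + r • unitVec t) := by
      rw [toC_add, toC_smul, toC_unitVec, Complex.exp_add, ← Complex.ofReal_exp,
        Real.exp_log hr.1]
    rw [h2] at h1
    simp only [Function.comp_apply, Homeomorph.symm_apply_apply] at h1
    rw [toC_sub, h1, add_sub_cancel_left]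
  have hFc : Continuous fun t : ℝ => F (Real.log r + t * Complex.I) :=
    hF.comp_continuous (by fun_prop) hp
  obtain ⟨k, hk⟩ := exists_int_of_exp_eq isPreconnected_univ
    (F := fun t : ℝ => ((F (Real.log r + t * Complex.I)).im : ℂ) * Complex.I)
    (G := fun t : ℝ => (θ t : ℂ) * Complex.I)
    ((Complex.continuous_ofReal.comp (Complex.continuous_im.comp hFc)).mul
      continuous_const).continuousOn
    ((Complex.continuous_ofReal.comp hθ).mul continuous_const).continuousOn (fun t _ => by
      have h1 := congrArg toC (hr' t)
      rw [toC_smul, toC_unitVec, ← norm_toC, hF1 t, Complex.norm_exp, Complex.ofReal_exp] at h1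
      rw [← mul_right_inj' (Complex.exp_ne_zero
        ((F (Real.log r + t * Complex.I)).re : ℂ)), ← h1, ← Complex.exp_add, Complex.re_add_im])
  have h1 := hk 0 trivial
  have h2 := hk (0 + 2 * Real.pi) trivial
  have h3 : (Real.log r : ℂ) + ((0 + 2 * Real.pi : ℝ) : ℂ) * Complex.I =
        Real.log r + (0 : ℝ) * Complex.I + turn := by simp [turn]
  simp only [h3, (hF' _ (hp 0)).2, hθ'] at h2
  have h4 : ((n * turn).im : ℂ) = n * (2 * Real.pi) := by
    simp [turn]
  rw [Complex.add_im, Complex.ofReal_add, h4] at h2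
  push_cast at h1 h2
  have h5 : (n : ℂ) * turn = (1 : ℤ) * turn := by
    unfold turn; push_cast; linear_combination h2 - h1
  exact_mod_cast mul_right_cancel₀ turn_ne_zero h5

/-! ### Planar charts -/

/-- The interior of the half-plane as a subset of the complex plane. -/
def halfC : OpenPartialHomeomorph HalfPlane ℂ where
  -- Only the source and the target are restricted. Both functions are the coordinates of the whole
  -- closed half-plane, and they are used there later for boundary points.
  toFun x := toC (model x)
  invFun z := model.symm (toC.symm z)
  source := {x | 0 < x.1 0}
  target := {z | 0 < z.re}
  map_source' x hx := hx
  map_target' z hz := by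
    have h : model (model.symm (toC.symm z)) = toC.symm z :=
      model.right_inv (by
        rw [range_modelWithCornersEuclideanHalfSpace]
        exact le_of_lt (show 0 < z.re from hz))
    change 0 < (model (model.symm (toC.symm z))) 0
    rw [h]
    exact hz
  left_inv' x _ := by simp only [Homeomorph.symm_apply_apply]; exact model.left_inv x
  right_inv' z hz := by
    have h : model (model.symm (toC.symm z)) = toC.symm z :=
      model.right_inv (by
        rw [range_modelWithCornersEuclideanHalfSpace]
        exact le_of_lt (show 0 < z.re from hz))
    rw [h]; simp
  open_source := isOpen_lt continuous_const
    ((EuclideanSpace.proj (𝕜 := ℝ) (0 : Fin 2)).continuous.comp continuous_subtype_val)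
  open_target := isOpen_lt continuous_const Complex.continuous_re
  continuousOn_toFun := (toC.continuous.comp model.continuous).continuousOn
  continuousOn_invFun := (model.continuous_symm.comp toC.symm.continuous).continuousOn

section
variable {X Y : Type*} [TopologicalSpace X] [TopologicalSpace Y]

/-- The restriction of a chart with values in the half-plane to the points with values in the
interior of the half-plane. -/
def planar (e : OpenPartialHomeomorph X HalfPlane) : OpenPartialHomeomorph X ℂ := e.trans halfC

theorem mem_planar_source {e : OpenPartialHomeomorph X HalfPlane} {x : X} :
    x ∈ (planar e).source ↔ x ∈ e.source ∧ 0 < (planar e x).re := by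
  rw [planar, OpenPartialHomeomorph.trans_source]
  rfl

theorem planar_re_nonneg (e : OpenPartialHomeomorph X HalfPlane) (x : X) :
    0 ≤ (planar e x).re := (e x).2

theorem planar_continuousOn (e : OpenPartialHomeomorph X HalfPlane) :
    ContinuousOn (planar e) e.source :=
  (toC.continuous.comp model.continuous).comp_continuousOn e.continuousOn

theorem planar_injOn (e : OpenPartialHomeomorph X HalfPlane) : InjOn (planar e) e.source :=
  fun _ hx _ hy h => e.injOn hx hy (model.injective (toC.injective h))

theorem mem_interior_range_iff (e : OpenPartialHomeomorph X HalfPlane) (x : X) :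
    e.extend model x ∈ interior (range model) ↔ 0 < (planar e x).re := by
  rw [interior_range_modelWithCornersEuclideanHalfSpace]
  rfl

/-- The target coordinate is only assumed continuous and injective on a set, so that half-plane
charts are allowed before the value of `f` is known to be an interior point. -/
theorem exists_nhds_coord {e : OpenPartialHomeomorph X ℂ} {e' : Y → ℂ} {t : Set Y}
    (he'c : ContinuousOn e' t) (he'i : InjOn e' t)
    {f : X → Y} {x : X} {U : Set X} (hU : U ∈ 𝓝 x) (hf : ContinuousOn f U) (hi : InjOn f U)
    (hx : x ∈ e.source) (ht : ∀ᶠ y in 𝓝 x, f y ∈ t) :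
    ∃ V ∈ 𝓝 (e x), ContinuousOn (e' ∘ f ∘ e.symm) V ∧ InjOn (e' ∘ f ∘ e.symm) V := by
  have h1 : U ∩ {y | f y ∈ t} ∈ 𝓝 (e.symm (e x)) := by
    rw [e.left_inv hx]
    exact Filter.inter_mem hU ht
  refine ⟨e.target ∩ e.symm ⁻¹' (U ∩ {y | f y ∈ t}), Filter.inter_mem
    (e.open_target.mem_nhds (e.map_source hx))
    (e.continuousAt_symm (e.map_source hx) h1), ?_, ?_⟩
  · refine he'c.comp (hf.comp (e.continuousOn_symm.mono inter_subset_left) ?_) ?_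
    · exact fun z hz => hz.2.1
    · exact fun z hz => hz.2.2
  · intro z hz w hw h
    exact e.symm.injOn hz.1 hw.1 (hi hz.2.1 hw.2.1 (he'i hz.2.2 hw.2.2 h))

/-- The first conclusion is invariance of the boundary. In coordinates the map has degree one, hence
its image is a neighborhood of the value; as this image lies in the closed half-plane, the value
cannot be on the edge. -/
theorem planar_degree_of_preservesOrientationAt {e : OpenPartialHomeomorph X HalfPlane}
    {e' : OpenPartialHomeomorph Y HalfPlane} {f : X → Y} {x : X} {U : Set X} (hU : U ∈ 𝓝 x)
    (hf : ContinuousOn f U) (hi : InjOn f U) (hx : x ∈ (planar e).source)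
    (hfx : f x ∈ e'.source)
    (h : PreservesOrientationAt (e'.extend model ∘ f ∘ (e.extend model).symm)
      (e.extend model x)) :
    f x ∈ (planar e').source ∧ HasDegree (planar e' ∘ f ∘ (planar e).symm) (planar e x) 1 := by
  have hx' : (planar e).symm (planar e x) = x := (planar e).left_inv hx
  obtain ⟨V, hV, hVc, hVi⟩ := exists_nhds_coord (planar_continuousOn e') (planar_injOn e') hU hf hi
    hx ((hf.continuousAt hU) (e'.open_source.mem_nhds hfx))
  obtain ⟨n, hn⟩ := exists_hasDegree_nhds hV hVc hVi
  have hn1 : n = 1 := HasDegree.eq_one_of_preservesOrientationAt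
    (f := e'.extend model ∘ f ∘ (e.extend model).symm) (x := e.extend model x)
    hn.self_of_nhds h
  rw [hn1] at hn
  refine ⟨mem_planar_source.2 ⟨hfx, ?_⟩, hn.self_of_nhds⟩
  have h1 := hn.self_of_nhds.image_mem_nhds one_ne_zero hV hVc hV
  have h2 : planar e' (f x) ∈ interior {z : ℂ | 0 ≤ z.re} := by
    rw [mem_interior_iff_mem_nhds]
    have h3 : (planar e' ∘ f ∘ (planar e).symm) (planar e x) = planar e' (f x) := by
      simp only [Function.comp_apply, hx']
    rw [h3] at h1
    refine Filter.mem_of_superset h1 ?_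
    rintro _ ⟨z, -, rfl⟩
    exact planar_re_nonneg _ _
  rw [Complex.interior_setOfPred_le_re] at h2
  exact h2

end

/-! ### Degrees of maps between oriented spaces -/

/-- An orientation of an open subset of `X` by charts in the plane. -/
class PlanarOriented (X : Type*) [TopologicalSpace X] where
  charts : Set (OpenPartialHomeomorph X ℂ)
  compat : ∀ φ ∈ charts, ∀ ψ ∈ charts, ∀ x ∈ φ.source, x ∈ ψ.source →
    HasDegree (ψ ∘ φ.symm) (φ x) 1

instance : PlanarOriented ℂ where
  charts := {OpenPartialHomeomorph.refl ℂ}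
  compat := by
    rintro _ rfl _ rfl x - -
    exact hasDegree_id x

section
variable {X Y Z : Type*} [TopologicalSpace X] [TopologicalSpace Y] [TopologicalSpace Z]
  [PlanarOriented X] [PlanarOriented Y] [PlanarOriented Z]

variable (X) in
/-- The points that are in the domain of an oriented chart. -/
def regular : Set X := ⋃ φ ∈ PlanarOriented.charts (X := X), φ.source

theorem mem_regular {x : X} :
    x ∈ regular X ↔ ∃ φ ∈ PlanarOriented.charts (X := X), x ∈ φ.source := by
  simp [regular]

theorem isOpen_regular : IsOpen (regular X) := isOpen_biUnion fun φ _ => φ.open_source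

theorem regular_complex : regular ℂ = univ :=
  eq_univ_of_forall fun _ => mem_regular.2 ⟨_, rfl, trivial⟩

/-- The map `f` has degree `n` at `x`. -/
def DegAt (f : X → Y) (x : X) (n : ℤ) : Prop :=
  ∃ φ ∈ PlanarOriented.charts (X := X), ∃ ψ ∈ PlanarOriented.charts (X := Y),
    x ∈ φ.source ∧ f x ∈ ψ.source ∧ HasDegree (ψ ∘ f ∘ φ.symm) (φ x) n

theorem DegAt.mem_regular {f : X → Y} {x : X} {n : ℤ} (h : DegAt f x n) : x ∈ regular X := by
  obtain ⟨φ, hφ, _, _, hx, _⟩ := h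
  exact Doodle.mem_regular.2 ⟨φ, hφ, hx⟩

theorem DegAt.map_mem_regular {f : X → Y} {x : X} {n : ℤ} (h : DegAt f x n) :
    f x ∈ regular Y := by
  obtain ⟨_, _, ψ, hψ, _, hx, _⟩ := h
  exact Doodle.mem_regular.2 ⟨ψ, hψ, hx⟩

/-- Independence of the charts: changes of oriented charts have degree 1, and degrees multiply. -/
theorem DegAt.hasDegree {f : X → Y} {x : X} {n : ℤ} (h : DegAt f x n) (hf : ContinuousAt f x)
    {φ : OpenPartialHomeomorph X ℂ} (hφ : φ ∈ PlanarOriented.charts (X := X))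
    {ψ : OpenPartialHomeomorph Y ℂ} (hψ : ψ ∈ PlanarOriented.charts (X := Y))
    (hx : x ∈ φ.source) (hy : f x ∈ ψ.source) : HasDegree (ψ ∘ f ∘ φ.symm) (φ x) n := by
  obtain ⟨φ', hφ', ψ', hψ', hx', hy', h⟩ := h
  have h1 := PlanarOriented.compat φ hφ φ' hφ' x hx hx'
  have h2 := PlanarOriented.compat ψ' hψ' ψ hψ (f x) hy' hy
  have e1 : (φ' ∘ φ.symm) (φ x) = φ' x := by simp [φ.left_inv hx]
  have e2 : (ψ' ∘ f ∘ φ'.symm) (φ' x) = ψ' (f x) := by simp [φ'.left_inv hx']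
  have c1 : ContinuousAt φ.symm (φ x) := φ.continuousAt_symm (φ.map_source hx)
  have c2 : ContinuousAt (φ' ∘ φ.symm) (φ x) := by
    refine ContinuousAt.comp ?_ c1
    rw [φ.left_inv hx]; exact φ'.continuousAt hx'
  have c3 : ContinuousAt (ψ' ∘ f ∘ φ'.symm) (φ' x) := by
    have c4 : ContinuousAt (f ∘ φ'.symm) (φ' x) := by
      refine ContinuousAt.comp ?_ (φ'.continuousAt_symm (φ'.map_source hx'))
      rwa [φ'.left_inv hx']
    refine ContinuousAt.comp ?_ c4
    simp only [Function.comp_apply, φ'.left_inv hx']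
    exact ψ'.continuousAt hy'
  rw [← e2] at h2
  have h3 := (h2.comp h c3)
  rw [← e1] at h3
  have h4 := h3.comp h1 c2
  simp only [mul_one, one_mul] at h4
  refine h4.congr ?_
  have hx1 : ∀ᶠ z in 𝓝 (φ x), φ.symm z ∈ φ'.source :=
    c1 (by rw [φ.left_inv hx]; exact φ'.open_source.mem_nhds hx')
  have c5 : ContinuousAt (f ∘ φ.symm) (φ x) := by
    refine ContinuousAt.comp ?_ c1
    rwa [φ.left_inv hx]
  have hx2 : ∀ᶠ z in 𝓝 (φ x), f (φ.symm z) ∈ ψ'.source :=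
    c5 (by simp only [Function.comp_apply, φ.left_inv hx]; exact ψ'.open_source.mem_nhds hy')
  filter_upwards [hx1, hx2] with z hz1 hz2
  simp only [Function.comp_apply]
  rw [φ'.left_inv hz1, ψ'.left_inv hz2]

theorem DegAt.unique {f : X → Y} {x : X} {m n : ℤ} (h : DegAt f x m) (h' : DegAt f x n)
    (hf : ContinuousAt f x) : m = n := by
  obtain ⟨φ, hφ, ψ, hψ, hx, hy, h⟩ := h
  exact h.unique (h'.hasDegree hf hφ hψ hx hy)

theorem DegAt.congr {f g : X → Y} {x : X} {n : ℤ} (h : DegAt f x n) (hfg : f =ᶠ[𝓝 x] g) :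
    DegAt g x n := by
  obtain ⟨φ, hφ, ψ, hψ, hx, hy, h⟩ := h
  refine ⟨φ, hφ, ψ, hψ, hx, by rwa [← hfg.self_of_nhds], h.congr ?_⟩
  have : ∀ᶠ z in 𝓝 (φ x), f (φ.symm z) = g (φ.symm z) :=
    (φ.continuousAt_symm (φ.map_source hx)).eventually (by rwa [φ.left_inv hx])
  filter_upwards [this] with z hz
  simp [hz]

theorem DegAt.comp {g : Y → Z} {f : X → Y} {x : X} {m n : ℤ} (hg : DegAt g (f x) m)
    (hf : DegAt f x n) (hgc : ContinuousAt g (f x)) (hfc : ContinuousAt f x) :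
    DegAt (g ∘ f) x (m * n) := by
  obtain ⟨φ, hφ, ψ, hψ, hx, hy, h⟩ := hf
  obtain ⟨χ, hχ, hz⟩ := Doodle.mem_regular.1 hg.map_mem_regular
  have h1 := hg.hasDegree hgc hψ hχ hy hz
  have e1 : (ψ ∘ f ∘ φ.symm) (φ x) = ψ (f x) := by simp [φ.left_inv hx]
  have c4 : ContinuousAt (f ∘ φ.symm) (φ x) := by
    refine ContinuousAt.comp ?_ (φ.continuousAt_symm (φ.map_source hx))
    rwa [φ.left_inv hx]
  have c3 : ContinuousAt (ψ ∘ f ∘ φ.symm) (φ x) := by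
    refine ContinuousAt.comp ?_ c4
    simp only [Function.comp_apply, φ.left_inv hx]
    exact ψ.continuousAt hy
  rw [← e1] at h1
  refine ⟨φ, hφ, χ, hχ, hx, hz, (h1.comp h c3).congr ?_⟩
  have hx2 : ∀ᶠ z in 𝓝 (φ x), f (φ.symm z) ∈ ψ.source :=
    c4 (by simp only [Function.comp_apply, φ.left_inv hx]; exact ψ.open_source.mem_nhds hy)
  filter_upwards [hx2] with z hz2
  simp only [Function.comp_apply]
  rw [ψ.left_inv hz2]

theorem degAt_id {x : X} (hx : x ∈ regular X) : DegAt (id : X → X) x 1 := by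
  obtain ⟨φ, hφ, hx⟩ := mem_regular.1 hx
  exact ⟨φ, hφ, φ, hφ, hx, hx, PlanarOriented.compat φ hφ φ hφ x hx hx⟩

theorem exists_degAt_eventually {f : X → Y} {x : X} {U : Set X} (hU : U ∈ 𝓝 x)
    (hf : ContinuousOn f U) (hi : InjOn f U) (hx : x ∈ regular X) (hy : f x ∈ regular Y) :
    ∃ n : ℤ, ∀ᶠ y in 𝓝 x, DegAt f y n := by
  obtain ⟨φ, hφ, hx⟩ := mem_regular.1 hx
  obtain ⟨ψ, hψ, hy⟩ := mem_regular.1 hy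
  have ht := (hf.continuousAt hU) (ψ.open_source.mem_nhds hy)
  obtain ⟨V, hV, hVc, hVi⟩ := exists_nhds_coord ψ.continuousOn ψ.injOn hU hf hi hx ht
  obtain ⟨n, hn⟩ := exists_hasDegree_nhds hV hVc hVi
  refine ⟨n, ?_⟩
  filter_upwards [(φ.continuousAt hx).eventually hn, φ.open_source.mem_nhds hx, ht]
    with y h1 h2 h3
  exact ⟨φ, hφ, ψ, hψ, h2, h3, h1⟩

/-- The degree of an injective map is locally constant, so the points near which it is `n` and those
near which it is not `n` form two disjoint open sets that cover `U`. -/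
theorem DegAt.of_isPreconnected {f : X → Y} {U : Set X} (hU : IsOpen U) (hU' : IsPreconnected U)
    (hf : ContinuousOn f U) (hi : InjOn f U) (hr : U ⊆ regular X) (hm : MapsTo f U (regular Y))
    {x : X} (hx : x ∈ U) {n : ℤ} (h : DegAt f x n) {y : X} (hy : y ∈ U) : DegAt f y n := by
  have key : ∀ z ∈ U, (∀ᶠ w in 𝓝 z, DegAt f w n) ∨ (∀ᶠ w in 𝓝 z, ¬ DegAt f w n) := by
    intro z hz
    obtain ⟨k, hk⟩ := exists_degAt_eventually (hU.mem_nhds hz) hf hi (hr hz) (hm hz)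
    by_cases hkn : k = n
    · left; rwa [hkn] at hk
    · right
      filter_upwards [hk, hU.mem_nhds hz] with w hw hwU h'
      exact hkn (hw.unique h' (hf.continuousAt (hU.mem_nhds hwU)))
  rcases isPreconnected_iff_subset_of_disjoint.1 hU' {z | ∀ᶠ w in 𝓝 z, DegAt f w n}
    {z | ∀ᶠ w in 𝓝 z, ¬ DegAt f w n} isOpen_setOfPred_eventually_nhds isOpen_setOfPred_eventually_nhds
    key (by
      ext z
      simp only [mem_inter_iff, mem_ofPred_eq, mem_empty_iff_false, iff_false]
      rintro ⟨-, h1, h2⟩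
      exact h2.self_of_nhds h1.self_of_nhds) with h1 | h1
  · exact (h1 hy).self_of_nhds
  · exact ((h1 hx).self_of_nhds h).elim

theorem DegAt.image_mem_nhds {f : X → Y} {x : X} {n : ℤ} (h : DegAt f x n) (hn : n ≠ 0)
    {U V : Set X} (hU : U ∈ 𝓝 x) (hf : ContinuousOn f U) (hV : V ∈ 𝓝 x) :
    f '' V ∈ 𝓝 (f x) := by
  obtain ⟨φ, hφ, ψ, hψ, hx, hy, h⟩ := h
  have ht := (hf.continuousAt hU) (ψ.open_source.mem_nhds hy)
  have hW : U ∩ {y | f y ∈ ψ.source} ∩ V ∈ 𝓝 (φ.symm (φ x)) := by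
    rw [φ.left_inv hx]
    exact Filter.inter_mem (Filter.inter_mem hU ht) hV
  have hW' : φ.target ∩ φ.symm ⁻¹' (U ∩ {y | f y ∈ ψ.source} ∩ V) ∈ 𝓝 (φ x) :=
    Filter.inter_mem (φ.open_target.mem_nhds (φ.map_source hx))
      (φ.continuousAt_symm (φ.map_source hx) hW)
  have h1 := h.image_mem_nhds hn hW' (ψ.continuousOn.comp
    (hf.comp (φ.continuousOn_symm.mono inter_subset_left) (fun z hz => hz.2.1.1))
    (fun z hz => hz.2.1.2)) hW'
  have e1 : (ψ ∘ f ∘ φ.symm) (φ x) = ψ (f x) := by simp [φ.left_inv hx]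
  rw [e1] at h1
  have h2 := ψ.symm.image_mem_nhds (ψ.map_source hy) h1
  rw [ψ.left_inv hy] at h2
  refine Filter.mem_of_superset h2 ?_
  rintro _ ⟨_, ⟨z, hz, rfl⟩, rfl⟩
  simp only [Function.comp_apply]
  rw [ψ.left_inv hz.2.1.2]
  exact mem_image_of_mem f hz.2.2

/-- The composition with the inverse is the identity, of degree 1, so both degrees are units of ℤ.
-/
theorem exists_degAt_openPartialHomeomorph (e : OpenPartialHomeomorph X Y) {x : X}
    (hx : x ∈ e.source) (hxr : x ∈ regular X) (hyr : e x ∈ regular Y) :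
    ∃ m n : ℤ, DegAt e x m ∧ DegAt e.symm (e x) n ∧ n * m = 1 := by
  obtain ⟨m, hm⟩ := exists_degAt_eventually (e.open_source.mem_nhds hx) e.continuousOn e.injOn
    hxr hyr
  obtain ⟨n, hn⟩ := exists_degAt_eventually (e.open_target.mem_nhds (e.map_source hx))
    e.continuousOn_symm e.symm.injOn hyr (by rwa [e.left_inv hx])
  refine ⟨m, n, hm.self_of_nhds, hn.self_of_nhds, ?_⟩
  have h1 := hn.self_of_nhds.comp hm.self_of_nhds (e.continuousAt_symm (e.map_source hx))
    (e.continuousAt hx)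
  refine DegAt.unique (h1.congr (g := id) ?_) (degAt_id hxr) continuousAt_id
  filter_upwards [e.open_source.mem_nhds hx] with y hy
  exact e.left_inv hy

theorem DegAt.symm {e : OpenPartialHomeomorph X Y} {x : X} (h : DegAt e x 1)
    (hx : x ∈ e.source) : DegAt e.symm (e x) 1 := by
  obtain ⟨m, n, hm, hn, hmn⟩ := exists_degAt_openPartialHomeomorph e hx h.mem_regular
    h.map_mem_regular
  obtain rfl := hm.unique h (e.continuousAt hx)
  rw [mul_one] at hmn
  rwa [hmn] at hn

end

/-! ### Oriented surfaces as oriented spaces -/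

theorem OrientedSurface.planar_compat {X : OrientedSurface} {e e' : OpenPartialHomeomorph X HalfPlane}
    (he : e ∈ atlas HalfPlane X) (he' : e' ∈ atlas HalfPlane X) {x : X}
    (hx : x ∈ (planar e).source) (hx' : x ∈ e'.source) :
    x ∈ (planar e').source ∧ HasDegree (planar e' ∘ (planar e).symm) (planar e x) 1 :=
  planar_degree_of_preservesOrientationAt (f := id) univ_mem continuousOn_id (injOn_id _) hx hx'
    (X.oriented e he e' he' x ⟨(mem_planar_source.1 hx).1, hx'⟩
      ((mem_interior_range_iff e x).2 (mem_planar_source.1 hx).2))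

instance (X : OrientedSurface) : PlanarOriented X where
  charts := planar '' atlas HalfPlane X
  compat := by
    rintro _ ⟨e, he, rfl⟩ _ ⟨e', he', rfl⟩ x hx hx'
    exact (OrientedSurface.planar_compat he he' hx (mem_planar_source.1 hx').1).2

/-- The interior is defined by the preferred chart at the point. That any other chart of the atlas
gives the same answer is invariance of the boundary, applied to changes of charts. -/
theorem OrientedSurface.mem_inner_iff {X : OrientedSurface} {e : OpenPartialHomeomorph X HalfPlane}
    (he : e ∈ atlas HalfPlane X) {x : X} (hx : x ∈ e.source) :
    x ∈ X.inner ↔ x ∈ (planar e).source := by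
  have h0 : x ∈ X.inner ↔ x ∈ (planar (chartAt HalfPlane x)).source := by
    rw [mem_planar_source, ← mem_interior_range_iff]
    simp only [mem_chart_source, true_and]
    rfl
  rw [h0]
  exact ⟨fun h => (planar_compat (chart_mem_atlas _ x) he h hx).1,
    fun h => (planar_compat he (chart_mem_atlas _ x) h (mem_chart_source _ x)).1⟩

theorem OrientedSurface.regular_eq (X : OrientedSurface) : regular X = X.inner := by
  ext x
  rw [mem_regular]
  constructor
  · rintro ⟨_, ⟨e, he, rfl⟩, hx⟩
    exact (mem_inner_iff he (mem_planar_source.1 hx).1).2 hx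
  · intro hx
    exact ⟨_, mem_image_of_mem _ (chart_mem_atlas _ x),
      (mem_inner_iff (chart_mem_atlas _ x) (mem_chart_source _ x)).1 hx⟩

theorem OrientedSurface.isOpen_inner (X : OrientedSurface) : IsOpen X.inner := by
  rw [← X.regular_eq]; exact isOpen_regular

theorem OrientedSurface.bdry_eq_compl (X : OrientedSurface) : X.bdry = X.innerᶜ :=
  (ModelWithCorners.compl_interior (I := model) (M := X)).symm

theorem OrientedSurface.isClosed_bdry (X : OrientedSurface) : IsClosed X.bdry := by
  rw [X.bdry_eq_compl]; exact X.isOpen_inner.isClosed_compl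

/-- The bridge from the definition in half-plane charts to degrees. The right-hand side also
contains that `f x` is an interior point; in the forward direction this comes from invariance of
domain. -/
theorem orientationPreservingOn_iff {X Y : OrientedSurface} {f : X → Y} {s : Set X}
    (hf : ContinuousOn f s) (hi : InjOn f s) :
    OrientationPreservingOn f s ↔ ∀ x ∈ interior s, x ∈ X.inner → DegAt f x 1 := by
  refine forall₃_congr fun x hx hxi => ?_
  have hs : s ∈ 𝓝 x := mem_interior_iff_mem_nhds.1 hx
  have hx' := (OrientedSurface.mem_inner_iff (chart_mem_atlas HalfPlane x)
    (mem_chart_source HalfPlane x)).1 hxi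
  constructor
  · intro h
    have := planar_degree_of_preservesOrientationAt hs hf hi hx' (mem_chart_source _ (f x)) h
    exact ⟨_, ⟨_, chart_mem_atlas _ x, rfl⟩, _, ⟨_, chart_mem_atlas _ (f x), rfl⟩, hx',
      this.1, this.2⟩
  · intro h
    have h1 := h.map_mem_regular
    rw [Y.regular_eq, OrientedSurface.mem_inner_iff (chart_mem_atlas HalfPlane (f x))
      (mem_chart_source HalfPlane (f x))] at h1
    exact HasDegree.preservesOrientationAt
      (f := writtenInExtChartAt model model x f) (x := extChartAt model x x)
      (h.hasDegree (hf.continuousAt hs) ⟨_, chart_mem_atlas _ x, rfl⟩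
        ⟨_, chart_mem_atlas _ (f x), rfl⟩ hx' h1)

theorem isOrientedEmbedding_iff {X Y : OrientedSurface} {f : X → Y} :
    IsOrientedEmbedding f ↔ Continuous f ∧ Function.Injective f ∧ ∀ x ∈ X.inner, DegAt f x 1 := by
  constructor
  · rintro ⟨h1, h2⟩
    refine ⟨h1.continuous, h1.injective, ?_⟩
    rw [orientationPreservingOn_iff h1.continuous.continuousOn h1.injective.injOn] at h2
    simpa using h2
  · rintro ⟨h1, h2, h3⟩
    refine ⟨(h1.isClosedEmbedding h2).isEmbedding, ?_⟩
    rw [orientationPreservingOn_iff h1.continuousOn h2.injOn]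
    simpa using h3

theorem IsOrientedEmbedding.map_inner {X Y : OrientedSurface} {f : X → Y}
    (hf : IsOrientedEmbedding f) {x : X} (hx : x ∈ X.inner) : f x ∈ Y.inner := by
  rw [← Y.regular_eq]
  exact ((isOrientedEmbedding_iff.1 hf).2.2 x hx).map_mem_regular

theorem IsOrientedEmbedding.comp {X Y Z : OrientedSurface} {g : Y → Z} {f : X → Y}
    (hg : IsOrientedEmbedding g) (hf : IsOrientedEmbedding f) : IsOrientedEmbedding (g ∘ f) := by
  have hg' := isOrientedEmbedding_iff.1 hg
  have hf' := isOrientedEmbedding_iff.1 hf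
  refine isOrientedEmbedding_iff.2 ⟨hg'.1.comp hf'.1, hg'.2.1.comp hf'.2.1, fun x hx => ?_⟩
  simpa using (hg'.2.2 _ (hf.map_inner hx)).comp (hf'.2.2 x hx) hg'.1.continuousAt
    hf'.1.continuousAt

theorem isOrientedEmbedding_id (X : OrientedSurface) : IsOrientedEmbedding (id : X → X) :=
  isOrientedEmbedding_iff.2 ⟨continuous_id, Function.injective_id, fun x hx =>
    degAt_id (by rwa [X.regular_eq])⟩

/-! ### Construction of oriented surfaces -/

/-- An oriented surface from a family of charts. -/
def OrientedSurface.ofCharts (X : Type) [TopologicalSpace X] [T2Space X] [CompactSpace X]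
    (c : X → OpenPartialHomeomorph X HalfPlane) (hc : ∀ x, x ∈ (c x).source)
    (h : ∀ x y z, z ∈ (planar (c x)).source → z ∈ (c y).source →
      HasDegree (planar (c y) ∘ (planar (c x)).symm) (planar (c x) z) 1) : OrientedSurface :=
  letI : ChartedSpace HalfPlane X :=
    { atlas := range c
      chartAt := c
      mem_chart_source := hc
      chart_mem_atlas := fun x => mem_range_self x }
  { carrier := X
    oriented := by
      rintro _ ⟨x, rfl⟩ _ ⟨y, rfl⟩ z ⟨hz, hz'⟩ hzi
      exact HasDegree.preservesOrientationAt
        (f := (c y).extend model ∘ ((c x).extend model).symm) (x := (c x).extend model z)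
        (h x y z (mem_planar_source.2 ⟨hz, (mem_interior_range_iff _ _).1 hzi⟩) hz') }

section
variable {X Y : Type*} [TopologicalSpace X] [TopologicalSpace Y] [PlanarOriented Y]

/-- If the change of charts has degree n, then comparing both charts with the reference map gives
1·n = 1. To orient a new surface it is therefore enough to compare each chart separately with the
old surface. -/
theorem hasDegree_of_reference {ρ : X → Y} {φ ψ : OpenPartialHomeomorph X ℂ} {x : X}
    (hx : x ∈ φ.source) (hx' : x ∈ ψ.source) (hρ : ContinuousAt ρ x)
    (h : DegAt (ρ ∘ φ.symm) (φ x) 1) (h' : DegAt (ρ ∘ ψ.symm) (ψ x) 1) :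
    HasDegree (ψ ∘ φ.symm) (φ x) 1 := by
  have hφ : φ x ∈ φ.target := φ.map_source hx
  have hψ : ψ x ∈ ψ.target := ψ.map_source hx'
  have c1 : ContinuousAt φ.symm (φ x) := φ.continuousAt_symm hφ
  have hx1 : ∀ᶠ z in 𝓝 (φ x), φ.symm z ∈ ψ.source :=
    c1 (by rw [φ.left_inv hx]; exact ψ.open_source.mem_nhds hx')
  have hU : φ.target ∩ {z | φ.symm z ∈ ψ.source} ∈ 𝓝 (φ x) :=
    Filter.inter_mem (φ.open_target.mem_nhds hφ) hx1
  have e1 : (ψ ∘ φ.symm) (φ x) = ψ x := by simp [φ.left_inv hx]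
  obtain ⟨n, hn⟩ := exists_degAt_eventually (f := ψ ∘ φ.symm) hU
    (ψ.continuousOn.comp (φ.continuousOn_symm.mono inter_subset_left) (fun z hz => hz.2))
    (fun z hz w hw h => φ.symm.injOn hz.1 hw.1 (ψ.injOn hz.2 hw.2 h))
    (by simp [regular_complex]) (by simp [regular_complex])
  have hn := hn.self_of_nhds
  have c2 : ContinuousAt (ψ ∘ φ.symm) (φ x) := by
    refine ContinuousAt.comp ?_ c1
    rw [φ.left_inv hx]; exact ψ.continuousAt hx'
  have c3 : ContinuousAt (ρ ∘ ψ.symm) (ψ x) := by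
    refine ContinuousAt.comp ?_ (ψ.continuousAt_symm hψ)
    rwa [ψ.left_inv hx']
  have c4 : ContinuousAt (ρ ∘ φ.symm) (φ x) := by
    refine ContinuousAt.comp ?_ c1
    rwa [φ.left_inv hx]
  rw [← e1] at h' c3
  have h2 := (h'.comp hn c3 c2).congr (g := ρ ∘ φ.symm) (by
    filter_upwards [hx1] with z hz
    simp only [Function.comp_apply]
    rw [ψ.left_inv hz])
  obtain rfl : n = 1 := by simpa using h2.unique h c4
  exact hn.hasDegree c2 (φ := OpenPartialHomeomorph.refl ℂ) rfl (ψ := OpenPartialHomeomorph.refl ℂ)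
    rfl trivial trivial

end

section
variable {X Y : Type*} [TopologicalSpace X] [TopologicalSpace Y]

/-- An open injective continuous map on an open set, as an open partial homeomorphism. -/
def ophOfInjOn [Nonempty X] (f : X → Y) (s : Set X) (hs : IsOpen s) (hc : ContinuousOn f s)
    (hi : InjOn f s) (ho : ∀ x ∈ s, ∀ V ∈ 𝓝 x, f '' V ∈ 𝓝 (f x)) : OpenPartialHomeomorph X Y :=
  OpenPartialHomeomorph.ofContinuousOpenRestrict (hi.toPartialEquiv f s) hc
    (by
      intro V hV
      rw [isOpen_iff_mem_nhds]
      rintro _ ⟨x, hx, rfl⟩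
      have h1 := (hs.isOpenMap_subtype_val V hV).mem_nhds (mem_image_of_mem _ hx)
      refine Filter.mem_of_superset (ho x x.2 _ h1) ?_
      rintro _ ⟨_, ⟨y, hy, rfl⟩, rfl⟩
      exact ⟨y, hy, rfl⟩) hs

/-- The chart with values in the half-plane given by a chart with values in the plane. -/
def ofPlanar (φ : OpenPartialHomeomorph X ℂ) : OpenPartialHomeomorph X HalfPlane :=
  φ.trans halfC.symm

theorem mem_ofPlanar_source {φ : OpenPartialHomeomorph X ℂ} {x : X} :
    x ∈ (ofPlanar φ).source ↔ x ∈ φ.source ∧ 0 < (φ x).re := by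
  rw [ofPlanar, OpenPartialHomeomorph.trans_source]
  rfl

theorem planar_ofPlanar_apply {φ : OpenPartialHomeomorph X ℂ} {x : X}
    (hx : x ∈ (ofPlanar φ).source) : planar (ofPlanar φ) x = φ x :=
  halfC.right_inv (show φ x ∈ halfC.target from (mem_ofPlanar_source.1 hx).2)

theorem planar_ofPlanar_source (φ : OpenPartialHomeomorph X ℂ) :
    (planar (ofPlanar φ)).source = (ofPlanar φ).source := by
  ext x
  rw [mem_planar_source]
  refine ⟨fun h => h.1, fun h => ⟨h, ?_⟩⟩
  rw [planar_ofPlanar_apply h]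
  exact (mem_ofPlanar_source.1 h).2

theorem planar_ofPlanar_symm_apply {φ : OpenPartialHomeomorph X ℂ} {z : ℂ} (hz : 0 < z.re) :
    (planar (ofPlanar φ)).symm z = φ.symm z :=
  congrArg φ.symm (halfC.right_inv (show z ∈ halfC.target from hz))

end

theorem degAt_symm_chart {X : Type*} [TopologicalSpace X] [PlanarOriented X]
    {φ : OpenPartialHomeomorph X ℂ} (hφ : φ ∈ PlanarOriented.charts (X := X)) {x : X}
    (hx : x ∈ φ.source) : DegAt φ.symm (φ x) 1 :=
  ⟨OpenPartialHomeomorph.refl ℂ, rfl, φ, hφ, trivial, by rwa [φ.left_inv hx],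
    (hasDegree_id _).congr (by
      filter_upwards [φ.open_target.mem_nhds (φ.map_source hx)] with z hz
      exact (φ.right_inv hz).symm)⟩

theorem degAt_chart {X : Type*} [TopologicalSpace X] [PlanarOriented X]
    {φ : OpenPartialHomeomorph X ℂ} (hφ : φ ∈ PlanarOriented.charts (X := X)) {x : X}
    (hx : x ∈ φ.source) : DegAt φ x 1 :=
  ⟨φ, hφ, OpenPartialHomeomorph.refl ℂ, rfl, hx, trivial, (hasDegree_id _).congr (by
      filter_upwards [φ.open_target.mem_nhds (φ.map_source hx)] with z hz
      exact (φ.right_inv hz).symm)⟩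

theorem degAt_complex {f : ℂ → ℂ} {z : ℂ} {n : ℤ} (h : HasDegree f z n) : DegAt f z n :=
  ⟨OpenPartialHomeomorph.refl ℂ, rfl, OpenPartialHomeomorph.refl ℂ, rfl, trivial, trivial, h⟩

theorem degAt_add (a z : ℂ) : DegAt (fun w => w + a) z 1 :=
  degAt_complex (hasDegree_of_hasDerivAt ((hasDerivAt_id z).add_const a) one_ne_zero
    (Filter.Eventually.of_forall fun _ => by fun_prop))

/-! ### Surfaces with ends -/

/-- The points of the plane bundle over `J` that are not on the zero section. -/
def punctured (J : Type*) : Set (J × ℂ) := {p | p.2 ≠ 0}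

/-- An open part `O` of a surface, together with finitely many ends of it. These are parametrized
by punctured planes, whose closed punctured unit disks have a relatively open complement, and whose
open punctured unit disks have a compact complement. -/
structure Ends (A : OrientedSurface) (J : Type) [TopologicalSpace J] where
  O : Set A
  e : J × ℂ → A
  isOpen_O : IsOpen O
  continuousOn_e : ContinuousOn e (punctured J)
  injOn_e : InjOn e (punctured J)
  mem_O : ∀ p ∈ punctured J, e p ∈ O
  deg_e : ∀ p ∈ punctured J, DegAt (fun z => e (p.1, z)) p.2 1
  isOpen_outer : IsOpen (O \ e '' (punctured J ∩ {p | ‖p.2‖ ≤ 1}))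
  isCompact_core : IsCompact (O \ e '' (punctured J ∩ {p | ‖p.2‖ < 1}))

theorem isOpen_punctured (J : Type*) [TopologicalSpace J] : IsOpen (punctured J) :=
  isOpen_ne_fun continuous_snd continuous_const

theorem continuousAt_slice {J X : Type*} [TopologicalSpace J] [TopologicalSpace X]
    {e : J × ℂ → X} (h : ContinuousOn e (punctured J)) {p : J × ℂ} (hp : p ∈ punctured J) :
    ContinuousAt (fun z => e (p.1, z)) p.2 :=
  ContinuousAt.comp (f := fun z => (p.1, z)) (h.continuousAt ((isOpen_punctured J).mem_nhds hp))
    (by fun_prop)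

namespace Ends

variable {A : OrientedSurface} {J : Type} [TopologicalSpace J]
  (E : Ends A J)

theorem mem_inner {p : J × ℂ} (hp : p ∈ punctured J) : E.e p ∈ A.inner := by
  rw [← A.regular_eq]
  exact (E.deg_e p hp).map_mem_regular

/-- The image of the slice through `p` alone is already a neighborhood, because the slice map has
degree 1. -/
theorem image_mem_nhds {p : J × ℂ} (hp : p ∈ punctured J) {V : Set (J × ℂ)} (hV : V ∈ 𝓝 p) :
    E.e '' V ∈ 𝓝 (E.e p) := by
  have hc : Continuous fun z : ℂ => (p.1, z) := by fun_prop
  have h1 : (fun z => (p.1, z)) ⁻¹' punctured J ∈ 𝓝 p.2 :=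
    hc.continuousAt ((isOpen_punctured J).mem_nhds hp)
  have h2 : (fun z => (p.1, z)) ⁻¹' V ∈ 𝓝 p.2 := hc.continuousAt hV
  have h3 := (E.deg_e p hp).image_mem_nhds one_ne_zero h1
    (E.continuousOn_e.comp hc.continuousOn (fun z hz => hz)) h2
  refine Filter.mem_of_superset h3 ?_
  rintro _ ⟨z, hz, rfl⟩
  exact ⟨_, hz, rfl⟩

theorem isOpen_image {V : Set (J × ℂ)} (hV : IsOpen V) (hV' : V ⊆ punctured J) :
    IsOpen (E.e '' V) := by
  rw [isOpen_iff_mem_nhds]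
  rintro _ ⟨p, hp, rfl⟩
  exact E.image_mem_nhds (hV' hp) (hV.mem_nhds hp)

/-- The surface obtained by closing up the ends by points. -/
def Cap : Type := E.O ⊕ J

/-- The inclusion of the open part. -/
def inl (x : E.O) : E.Cap := Sum.inl x

/-- The point at an end. -/
def inr (j : J) : E.Cap := Sum.inr j

open Classical in
/-- The disks around the points at the ends. -/
def disk (p : J × ℂ) : E.Cap :=
  if h : p ∈ punctured J then E.inl ⟨E.e p, E.mem_O p h⟩ else E.inr p.1

theorem disk_of_ne {p : J × ℂ} (h : p ∈ punctured J) :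
    E.disk p = E.inl ⟨E.e p, E.mem_O p h⟩ := dif_pos h

theorem disk_of_eq {p : J × ℂ} (h : p ∉ punctured J) : E.disk p = E.inr p.1 := dif_neg h

theorem disk_zero (j : J) : E.disk (j, 0) = E.inr j := E.disk_of_eq (by simp [punctured])

theorem inl_injective : Function.Injective E.inl := Sum.inl_injective

theorem inl_ne_inr (x : E.O) (j : J) : E.inl x ≠ E.inr j := Sum.inl_ne_inr

theorem disk_injective : Function.Injective E.disk := by
  rintro ⟨j, z⟩ ⟨k, w⟩ h
  by_cases hz : (j, z) ∈ punctured J <;> by_cases hw : (k, w) ∈ punctured J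
  · rw [E.disk_of_ne hz, E.disk_of_ne hw] at h
    exact E.injOn_e hz hw (congrArg Subtype.val (E.inl_injective h))
  · rw [E.disk_of_ne hz, E.disk_of_eq hw] at h
    exact (E.inl_ne_inr _ _ h).elim
  · rw [E.disk_of_eq hz, E.disk_of_ne hw] at h
    exact (E.inl_ne_inr _ _ h.symm).elim
  · rw [E.disk_of_eq hz, E.disk_of_eq hw] at h
    obtain rfl : z = 0 := by simpa [punctured] using hz
    obtain rfl : w = 0 := by simpa [punctured] using hw
    rw [show j = k from Sum.inr_injective h]

/-- The final topology for the two maps, which glues the open part and the full planes along the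
punctured planes. Both maps turn out to be open embeddings. -/
instance : TopologicalSpace E.Cap :=
  TopologicalSpace.coinduced E.inl inferInstance ⊔ TopologicalSpace.coinduced E.disk inferInstance

theorem isOpen_iff {U : Set E.Cap} : IsOpen U ↔ IsOpen (E.inl ⁻¹' U) ∧ IsOpen (E.disk ⁻¹' U) :=
  isOpen_sup

theorem continuous_inl : Continuous E.inl :=
  continuous_def.2 fun _ hU => (E.isOpen_iff.1 hU).1

theorem continuous_disk : Continuous E.disk :=
  continuous_def.2 fun _ hU => (E.isOpen_iff.1 hU).2

theorem isOpenEmbedding_inl : IsOpenEmbedding E.inl := by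
  refine .of_continuous_injective_isOpenMap E.continuous_inl E.inl_injective fun U hU => ?_
  refine E.isOpen_iff.2 ⟨by rwa [preimage_image_eq _ E.inl_injective], ?_⟩
  have h1 : E.disk ⁻¹' (E.inl '' U) = punctured J ∩ E.e ⁻¹' (Subtype.val '' U) := by
    ext p
    constructor
    · rintro ⟨x, hx, hxp⟩
      by_cases hp : p ∈ punctured J
      · rw [E.disk_of_ne hp] at hxp
        exact ⟨hp, x, hx, congrArg Subtype.val (E.inl_injective hxp)⟩
      · rw [E.disk_of_eq hp] at hxp
        exact (E.inl_ne_inr _ _ hxp).elim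
    · rintro ⟨hp, x, hx, hxp⟩
      refine ⟨x, hx, ?_⟩
      rw [E.disk_of_ne hp]
      exact congrArg E.inl (Subtype.ext hxp)
  rw [h1]
  exact E.continuousOn_e.isOpen_inter_preimage (isOpen_punctured J)
    (E.isOpen_O.isOpenMap_subtype_val U hU)

theorem isOpenEmbedding_disk : IsOpenEmbedding E.disk := by
  refine .of_continuous_injective_isOpenMap E.continuous_disk E.disk_injective fun V hV => ?_
  refine E.isOpen_iff.2 ⟨?_, by rwa [preimage_image_eq _ E.disk_injective]⟩
  have h1 : E.inl ⁻¹' (E.disk '' V) = Subtype.val ⁻¹' (E.e '' (V ∩ punctured J)) := by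
    ext x
    constructor
    · rintro ⟨p, hp, hxp⟩
      by_cases hp' : p ∈ punctured J
      · rw [E.disk_of_ne hp'] at hxp
        exact ⟨p, ⟨hp, hp'⟩, congrArg Subtype.val (E.inl_injective hxp)⟩
      · rw [E.disk_of_eq hp'] at hxp
        exact (E.inl_ne_inr _ _ hxp.symm).elim
    · rintro ⟨p, ⟨hp, hp'⟩, hxp⟩
      refine ⟨p, hp, ?_⟩
      rw [E.disk_of_ne hp']
      exact congrArg E.inl (Subtype.ext hxp)
  rw [h1]
  exact (E.isOpen_image (hV.inter (isOpen_punctured J)) inter_subset_right).preimage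
    continuous_subtype_val

theorem inr_mem_range (j : J) : E.inr j ∈ range E.disk := ⟨(j, 0), E.disk_zero j⟩

theorem eq_inl_or_inr (y : E.Cap) : (∃ x, y = E.inl x) ∨ ∃ j, y = E.inr j := by
  rcases y with x | j
  · exact Or.inl ⟨x, rfl⟩
  · exact Or.inr ⟨j, rfl⟩

theorem mem_outer_or_mem_range (x : E.O) :
    (x : A) ∈ E.O \ E.e '' (punctured J ∩ {p | ‖p.2‖ ≤ 1}) ∨ E.inl x ∈ range E.disk := by
  by_cases h : (x : A) ∈ E.e '' (punctured J ∩ {p | ‖p.2‖ ≤ 1})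
  · obtain ⟨p, hp, hpx⟩ := h
    right
    refine ⟨p, ?_⟩
    rw [E.disk_of_ne hp.1]
    exact congrArg E.inl (Subtype.ext hpx)
  · exact Or.inl ⟨x.2, h⟩

/-- Points in the image of one of the two Hausdorff pieces are separated there. The remaining pairs
are a new point and a point outside all closed unit disks; they are separated by the open unit disks
and the open set `isOpen_outer`. -/
instance [DiscreteTopology J] : T2Space E.Cap := by
  have hA : ∀ {W : Type} [TopologicalSpace W] [T2Space W] {f : W → E.Cap}, IsOpenEmbedding f →
      ∀ y ∈ range f, ∀ y' ∈ range f, y ≠ y' →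
      ∃ u v : Set E.Cap, IsOpen u ∧ IsOpen v ∧ y ∈ u ∧ y' ∈ v ∧ Disjoint u v := by
    rintro W _ _ f hf _ ⟨w, rfl⟩ _ ⟨w', rfl⟩ h
    obtain ⟨u, v, hu, hv, hwu, hwv, huv⟩ := t2_separation (fun h' => h (congrArg f h') : w ≠ w')
    exact ⟨f '' u, f '' v, hf.isOpenMap u hu, hf.isOpenMap v hv, mem_image_of_mem f hwu,
      mem_image_of_mem f hwv, (disjoint_image_iff hf.injective).2 huv⟩
  have hB : ∀ x : E.O, ∀ j : J,
      ∃ u v : Set E.Cap, IsOpen u ∧ IsOpen v ∧ E.inl x ∈ u ∧ E.inr j ∈ v ∧ Disjoint u v := by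
    intro x j
    rcases E.mem_outer_or_mem_range x with hx | hx
    · refine ⟨E.inl '' (Subtype.val ⁻¹' (E.O \ E.e '' (punctured J ∩ {p | ‖p.2‖ ≤ 1}))),
        E.disk '' {p | ‖p.2‖ < 1}, E.isOpenEmbedding_inl.isOpenMap _
          (E.isOpen_outer.preimage continuous_subtype_val), E.isOpenEmbedding_disk.isOpenMap _
          (isOpen_lt (by fun_prop) continuous_const), mem_image_of_mem _ hx,
          ⟨(j, 0), by simp, E.disk_zero j⟩, ?_⟩
      rw [Set.disjoint_left]
      rintro _ ⟨y, hy, rfl⟩ ⟨p, hp, hpy⟩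
      by_cases hp' : p ∈ punctured J
      · rw [E.disk_of_ne hp'] at hpy
        exact hy.2 ⟨p, ⟨hp', le_of_lt (show ‖p.2‖ < 1 from hp)⟩, congrArg Subtype.val (E.inl_injective hpy)⟩
      · rw [E.disk_of_eq hp'] at hpy
        exact (E.inl_ne_inr _ _ hpy.symm).elim
    · exact hA E.isOpenEmbedding_disk _ hx _ (E.inr_mem_range j) (E.inl_ne_inr x j)
  refine ⟨fun y y' h => ?_⟩
  rcases E.eq_inl_or_inr y with ⟨x, rfl⟩ | ⟨j, rfl⟩ <;>
    rcases E.eq_inl_or_inr y' with ⟨x', rfl⟩ | ⟨j', rfl⟩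
  · exact hA E.isOpenEmbedding_inl _ (mem_range_self x) _ (mem_range_self x') h
  · exact hB x j'
  · obtain ⟨u, v, hu, hv, h1, h2, h3⟩ := hB x' j
    exact ⟨v, u, hv, hu, h2, h1, h3.symm⟩
  · exact hA E.isOpenEmbedding_disk _ (E.inr_mem_range j) _ (E.inr_mem_range j') h

/-- The space is the union of the compact core and of finitely many closed unit disks. -/
instance [Finite J] : CompactSpace E.Cap := by
  have h1 : IsCompact (E.inl '' (Subtype.val ⁻¹' (E.O \ E.e '' (punctured J ∩ {p | ‖p.2‖ < 1})))) := by
    refine IsCompact.image ?_ E.continuous_inl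
    rw [Subtype.isCompact_iff, Subtype.image_preimage_coe]
    convert E.isCompact_core using 1
    exact inter_eq_right.2 sdiff_subset
  have h2 : IsCompact (E.disk '' (univ ×ˢ Metric.closedBall 0 1)) :=
    (isCompact_univ.prod (isCompact_closedBall _ _)).image E.continuous_disk
  refine ⟨(h1.union h2).of_isClosed_subset isClosed_univ fun y _ => ?_⟩
  rcases E.eq_inl_or_inr y with ⟨x, rfl⟩ | ⟨j, rfl⟩
  · by_cases h : (x : A) ∈ E.e '' (punctured J ∩ {p | ‖p.2‖ < 1})
    · obtain ⟨p, hp, hpx⟩ := h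
      refine Or.inr ⟨p, ⟨trivial, ?_⟩, ?_⟩
      · rw [mem_closedBall_zero_iff]; exact le_of_lt (show ‖p.2‖ < 1 from hp.2)
      · rw [E.disk_of_ne hp.1]
        exact congrArg E.inl (Subtype.ext hpx)
    · exact Or.inl (mem_image_of_mem _ ⟨x.2, h⟩)
  · exact Or.inr ⟨(j, 0), by simp, E.disk_zero j⟩

/-- The map from the closed-up surface to the original one. -/
def proj : E.Cap → A
  | Sum.inl x => x
  -- An arbitrary value: the map is only used on the open part.
  | Sum.inr j => E.e (j, 1)

theorem proj_inl (x : E.O) : E.proj (E.inl x) = x := rfl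

theorem proj_disk {p : J × ℂ} (hp : p ∈ punctured J) : E.proj (E.disk p) = E.e p := by
  rw [E.disk_of_ne hp]; rfl

theorem continuousAt_proj (x : E.O) : ContinuousAt E.proj (E.inl x) :=
  (E.isOpenEmbedding_inl.continuousAt_iff (g := E.proj)).1 continuous_subtype_val.continuousAt

/-- The map to the original surface as an open partial homeomorphism. -/
def projOph (y : E.Cap) : OpenPartialHomeomorph E.Cap A :=
  -- The argument `y` serves only as a witness of nonemptiness.
  haveI : Nonempty E.Cap := ⟨y⟩
  ophOfInjOn E.proj (range E.inl) E.isOpenEmbedding_inl.isOpen_range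
    (by rintro _ ⟨x, rfl⟩; exact (E.continuousAt_proj x).continuousWithinAt)
    (by rintro _ ⟨x, rfl⟩ _ ⟨x', rfl⟩ h; exact congrArg E.inl (Subtype.ext h))
    (by
      rintro _ ⟨x, rfl⟩ V hV
      have h1 := E.continuous_inl.continuousAt hV
      have h2 := E.isOpen_O.isOpenMap_subtype_val.image_mem_nhds h1
      refine Filter.mem_of_superset h2 ?_
      rintro _ ⟨y, hy, rfl⟩
      exact ⟨_, hy, rfl⟩)

theorem projOph_target (y : E.Cap) : (E.projOph y).target = E.O := by
  change E.proj '' range E.inl = E.O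
  rw [← range_comp]
  exact Subtype.range_val

theorem projOph_symm_apply (y : E.Cap) (x : E.O) : (E.projOph y).symm x = E.inl x :=
  (E.projOph y).left_inv (mem_range_self x)

/-- The disk around the point at an end. -/
def diskAt (j : J) (z : ℂ) : E.Cap := E.disk (j, z)

variable [DiscreteTopology J]

theorem isOpenEmbedding_diskAt (j : J) : IsOpenEmbedding (E.diskAt j) :=
  E.isOpenEmbedding_disk.comp (.of_continuous_injective_isOpenMap (by fun_prop)
    (Prod.mk_right_injective j) fun U hU => by
      have : Prod.mk j '' U = {j} ×ˢ U := by ext ⟨a, b⟩; simp [eq_comm, and_comm]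
      rw [this]
      exact (isOpen_discrete _).prod hU)

/-- The chart around the point at an end. -/
def diskChart (j : J) : OpenPartialHomeomorph E.Cap ℂ :=
  ((E.isOpenEmbedding_diskAt j).toOpenPartialHomeomorph (E.diskAt j)).symm.trans
    -- The shift by 1 moves the center of the disk into the open right half-plane, the only part
    -- that `ofPlanar` retains.
    (Homeomorph.addRight (1 : ℂ)).toOpenPartialHomeomorph

theorem diskChart_source (j : J) : (E.diskChart j).source = range (E.diskAt j) := by
  simp [diskChart]

theorem diskChart_apply (j : J) (z : ℂ) : E.diskChart j (E.diskAt j z) = z + 1 := by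
  have : ((E.isOpenEmbedding_diskAt j).toOpenPartialHomeomorph (E.diskAt j)).symm
    (E.diskAt j z) = z := IsOpenEmbedding.toOpenPartialHomeomorph_left_inv _ _
  simp [diskChart, this]

theorem diskChart_symm_apply (j : J) (z : ℂ) : (E.diskChart j).symm z = E.diskAt j (z - 1) := by
  rw [sub_eq_add_neg]
  rfl

/-- The charts of the closed-up surface. -/
def capChart : E.Cap → OpenPartialHomeomorph E.Cap HalfPlane
  | Sum.inl x => (E.projOph (E.inl x)).trans (chartAt HalfPlane (x : A))
  | Sum.inr j => ofPlanar (E.diskChart j)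

theorem capChart_inl (x : E.O) :
    E.capChart (E.inl x) = (E.projOph (E.inl x)).trans (chartAt HalfPlane (x : A)) := rfl

theorem capChart_inr (j : J) : E.capChart (E.inr j) = ofPlanar (E.diskChart j) := rfl

theorem mem_capChart_source (y : E.Cap) : y ∈ (E.capChart y).source := by
  rcases E.eq_inl_or_inr y with ⟨x, rfl⟩ | ⟨j, rfl⟩
  · rw [capChart_inl, OpenPartialHomeomorph.trans_source]
    exact ⟨mem_range_self x, mem_chart_source HalfPlane (x : A)⟩
  · rw [capChart_inr, mem_ofPlanar_source, diskChart_source]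
    have : E.inr j = E.diskAt j 0 := (E.disk_zero j).symm
    refine ⟨⟨0, this.symm⟩, ?_⟩
    rw [this, diskChart_apply]
    simp

theorem planar_trans {X Y : Type*} [TopologicalSpace X] [TopologicalSpace Y]
    (f : OpenPartialHomeomorph X Y) (e : OpenPartialHomeomorph Y HalfPlane) :
    planar (f.trans e) = f.trans (planar e) := OpenPartialHomeomorph.trans_assoc _ _ _

theorem mem_capChart_inl_source {x x' : E.O} :
    E.inl x' ∈ (E.capChart (E.inl x)).source ↔ (x' : A) ∈ (chartAt HalfPlane (x : A)).source := by
  rw [capChart_inl, OpenPartialHomeomorph.trans_source]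
  exact ⟨fun h => h.2, fun h => ⟨mem_range_self x', h⟩⟩

theorem mem_planar_capChart_inl_source {x x' : E.O} :
    E.inl x' ∈ (planar (E.capChart (E.inl x))).source ↔
      (x' : A) ∈ (planar (chartAt HalfPlane (x : A))).source := by
  rw [capChart_inl, planar_trans, OpenPartialHomeomorph.trans_source]
  exact ⟨fun h => h.2, fun h => ⟨mem_range_self x', h⟩⟩

theorem inr_notMem_capChart_inl_source (x : E.O) (j : J) :
    E.inr j ∉ (E.capChart (E.inl x)).source := by
  rw [capChart_inl, OpenPartialHomeomorph.trans_source]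
  rintro ⟨⟨x', hx'⟩, -⟩
  exact E.inl_ne_inr _ _ hx'

theorem inr_mem_capChart_inr_source {j k : J} (h : E.inr j ∈ (E.capChart (E.inr k)).source) :
    j = k := by
  rw [capChart_inr, mem_ofPlanar_source, diskChart_source] at h
  obtain ⟨⟨z, hz⟩, -⟩ := h
  rw [← E.disk_zero j] at hz
  exact (congrArg Prod.fst (E.disk_injective hz)).symm

/-- On the charts of the closed-up surface, the map to the original one preserves orientation. -/
theorem degAt_proj_capChart {x : E.O} {y : E.Cap}
    (h : E.inl x ∈ (planar (E.capChart y)).source) :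
    DegAt (E.proj ∘ (planar (E.capChart y)).symm) (planar (E.capChart y) (E.inl x)) 1 := by
  rcases E.eq_inl_or_inr y with ⟨x', rfl⟩ | ⟨j, rfl⟩
  · have hx := E.mem_planar_capChart_inl_source.1 h
    have h1 := degAt_symm_chart (X := A)
      (mem_image_of_mem planar (chart_mem_atlas HalfPlane (x' : A))) hx
    rw [capChart_inl, planar_trans] at h ⊢
    refine DegAt.congr (f := (planar (chartAt HalfPlane (x' : A))).symm) h1 ?_
    have hx2 : ∀ᶠ z in 𝓝 (planar (chartAt HalfPlane (x' : A)) x),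
        (planar (chartAt HalfPlane (x' : A))).symm z ∈ E.O :=
      (OpenPartialHomeomorph.continuousAt_symm _ (OpenPartialHomeomorph.map_source _ hx)) (by
        rw [OpenPartialHomeomorph.left_inv _ hx]
        exact E.isOpen_O.mem_nhds x.2)
    filter_upwards [hx2] with z hz
    exact ((E.projOph (E.inl x')).right_inv (by rwa [projOph_target])).symm
  · rw [capChart_inr] at h ⊢
    rw [planar_ofPlanar_source] at h
    rw [planar_ofPlanar_apply h]
    have h' := mem_ofPlanar_source.1 h
    obtain ⟨w, hw⟩ : E.inl x ∈ range (E.diskAt j) := by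
      rw [← diskChart_source]; exact h'.1
    rw [← hw, diskChart_apply] at h' ⊢
    have hw0 : (j, w) ∈ punctured J := by
      by_contra hw0
      exact E.inl_ne_inr _ _ (hw.symm.trans (E.disk_of_eq hw0))
    have h1 : DegAt (fun z => E.e (j, z)) (w + 1 + -1) 1 := by
      simpa using E.deg_e _ hw0
    have h2 := h1.comp (f := fun z => z + -1) (degAt_add (-1) (w + 1)) (by
      simpa using continuousAt_slice E.continuousOn_e hw0) (by fun_prop)
    refine DegAt.congr h2 ?_
    have h3 : ∀ᶠ z : ℂ in 𝓝 (w + 1), z - 1 ≠ 0 :=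
      ContinuousAt.eventually_ne (by fun_prop) (by simpa [punctured] using hw0)
    have h4 : ∀ᶠ z : ℂ in 𝓝 (w + 1), 0 < z.re :=
      (isOpen_lt continuous_const Complex.continuous_re).mem_nhds h'.2
    filter_upwards [h3, h4] with z hz hz'
    simp only [Function.comp_apply, planar_ofPlanar_symm_apply hz', diskChart_symm_apply, diskAt]
    rw [proj_disk E hz, sub_eq_add_neg]

/-- At points of the open part, both charts are compared with the original surface. A new point lies
in one chart only, where the change of charts is the identity. -/
theorem capChart_compat (x y z : E.Cap) (hx : z ∈ (planar (E.capChart x)).source)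
    (hy : z ∈ (E.capChart y).source) :
    HasDegree (planar (E.capChart y) ∘ (planar (E.capChart x)).symm)
      (planar (E.capChart x) z) 1 := by
  rcases E.eq_inl_or_inr z with ⟨a, rfl⟩ | ⟨k, rfl⟩
  · have h1 := E.degAt_proj_capChart hx
    -- The chart `x` shows that `a` is an interior point of the original surface, and this makes it
    -- an interior point for the chart `y`.
    have hy' : E.inl a ∈ (planar (E.capChart y)).source := by
      rcases E.eq_inl_or_inr y with ⟨y, rfl⟩ | ⟨j, rfl⟩
      · rw [mem_planar_capChart_inl_source]
        rw [mem_capChart_inl_source] at hy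
        rw [← OrientedSurface.mem_inner_iff (chart_mem_atlas HalfPlane _) hy, ← A.regular_eq]
        simpa [(planar (E.capChart x)).left_inv hx, proj_inl] using h1.map_mem_regular
      · rwa [capChart_inr, planar_ofPlanar_source]
    exact hasDegree_of_reference hx hy' (E.continuousAt_proj a) h1 (E.degAt_proj_capChart hy')
  · have key : ∀ {y : E.Cap}, E.inr k ∈ (E.capChart y).source → y = E.inr k := by
      intro y hy
      rcases E.eq_inl_or_inr y with ⟨y, rfl⟩ | ⟨j, rfl⟩
      · exact (E.inr_notMem_capChart_inl_source _ _ hy).elim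
      · rw [E.inr_mem_capChart_inr_source hy]
    obtain rfl := key hy
    obtain rfl := key (mem_planar_source.1 hx).1
    refine (hasDegree_id _).congr ?_
    filter_upwards [(planar (E.capChart (E.inr k))).open_target.mem_nhds
      ((planar (E.capChart (E.inr k))).map_source hx)] with w hw
    exact ((planar (E.capChart (E.inr k))).right_inv hw).symm

variable [Finite J]

/-- The closed-up surface. -/
def cap : OrientedSurface := OrientedSurface.ofCharts E.Cap E.capChart E.mem_capChart_source
  E.capChart_compat

instance : PlanarOriented E.Cap := inferInstanceAs (PlanarOriented E.cap)

theorem planar_capChart_mem (y : E.Cap) :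
    planar (E.capChart y) ∈ PlanarOriented.charts (X := E.Cap) :=
  mem_image_of_mem planar (mem_range_self y)

theorem degAt_proj {x : E.O} (hx : (x : A) ∈ A.inner) :
    DegAt E.proj (E.inl x) 1 := by
  have h1 : E.inl x ∈ (planar (E.capChart (E.inl x))).source := by
    rw [mem_planar_capChart_inl_source]
    exact (OrientedSurface.mem_inner_iff (chart_mem_atlas HalfPlane _) (mem_chart_source _ _)).1 hx
  have h2 := E.degAt_proj_capChart h1
  have h3 : DegAt (planar (E.capChart (E.inl x))) (E.inl x) 1 :=
    degAt_chart (E.planar_capChart_mem _) h1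
  have h4 := (planar (E.capChart (E.inl x))).left_inv h1
  have h5 := DegAt.comp h2 h3 (ContinuousAt.comp (by
      rw [h4]; exact E.continuousAt_proj x)
    ((planar (E.capChart (E.inl x))).continuousAt_symm ((planar _).map_source h1)))
    ((planar (E.capChart (E.inl x))).continuousAt h1)
  refine DegAt.congr h5 ?_
  filter_upwards [(planar (E.capChart (E.inl x))).open_source.mem_nhds h1] with w hw
  simp only [Function.comp_apply]
  rw [(planar _).left_inv hw]

theorem degAt_projOph_symm (y : E.Cap) {x : E.O} (hx : (x : A) ∈ A.inner) :
    DegAt (E.projOph y).symm (x : A) 1 :=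
  DegAt.symm (e := E.projOph y) (E.degAt_proj hx) (mem_range_self x)

/-- Away from the center the disk is the oriented parametrization of the end. At the center it is
the inverse of the chart there, up to the shift by 1. -/
theorem degAt_diskAt (j : J) (z : ℂ) : DegAt (E.diskAt j) z 1 := by
  by_cases hz : (j, z) ∈ punctured J
  · have h1 : DegAt (E.projOph (E.diskAt j z)).symm (E.e (j, z)) 1 :=
      E.degAt_projOph_symm _ (x := ⟨_, E.mem_O _ hz⟩) (E.mem_inner hz)
    have h2 := DegAt.comp (f := fun z => E.e (j, z)) h1 (E.deg_e _ hz)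
      (OpenPartialHomeomorph.continuousAt_symm _ (by rw [projOph_target]; exact E.mem_O _ hz))
      (continuousAt_slice E.continuousOn_e hz)
    refine DegAt.congr h2 ?_
    have h3 : ∀ᶠ w : ℂ in 𝓝 z, w ≠ 0 := isOpen_ne.mem_nhds hz
    filter_upwards [h3] with w hw
    have hw' : (j, w) ∈ punctured J := hw
    exact (E.projOph_symm_apply _ ⟨_, E.mem_O _ hw'⟩).trans (E.disk_of_ne hw').symm
  · obtain rfl : z = 0 := by simpa [punctured] using hz
    have h0 : E.inr j ∈ (planar (E.capChart (E.inr j))).source := by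
      rw [capChart_inr, planar_ofPlanar_source]; exact E.mem_capChart_source (E.inr j)
    have h1 : DegAt (planar (E.capChart (E.inr j))).symm
        (planar (E.capChart (E.inr j)) (E.inr j)) 1 :=
      degAt_symm_chart (E.planar_capChart_mem _) h0
    have h2 : planar (E.capChart (E.inr j)) (E.inr j) = 0 + 1 := by
      rw [capChart_inr, planar_ofPlanar_apply (E.mem_capChart_source (E.inr j))]
      have : E.inr j = E.diskAt j 0 := (E.disk_zero j).symm
      rw [this, diskChart_apply]
    have hc := (planar (E.capChart (E.inr j))).continuousAt_symm ((planar _).map_source h0)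
    rw [h2] at h1 hc
    have h3 := DegAt.comp (f := fun z => z + 1) h1 (degAt_add 1 0) hc (by fun_prop)
    refine DegAt.congr h3 ?_
    have h4 : ∀ᶠ w : ℂ in 𝓝 0, 0 < (w + 1).re :=
      (isOpen_lt continuous_const (by fun_prop)).mem_nhds (by simp)
    filter_upwards [h4] with w hw
    simp only [Function.comp_apply]
    rw [capChart_inr, planar_ofPlanar_symm_apply hw, diskChart_symm_apply, add_sub_cancel_right]

theorem regular_cap : regular E.Cap = E.cap.inner := E.cap.regular_eq

theorem disk_mem_inner (p : J × ℂ) : E.disk p ∈ E.cap.inner := by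
  rw [← regular_cap]
  exact (E.degAt_diskAt p.1 p.2).map_mem_regular

theorem inl_mem_inner {x : E.O} (hx : (x : A) ∈ A.inner) : E.inl x ∈ E.cap.inner := by
  rw [← regular_cap]
  exact (E.degAt_proj hx).mem_regular

theorem bdry_cap (h : E.O ⊆ A.inner) : E.cap.bdry = ∅ := by
  rw [OrientedSurface.bdry_eq_compl, compl_empty_iff, eq_univ_iff_forall]
  intro y
  rcases E.eq_inl_or_inr y with ⟨x, rfl⟩ | ⟨j, rfl⟩
  · exact E.inl_mem_inner (h x.2)
  · rw [← E.disk_zero j]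
    exact E.disk_mem_inner _

end Ends

/-! ### Equality of images -/

section
variable {Z W : Type} {l m n : ℕ}

theorem isDegreeOneLift_id : IsDegreeOneLift id := ⟨continuous_id, fun _ => rfl⟩

theorem IsDegreeOneLift.comp {θ η : ℝ → ℝ} (hθ : IsDegreeOneLift θ) (hη : IsDegreeOneLift η) :
    IsDegreeOneLift (θ ∘ η) :=
  ⟨hθ.1.comp hη.1, fun t => by simp only [Function.comp_apply, hη.2, hθ.2]⟩

theorem IsDegreeOneLift.add_nat {θ : ℝ → ℝ} (hθ : IsDegreeOneLift θ) (k : ℕ) (t : ℝ) :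
    θ (t + k * (2 * Real.pi)) = θ t + k * (2 * Real.pi) := by
  induction k with
  | zero => simp
  | succ k ih =>
    push_cast
    rw [show t + (k + 1) * (2 * Real.pi) = t + k * (2 * Real.pi) + 2 * Real.pi by ring, hθ.2, ih]
    ring

theorem IsDegreeOneLift.surjective {θ : ℝ → ℝ} (hθ : IsDegreeOneLift θ) :
    Function.Surjective θ := by
  intro y
  obtain ⟨k, hk⟩ := exists_nat_gt (|y - θ 0| / (2 * Real.pi))
  rw [div_lt_iff₀ Real.two_pi_pos] at hk
  have h1 := hθ.add_nat k 0
  have h2 := hθ.add_nat k (-(k * (2 * Real.pi)))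
  rw [zero_add] at h1
  rw [neg_add_cancel] at h2
  have h3 : y ∈ Icc (θ (-(k * (2 * Real.pi)))) (θ (k * (2 * Real.pi))) := by
    have := abs_lt.1 hk
    constructor <;> linarith
  obtain ⟨x, -, hx⟩ := intermediate_value_Icc (by nlinarith [Real.two_pi_pos, Nat.cast_nonneg (α := ℝ) k])
    hθ.1.continuousOn h3
  exact ⟨x, hx⟩

/-- Needed for the symmetry of `SameImage` for oriented curves: a strictly increasing surjection of
the line is an order isomorphism, hence a homeomorphism. -/
theorem IsDegreeOneLift.exists_inverse {θ : ℝ → ℝ} (hθ : IsDegreeOneLift θ)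
    (hm : StrictMono θ) : ∃ η : ℝ → ℝ, IsDegreeOneLift η ∧ StrictMono η ∧ ∀ t, θ (η t) = t := by
  let e := hm.orderIsoOfSurjective θ hθ.surjective
  have he : ∀ t, θ (e.symm t) = t := fun t => e.apply_symm_apply t
  refine ⟨e.symm, ⟨e.symm.continuous, fun t => ?_⟩, e.symm.strictMono, he⟩
  apply hm.injective
  rw [he, hθ.2, he]

theorem SameImage.refl (k : DiagramKind) (α : Fin m × Circle → Z) : SameImage α α k := by
  cases k
  · rfl
  · exact ⟨Equiv.refl _, fun i => ⟨id, isDegreeOneLift_id, strictMono_id, fun t => rfl⟩⟩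

theorem SameImage.symm {k : DiagramKind} {α : Fin m × Circle → Z} {β : Fin n × Circle → Z}
    (h : SameImage α β k) : SameImage β α k := by
  cases k
  · exact Eq.symm h
  · obtain ⟨e, h⟩ := h
    refine ⟨e.symm, fun i => ?_⟩
    obtain ⟨θ, hθ, hm, h⟩ := h (e.symm i)
    obtain ⟨η, hη, hm', h'⟩ := hθ.exists_inverse hm
    refine ⟨η, hη, hm', fun t => ?_⟩
    rw [h, h', e.apply_symm_apply]

theorem SameImage.trans {k : DiagramKind} {α : Fin l × Circle → Z} {β : Fin m × Circle → Z}
    {γ : Fin n × Circle → Z} (h : SameImage α β k) (h' : SameImage β γ k) : SameImage α γ k := by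
  cases k
  · exact Eq.trans h h'
  · obtain ⟨e, h⟩ := h
    obtain ⟨e', h'⟩ := h'
    refine ⟨e.trans e', fun i => ?_⟩
    obtain ⟨θ, hθ, hm, h⟩ := h i
    obtain ⟨η, hη, hm', h'⟩ := h' (e i)
    exact ⟨η ∘ θ, hη.comp hθ, hm'.comp hm, fun t => by rw [h, h']; rfl⟩

theorem SameImage.map {k : DiagramKind} {α : Fin m × Circle → Z} {β : Fin n × Circle → Z}
    (h : SameImage α β k) (f : Z → W) : SameImage (f ∘ α) (f ∘ β) k := by
  cases k
  · change range (f ∘ α) = range (f ∘ β)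
    rw [range_comp, range_comp, show range α = range β from h]
  · obtain ⟨e, h⟩ := h
    refine ⟨e, fun i => ?_⟩
    obtain ⟨θ, hθ, hm, h⟩ := h i
    exact ⟨θ, hθ, hm, fun t => congrArg f (h t)⟩

end

theorem Geotopic.symm {k : DiagramKind} {A B : DoodleDiagram} (h : Geotopic k A B) :
    Geotopic k B A := by
  obtain ⟨Z, f, g, hf, hg, h⟩ := h
  exact ⟨Z, g, f, hg, hf, h.symm⟩

theorem StablyEquivalent.symm {k : DiagramKind} {A B : DoodleDiagram}
    (h : StablyEquivalent k A B) : StablyEquivalent k B A := by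
  induction h with
  | refl => exact .refl
  | tail _ h ih => exact .head h.symm ih

/-! ### Images of diagrams -/

/-- A map of surfaces which, near a diagram, is an orientation preserving embedding. -/
structure MapsDoodle (A : DoodleDiagram) {Y : OrientedSurface} (f : A.surface → Y)
    (U : Set A.surface) : Prop where
  isOpen : IsOpen U
  image_subset : A.image ⊆ U
  continuousOn : ContinuousOn f U
  injOn : InjOn f U
  deg : ∀ x ∈ U, DegAt f x 1

theorem MapsDoodle.mem {A : DoodleDiagram} {Y : OrientedSurface} {f : A.surface → Y}
    {U : Set A.surface} (h : MapsDoodle A f U) (p : Fin A.n × Circle) : A.curve p ∈ U :=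
  h.image_subset (mem_range_self p)

/-- The restriction of the map to a neighborhood of the diagram. -/
def MapsDoodle.oph {A : DoodleDiagram} {Y : OrientedSurface} {f : A.surface → Y}
    {U : Set A.surface} (h : MapsDoodle A f U) (x : A.surface) :
    OpenPartialHomeomorph A.surface Y :=
  haveI : Nonempty A.surface := ⟨x⟩
  ophOfInjOn f U h.isOpen h.continuousOn h.injOn (fun x hx _ hV =>
    (h.deg x hx).image_mem_nhds one_ne_zero (h.isOpen.mem_nhds hx) h.continuousOn hV)

theorem MapsDoodle.oph_symm_apply {A : DoodleDiagram} {Y : OrientedSurface} {f : A.surface → Y}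
    {U : Set A.surface} (h : MapsDoodle A f U) (x : A.surface) (p : Fin A.n × Circle) :
    (h.oph x).symm (f (A.curve p)) = A.curve p := (h.oph x).left_inv (h.mem p)

theorem MapsDoodle.mem_oph_target {A : DoodleDiagram} {Y : OrientedSurface} {f : A.surface → Y}
    {U : Set A.surface} (h : MapsDoodle A f U) (x : A.surface) (p : Fin A.n × Circle) :
    f (A.curve p) ∈ (h.oph x).target := (h.oph x).map_source (h.mem p)

/-- The image of a diagram. -/
def DoodleDiagram.map (A : DoodleDiagram) {Y : OrientedSurface} (f : A.surface → Y)
    {U : Set A.surface} (h : MapsDoodle A f U) : DoodleDiagram where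
  surface := Y
  n := A.n
  curve := f ∘ A.curve
  continuous_curve := h.continuousOn.comp_continuous A.continuous_curve h.mem
  curve_mem_inner p := by
    rw [← Y.regular_eq]; exact (h.deg _ (h.mem p)).map_mem_regular
  finite_crossings := by
    refine (A.finite_crossings.image f).subset ?_
    rintro _ ⟨p, q, hpq, rfl, hq⟩
    exact ⟨A.curve p, ⟨p, q, hpq, rfl, h.injOn (h.mem q) (h.mem p) hq⟩, rfl⟩
  no_triple p q r hpq hqr := A.no_triple p q r (h.injOn (h.mem p) (h.mem q) hpq)
    (h.injOn (h.mem q) (h.mem r) hqr)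
  locally_flat p := by
    obtain ⟨φ, hφ, hφ'⟩ := A.locally_flat p
    refine ⟨(h.oph (A.curve p)).symm.trans φ, ?_, ?_⟩
    · rw [OpenPartialHomeomorph.trans_source]
      refine ⟨h.mem_oph_target (A.curve p) p, ?_⟩
      rw [mem_preimage, Function.comp_apply, h.oph_symm_apply]
      exact hφ
    · filter_upwards [hφ'] with p' hp'
      rw [OpenPartialHomeomorph.trans_apply, Function.comp_apply, h.oph_symm_apply]
      exact hp'
  transverse p q hpq hpq' := by
    obtain ⟨φ, hφ, hφ', hφ''⟩ := A.transverse p q hpq (h.injOn (h.mem p) (h.mem q) hpq')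
    refine ⟨(h.oph (A.curve p)).symm.trans φ, ?_, ?_, ?_⟩
    · rw [OpenPartialHomeomorph.trans_source]
      refine ⟨h.mem_oph_target (A.curve p) p, ?_⟩
      rw [mem_preimage, Function.comp_apply, h.oph_symm_apply]
      exact hφ
    · filter_upwards [hφ'] with p' hp'
      rw [OpenPartialHomeomorph.trans_apply, Function.comp_apply, h.oph_symm_apply]
      exact hp'
    · filter_upwards [hφ''] with p' hp'
      rw [OpenPartialHomeomorph.trans_apply, Function.comp_apply, h.oph_symm_apply]
      exact hp'

theorem IsOrientedEmbedding.mapsDoodle {A : DoodleDiagram} {Y : OrientedSurface}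
    {f : A.surface → Y} (h : IsOrientedEmbedding f) : MapsDoodle A f A.surface.inner := by
  have h' := isOrientedEmbedding_iff.1 h
  refine ⟨A.surface.isOpen_inner, ?_, h'.1.continuousOn, h'.2.1.injOn, h'.2.2⟩
  rintro _ ⟨p, rfl⟩
  exact A.curve_mem_inner p

/-! ### The complement of the open disks at the ends -/

theorem halfC_symm_eq {z : ℂ} (hz : 0 ≤ z.re) : toC (model (halfC.symm z)) = z := by
  have h : model (model.symm (toC.symm z)) = toC.symm z :=
      model.right_inv (by
        rw [range_modelWithCornersEuclideanHalfSpace]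
        exact hz)
  change toC (model (model.symm (toC.symm z))) = z
  rw [h, Homeomorph.apply_symm_apply]

theorem continuous_halfC_symm : Continuous halfC.symm :=
  model.continuous_symm.comp toC.symm.continuous

theorem continuous_halfC : Continuous halfC :=
  toC.continuous.comp model.continuous

theorem halfC_re_nonneg (x : HalfPlane) : 0 ≤ (halfC x).re := x.2

theorem halfC_symm_halfC (x : HalfPlane) : halfC.symm (halfC x) = x := by
  change model.symm (toC.symm (toC (model x))) = x
  rw [Homeomorph.symm_apply_apply]
  exact model.left_inv x

theorem halfC_halfC_symm {z : ℂ} (hz : 0 ≤ z.re) : halfC (halfC.symm z) = z := halfC_symm_eq hz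

/-- The map w ↦ z₁ exp w sends the closed right half-plane to the outside of the open unit disk and
the imaginary axis to the unit circle. Its local inverses are the charts at the new boundary. -/
theorem norm_mul_exp {z₁ : ℂ} (h₁ : ‖z₁‖ = 1) (x : HalfPlane) :
    1 ≤ ‖z₁ * Complex.exp (halfC x)‖ := by
  rw [norm_mul, h₁, one_mul, Complex.norm_exp]
  exact Real.one_le_exp (halfC_re_nonneg x)

theorem log_re_nonneg {z₁ z : ℂ} (h₁ : ‖z₁‖ = 1) (hz : 1 ≤ ‖z‖) : 0 ≤ (Complex.log (z / z₁)).re := by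
  rw [Complex.log_re, norm_div, h₁, div_one]
  exact Real.log_nonneg hz

theorem mul_exp_mem {J : Type*} (j : J) {z₁ : ℂ} (h₁ : ‖z₁‖ = 1) (w : ℂ) :
    (j, z₁ * Complex.exp w) ∈ punctured J :=
  mul_ne_zero (by rintro rfl; simp at h₁) (Complex.exp_ne_zero w)

namespace Ends

variable {A : OrientedSurface} {J : Type} [TopologicalSpace J] (E : Ends A J)

/-- The complement of the closed disks at the ends. -/
def outer : Set A := E.O \ E.e '' (punctured J ∩ {p | ‖p.2‖ ≤ 1})

/-- The complement of the open disks at the ends. -/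
def coreSet : Set A := E.O \ E.e '' (punctured J ∩ {p | ‖p.2‖ < 1})

theorem outer_subset_coreSet : E.outer ⊆ E.coreSet := by
  rintro x ⟨hx, hx'⟩
  refine ⟨hx, fun h => hx' ?_⟩
  obtain ⟨p, hp, rfl⟩ := h
  exact ⟨p, ⟨hp.1, le_of_lt (show ‖p.2‖ < 1 from hp.2)⟩, rfl⟩

theorem mem_coreSet_iff {p : J × ℂ} (hp : p ∈ punctured J) :
    E.e p ∈ E.coreSet ↔ 1 ≤ ‖p.2‖ := by
  constructor
  · intro h
    by_contra h'
    exact h.2 ⟨p, ⟨hp, not_le.1 h'⟩, rfl⟩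
  · intro h
    refine ⟨E.mem_O p hp, ?_⟩
    rintro ⟨q, hq, hqp⟩
    rw [E.injOn_e hq.1 hp hqp] at hq
    exact absurd (show ‖p.2‖ < 1 from hq.2) (not_lt.2 h)

theorem mem_outer_iff {p : J × ℂ} (hp : p ∈ punctured J) :
    E.e p ∈ E.outer ↔ 1 < ‖p.2‖ := by
  constructor
  · intro h
    by_contra h'
    exact h.2 ⟨p, ⟨hp, not_lt.1 h'⟩, rfl⟩
  · intro h
    refine ⟨E.mem_O p hp, ?_⟩
    rintro ⟨q, hq, hqp⟩
    rw [E.injOn_e hq.1 hp hqp] at hq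
    exact absurd (show ‖p.2‖ ≤ 1 from hq.2) (not_le.2 h)

theorem exists_of_notMem_outer {x : A} (hx : x ∈ E.coreSet) (hx' : x ∉ E.outer) :
    ∃ p ∈ punctured J, ‖p.2‖ = 1 ∧ E.e p = x := by
  have : x ∈ E.e '' (punctured J ∩ {p | ‖p.2‖ ≤ 1}) := by
    by_contra h; exact hx' ⟨hx.1, h⟩
  obtain ⟨p, hp, rfl⟩ := this
  exact ⟨p, hp.1, le_antisymm hp.2 ((E.mem_coreSet_iff hp.1).1 hx), rfl⟩

/-- The complement of the open disks at the ends, as a space. -/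
abbrev Core : Type := E.coreSet

instance : CompactSpace E.Core := isCompact_iff_compactSpace.1 E.isCompact_core

/-- The inclusion of the complement of the closed disks at the ends. -/
def coreOph (y : E.Core) : OpenPartialHomeomorph E.Core A :=
  haveI : Nonempty E.Core := ⟨y⟩
  ophOfInjOn Subtype.val (Subtype.val ⁻¹' E.outer) (E.isOpen_outer.preimage continuous_subtype_val)
    continuous_subtype_val.continuousOn Subtype.val_injective.injOn
    (by
      intro x hx V hV
      obtain ⟨W, hW, hWV⟩ := mem_nhds_subtype _ _ _ |>.1 hV
      refine Filter.mem_of_superset (Filter.inter_mem hW (E.isOpen_outer.mem_nhds hx)) ?_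
      rintro z ⟨hz, hz'⟩
      exact ⟨⟨z, E.outer_subset_coreSet hz'⟩, hWV hz, rfl⟩)

theorem coreOph_target (y : E.Core) : (E.coreOph y).target = E.outer := by
  change Subtype.val '' (Subtype.val ⁻¹' E.outer) = E.outer
  rw [Subtype.image_preimage_coe]
  exact inter_eq_right.2 E.outer_subset_coreSet

theorem val_coreOph_symm (y : E.Core) {x : A} (hx : x ∈ E.outer) :
    ((E.coreOph y).symm x : A) = x := (E.coreOph y).right_inv (by rwa [coreOph_target])

/-- The parametrization of the ends as an open partial homeomorphism. -/
def eOph (j : J) : OpenPartialHomeomorph (J × ℂ) A :=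
  haveI : Nonempty (J × ℂ) := ⟨(j, 0)⟩
  ophOfInjOn E.e (punctured J) (isOpen_punctured J) E.continuousOn_e E.injOn_e
    (fun _ hx _ hV => E.image_mem_nhds hx hV)

theorem eOph_symm_apply (j : J) {p : J × ℂ} (hp : p ∈ punctured J) :
    (E.eOph j).symm (E.e p) = p := (E.eOph j).left_inv hp

variable [DiscreteTopology J]

/-- The charts of the complement of the open disks at the boundary points. -/
def bdryChart (j : J) (z₁ : ℂ) (h₁ : ‖z₁‖ = 1) : OpenPartialHomeomorph E.Core HalfPlane where
  -- Logarithmic polar coordinates centered at the boundary point z₁: the condition |z| ≥ 1 becomes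
  -- Re ≥ 0. The source is restricted to the slit plane around z₁, where the logarithm is
  -- continuous.
  toFun y := halfC.symm (Complex.log (((E.eOph j).symm y).2 / z₁))
  invFun x := ⟨E.e (j, z₁ * Complex.exp (halfC x)),
    (E.mem_coreSet_iff (mul_exp_mem j h₁ _)).2 (norm_mul_exp h₁ x)⟩
  source := Subtype.val ⁻¹' ((E.eOph j).target ∩
    (E.eOph j).symm ⁻¹' ({j} ×ˢ {z | z / z₁ ∈ Complex.slitPlane}))
  target := {x | (halfC x).im ∈ Ioo (-Real.pi) Real.pi}
  map_source' := by
    rintro ⟨y, hyc⟩ ⟨⟨⟨k, z⟩, hp, rfl⟩, hy'⟩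
    change E.e (k, z) ∈ E.coreSet at hyc
    change (E.eOph j).symm (E.e (k, z)) ∈ {j} ×ˢ {z | z / z₁ ∈ Complex.slitPlane} at hy'
    change (halfC (halfC.symm (Complex.log (((E.eOph j).symm (E.e (k, z))).2 / z₁)))).im ∈
      Ioo (-Real.pi) Real.pi
    rw [E.eOph_symm_apply j hp] at hy' ⊢
    have h2 := (E.mem_coreSet_iff hp).1 hyc
    rw [halfC_halfC_symm (log_re_nonneg h₁ h2)]
    exact ⟨Complex.neg_pi_lt_log_im _, lt_of_le_of_ne (Complex.log_im_le_pi _) (by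
      rw [Complex.log_im]; exact (Complex.mem_slitPlane_iff_arg.1 hy'.2).1)⟩
  map_target' := by
    intro x hx
    have hp := mul_exp_mem j h₁ (halfC x)
    refine ⟨mem_image_of_mem E.e hp, ?_⟩
    rw [mem_preimage, E.eOph_symm_apply j hp]
    refine ⟨rfl, ?_⟩
    have h0 : z₁ ≠ 0 := by rintro rfl; simp at h₁
    change z₁ * Complex.exp (halfC x) / z₁ ∈ Complex.slitPlane
    rw [mul_div_cancel_left₀ _ h0]
    exact Complex.expOpenPartialHomeomorph.map_source hx
  left_inv' := by
    rintro ⟨y, hyc⟩ ⟨⟨⟨k, z⟩, hp, rfl⟩, hy'⟩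
    change E.e (k, z) ∈ E.coreSet at hyc
    change (E.eOph j).symm (E.e (k, z)) ∈ {j} ×ˢ {z | z / z₁ ∈ Complex.slitPlane} at hy'
    apply Subtype.ext
    change E.e (j, z₁ * Complex.exp (halfC (halfC.symm
      (Complex.log (((E.eOph j).symm (E.e (k, z))).2 / z₁))))) = E.e (k, z)
    rw [E.eOph_symm_apply j hp] at hy' ⊢
    have h2 := (E.mem_coreSet_iff hp).1 hyc
    have h0 : z₁ ≠ 0 := by rintro rfl; simp at h₁
    rw [halfC_halfC_symm (log_re_nonneg h₁ h2), Complex.exp_log (div_ne_zero hp h0),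
      mul_div_cancel₀ _ h0, show k = j from hy'.1]
  right_inv' := by
    intro x hx
    have hp := mul_exp_mem j h₁ (halfC x)
    have h0 : z₁ ≠ 0 := by rintro rfl; simp at h₁
    change halfC.symm (Complex.log (((E.eOph j).symm (E.e _)).2 / z₁)) = x
    rw [E.eOph_symm_apply j hp]
    change halfC.symm (Complex.log (z₁ * Complex.exp (halfC x) / z₁)) = x
    rw [mul_div_cancel_left₀ _ h0, Complex.log_exp hx.1 hx.2.le, halfC_symm_halfC]
  open_source := by
    refine IsOpen.preimage continuous_subtype_val ?_
    refine (E.eOph j).symm.isOpen_inter_preimage ?_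
    exact (isOpen_discrete _).prod (Complex.isOpen_slitPlane.preimage (by fun_prop))
  open_target := isOpen_Ioo.preimage (Complex.continuous_im.comp continuous_halfC)
  continuousOn_toFun := by
    refine continuous_halfC_symm.comp_continuousOn (ContinuousOn.clog (ContinuousOn.div_const
      (continuous_snd.comp_continuousOn ((E.eOph j).continuousOn_symm.comp
        continuous_subtype_val.continuousOn ?_)) _) ?_)
    · exact fun y hy => hy.1
    · exact fun y hy => hy.2.2
  continuousOn_invFun := by
    refine Continuous.continuousOn (Continuous.subtype_mk ?_ _)
    refine E.continuousOn_e.comp_continuous ?_ (fun x => mul_exp_mem j h₁ _)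
    exact continuous_const.prodMk (continuous_const.mul (Complex.continuous_exp.comp
      continuous_halfC))

end Ends

namespace Ends

variable {A : OrientedSurface} {J : Type} [TopologicalSpace J] [DiscreteTopology J] (E : Ends A J)

open Classical in
/-- The charts of the complement of the open disks at the ends. -/
def coreChart (y : E.Core) : OpenPartialHomeomorph E.Core HalfPlane :=
  if h : (y : A) ∈ E.outer then (E.coreOph y).trans (chartAt HalfPlane (y : A))
  else E.bdryChart (E.exists_of_notMem_outer y.2 h).choose.1
    (E.exists_of_notMem_outer y.2 h).choose.2
    (E.exists_of_notMem_outer y.2 h).choose_spec.2.1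

/-- Hides the choice of the parameters of the boundary charts; what follows holds for every choice.
-/
theorem coreChart_induction {P : OpenPartialHomeomorph E.Core HalfPlane → Prop}
    (h : ∀ (y : E.Core) (x : A), P ((E.coreOph y).trans (chartAt HalfPlane x)))
    (h' : ∀ (j : J) (z : ℂ) (hz : ‖z‖ = 1), P (E.bdryChart j z hz)) (y : E.Core) :
    P (E.coreChart y) := by
  unfold coreChart
  split_ifs
  · exact h _ _
  · exact h' _ _ _

theorem mem_coreChart_source (y : E.Core) : y ∈ (E.coreChart y).source := by
  unfold coreChart
  split_ifs with h
  · rw [OpenPartialHomeomorph.trans_source]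
    exact ⟨h, mem_chart_source HalfPlane (y : A)⟩
  · obtain ⟨hp, hn, hpy⟩ := (E.exists_of_notMem_outer y.2 h).choose_spec
    have h1 := (congrArg (E.eOph (E.exists_of_notMem_outer y.2 h).choose.1).symm hpy).symm.trans
      (E.eOph_symm_apply _ hp)
    refine ⟨⟨_, hp, hpy⟩, congrArg Prod.fst h1, ?_⟩
    change Prod.snd _ / _ ∈ Complex.slitPlane
    rw [h1, div_self hp]
    simp

theorem exists_of_mem_bdryChart_source {j : J} {z₁ : ℂ} {h₁ : ‖z₁‖ = 1} {y : E.Core}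
    (hy : y ∈ (E.bdryChart j z₁ h₁).source) :
    ∃ w : ℂ, (j, w) ∈ punctured J ∧ (y : A) = E.e (j, w) ∧
      planar (E.bdryChart j z₁ h₁) y = Complex.log (w / z₁) := by
  obtain ⟨y, hyc⟩ := y
  obtain ⟨⟨⟨k, w⟩, hp, rfl⟩, hy'⟩ := hy
  change E.e (k, w) ∈ E.coreSet at hyc
  change (E.eOph j).symm (E.e (k, w)) ∈ {j} ×ˢ {z | z / z₁ ∈ Complex.slitPlane} at hy'
  rw [E.eOph_symm_apply j hp] at hy'
  obtain rfl : k = j := hy'.1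
  refine ⟨w, hp, rfl, ?_⟩
  change halfC (halfC.symm (Complex.log (((E.eOph k).symm (E.e (k, w))).2 / z₁))) = _
  rw [E.eOph_symm_apply k hp,
    halfC_halfC_symm (log_re_nonneg h₁ ((E.mem_coreSet_iff hp).1 hyc))]

/-- The right-hand side does not depend on the chart, so the new atlas has a well-defined interior:
boundary points are old ones, or lie on the unit circles of the ends. -/
theorem mem_planar_coreChart {x y : E.Core} (hx : x ∈ (E.coreChart y).source) :
    x ∈ (planar (E.coreChart y)).source ↔ (x : A) ∈ E.outer ∧ (x : A) ∈ A.inner := by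
  revert hx
  refine E.coreChart_induction (P := fun c => x ∈ c.source →
    (x ∈ (planar c).source ↔ (x : A) ∈ E.outer ∧ (x : A) ∈ A.inner)) ?_ ?_ y
  · intro y a hx
    rw [OpenPartialHomeomorph.trans_source] at hx
    rw [planar_trans, OpenPartialHomeomorph.trans_source]
    exact and_congr Iff.rfl (OrientedSurface.mem_inner_iff (chart_mem_atlas HalfPlane a) hx.2).symm
  · intro j z₁ h₁ hx
    obtain ⟨w, hw, hxw, hp⟩ := E.exists_of_mem_bdryChart_source hx
    rw [mem_planar_source, hp, hxw, E.mem_outer_iff hw, Complex.log_re, norm_div, h₁, div_one,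
      Real.log_pos_iff (norm_nonneg _)]
    simp [hx, E.mem_inner hw]

theorem degAt_val_coreChart {x y : E.Core} (hx : x ∈ (planar (E.coreChart y)).source) :
    DegAt (Subtype.val ∘ (planar (E.coreChart y)).symm : ℂ → A) (planar (E.coreChart y) x) 1 := by
  revert hx
  refine E.coreChart_induction (P := fun c => x ∈ (planar c).source →
    DegAt (Subtype.val ∘ (planar c).symm : ℂ → A) (planar c x) 1) ?_ ?_ y
  · intro y a hx
    rw [planar_trans, OpenPartialHomeomorph.trans_source] at hx
    have h1 := degAt_symm_chart (X := A)
      (mem_image_of_mem planar (chart_mem_atlas HalfPlane a)) hx.2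
    rw [planar_trans]
    refine DegAt.congr (f := (planar (chartAt HalfPlane a)).symm) h1 ?_
    have hx2 : ∀ᶠ z in 𝓝 (planar (chartAt HalfPlane a) x),
        (planar (chartAt HalfPlane a)).symm z ∈ E.outer :=
      (OpenPartialHomeomorph.continuousAt_symm _ (OpenPartialHomeomorph.map_source _ hx.2)) (by
        rw [show (planar (chartAt HalfPlane a)).symm (planar (chartAt HalfPlane a) x) = x from
          OpenPartialHomeomorph.left_inv _ hx.2]
        exact E.isOpen_outer.mem_nhds hx.1)
    filter_upwards [hx2] with z hz
    exact (E.val_coreOph_symm y hz).symm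
  · intro j z₁ h₁ hx
    obtain ⟨w, hw, hxw, hp⟩ := E.exists_of_mem_bdryChart_source (mem_planar_source.1 hx).1
    have h0 : z₁ ≠ 0 := by rintro rfl; simp at h₁
    have hw0 : w ≠ 0 := hw
    have h1 : z₁ * Complex.exp (Complex.log (w / z₁)) = w := by
      rw [Complex.exp_log (div_ne_zero hw0 h0), mul_div_cancel₀ _ h0]
    have hre := (mem_planar_source.1 hx).2
    rw [hp] at hre ⊢
    -- The parametrization is holomorphic with non-zero derivative, hence of degree 1.
    have h2 : DegAt (fun v => z₁ * Complex.exp v) (Complex.log (w / z₁)) 1 :=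
      degAt_complex (hasDegree_of_hasDerivAt (((Complex.hasDerivAt_exp _).const_mul z₁))
        (by rw [h1]; exact hw0) (Filter.Eventually.of_forall fun _ => by fun_prop))
    have h3 := E.deg_e _ hw
    have h4 := continuousAt_slice E.continuousOn_e hw
    rw [← h1] at h3 h4
    have h5 := DegAt.comp (f := fun v => z₁ * Complex.exp v) h3 h2 h4 (by fun_prop)
    refine h5.congr ?_
    filter_upwards [(isOpen_lt continuous_const Complex.continuous_re).mem_nhds hre] with v hv
    change _ = E.e (j, z₁ * Complex.exp (halfC (halfC.symm v)))
    rw [halfC_halfC_symm (le_of_lt (show 0 < v.re from hv))]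
    rfl

theorem coreChart_compat (x y z : E.Core) (hx : z ∈ (planar (E.coreChart x)).source)
    (hy : z ∈ (E.coreChart y).source) :
    HasDegree (planar (E.coreChart y) ∘ (planar (E.coreChart x)).symm)
      (planar (E.coreChart x) z) 1 := by
  have hy' := (E.mem_planar_coreChart hy).2 ((E.mem_planar_coreChart (mem_planar_source.1 hx).1).1 hx)
  exact hasDegree_of_reference hx hy' continuous_subtype_val.continuousAt
    (E.degAt_val_coreChart hx) (E.degAt_val_coreChart hy')

/-- The complement of the open disks at the ends. -/
def core : OrientedSurface := OrientedSurface.ofCharts E.Core E.coreChart E.mem_coreChart_source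
  E.coreChart_compat

instance : PlanarOriented E.Core := inferInstanceAs (PlanarOriented E.core)

theorem mem_core_inner (y : E.Core) :
    y ∈ E.core.inner ↔ (y : A) ∈ E.outer ∧ (y : A) ∈ A.inner := by
  rw [← E.mem_planar_coreChart (E.mem_coreChart_source y)]
  exact OrientedSurface.mem_inner_iff (X := E.core) (mem_range_self y) (E.mem_coreChart_source y)

theorem degAt_val {y : E.Core} (hy : (y : A) ∈ E.outer) (hy' : (y : A) ∈ A.inner) :
    DegAt (Subtype.val : E.Core → A) y 1 := by
  have h1 := (E.mem_planar_coreChart (E.mem_coreChart_source y)).2 ⟨hy, hy'⟩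
  have h2 := E.degAt_val_coreChart h1
  have h3 : DegAt (planar (E.coreChart y)) y 1 :=
    degAt_chart (mem_image_of_mem planar (mem_range_self y)) h1
  have h4 := (planar (E.coreChart y)).left_inv h1
  have h5 := DegAt.comp h2 h3 (continuous_subtype_val.continuousAt.comp
    ((planar (E.coreChart y)).continuousAt_symm ((planar _).map_source h1)))
    ((planar (E.coreChart y)).continuousAt h1)
  refine DegAt.congr h5 ?_
  filter_upwards [(planar (E.coreChart y)).open_source.mem_nhds h1] with w hw
  simp only [Function.comp_apply]
  rw [(planar _).left_inv hw]

theorem isOrientedEmbedding_val :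
    IsOrientedEmbedding (X := E.core) (Y := A) (Subtype.val : E.Core → A) := by
  refine isOrientedEmbedding_iff.2 ⟨continuous_subtype_val, Subtype.val_injective, fun y hy => ?_⟩
  have := (E.mem_core_inner y).1 hy
  exact E.degAt_val this.1 this.2

theorem degAt_coreOph_symm (y : E.Core) {x : A} (hx : x ∈ E.outer) (hx' : x ∈ A.inner) :
    DegAt (E.coreOph y).symm x 1 :=
  DegAt.symm (e := E.coreOph y) (x := ⟨x, E.outer_subset_coreSet hx⟩) (E.degAt_val hx hx') hx

/-- The restriction of a diagram to the complement of the open disks at the ends. -/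
theorem mapsDoodle_core {A : DoodleDiagram} (E : Ends A.surface J) (y : E.Core)
    (h : A.image ⊆ E.outer) :
    MapsDoodle A (Y := E.core) (E.coreOph y).symm (E.outer ∩ A.surface.inner) where
  isOpen := E.isOpen_outer.inter A.surface.isOpen_inner
  image_subset := by
    rintro _ ⟨p, rfl⟩
    exact ⟨h (mem_range_self p), A.curve_mem_inner p⟩
  continuousOn := (E.coreOph y).continuousOn_symm.mono (by
    rw [coreOph_target]; exact inter_subset_left)
  injOn := (E.coreOph y).symm.injOn.mono (by
    change _ ⊆ (E.coreOph y).target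
    rw [coreOph_target]; exact inter_subset_left)
  deg x hx := E.degAt_coreOph_symm y hx.1 hx.2

end Ends

/-! ### Construction of ends -/

/-- The identity or the complex conjugation. -/
def flip (b : Bool) (z : ℂ) : ℂ := if b then starRingEnd ℂ z else z

theorem flip_flip (b : Bool) (z : ℂ) : flip b (flip b z) = z := by
  unfold flip; split_ifs <;> simp

theorem norm_flip (b : Bool) (z : ℂ) : ‖flip b z‖ = ‖z‖ := by
  unfold flip; split_ifs <;> simp

theorem flip_ne_zero {b : Bool} {z : ℂ} : flip b z ≠ 0 ↔ z ≠ 0 := by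
  rw [← norm_pos_iff, norm_flip, norm_pos_iff]

theorem continuous_flip (b : Bool) : Continuous (flip b) := by
  cases b
  · exact continuous_id
  · exact Complex.continuous_conj

/-- Fiberwise conjugation. -/
def flips {J : Type*} (ε : J → Bool) (p : J × ℂ) : J × ℂ := (p.1, flip (ε p.1) p.2)

theorem flips_flips {J : Type*} (ε : J → Bool) (p : J × ℂ) : flips ε (flips ε p) = p := by
  simp [flips, flip_flip]

theorem flips_mem_punctured {J : Type*} {ε : J → Bool} {p : J × ℂ} :
    flips ε p ∈ punctured J ↔ p ∈ punctured J := flip_ne_zero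

section
variable {J : Type*} [TopologicalSpace J] [DiscreteTopology J]

theorem continuous_flips (ε : J → Bool) : Continuous (flips ε : J × ℂ → J × ℂ) :=
  continuous_prod_of_discrete_left.2 fun j => continuous_const.prodMk (continuous_flip (ε j))

/-- Fiberwise conjugation as a homeomorphism. -/
def flipsHomeo (ε : J → Bool) : J × ℂ ≃ₜ J × ℂ where
  toFun := flips ε
  invFun := flips ε
  left_inv := flips_flips ε
  right_inv := flips_flips ε
  continuous_toFun := continuous_flips ε
  continuous_invFun := continuous_flips ε

theorem image_flips {J X : Type*} (ε : J → Bool) (g : J × ℂ → X) (P : ℝ → Prop) :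
    (g ∘ flips ε) '' (punctured J ∩ {p | P ‖p.2‖}) = g '' (punctured J ∩ {p | P ‖p.2‖}) := by
  ext x
  constructor
  · rintro ⟨p, ⟨hp, hp'⟩, rfl⟩
    refine ⟨flips ε p, ⟨flips_mem_punctured.2 hp, ?_⟩, rfl⟩
    change P ‖flip _ p.2‖
    rwa [norm_flip]
  · rintro ⟨p, ⟨hp, hp'⟩, rfl⟩
    refine ⟨flips ε p, ⟨flips_mem_punctured.2 hp, ?_⟩, by simp [flips_flips]⟩
    change P ‖flip _ p.2‖
    rwa [norm_flip]

theorem isPreconnected_compl_zero : IsPreconnected ({z : ℂ | z ≠ 0}) :=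
  (isConnected_compl_singleton_of_one_lt_rank (by simp) (0 : ℂ)).isPreconnected

/-- Punctured planes in an oriented surface become oriented after conjugation of some of them. -/
theorem exists_flips_degAt {A : OrientedSurface} {g : J × ℂ → A}
    (hc : ContinuousOn g (punctured J)) (hi : InjOn g (punctured J))
    (ho : ∀ p ∈ punctured J, ∀ V ∈ 𝓝 p, g '' V ∈ 𝓝 (g p))
    (hm : ∀ p ∈ punctured J, g p ∈ A.inner) :
    ∃ ε : J → Bool, ∀ p ∈ punctured J, DegAt (fun z => (g ∘ flips ε) (p.1, z)) p.2 1 := by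
  have key : ∀ j : J, ∃ b : Bool, ∀ z : ℂ, z ≠ 0 → DegAt (fun z => g (j, flip b z)) z 1 := by
    intro j
    have hc1 : ContinuousOn (fun z => g (j, z)) {z | z ≠ 0} :=
      hc.comp (by fun_prop) (fun z hz => hz)
    have hi1 : InjOn (fun z => g (j, z)) {z | z ≠ 0} := fun z hz w hw h =>
      congrArg Prod.snd (hi (show (j, z) ∈ punctured J from hz) (show (j, w) ∈ punctured J from hw) h)
    have ho1 : ∀ z ∈ {z : ℂ | z ≠ 0}, ∀ V ∈ 𝓝 z, (fun z => g (j, z)) '' V ∈ 𝓝 (g (j, z)) := by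
      intro z hz V hV
      have h1 : ({j} : Set J) ×ˢ V ∈ 𝓝 (j, z) :=
        prod_mem_nhds ((isOpen_discrete {j}).mem_nhds rfl) hV
      refine Filter.mem_of_superset (ho (j, z) hz _ h1) ?_
      rintro _ ⟨⟨k, w⟩, ⟨rfl, hw⟩, rfl⟩
      exact ⟨w, hw, rfl⟩
    let e := ophOfInjOn (fun z => g (j, z)) {z | z ≠ 0} isOpen_ne hc1 hi1 ho1
    obtain ⟨m, n, hm1, -, hmn⟩ := exists_degAt_openPartialHomeomorph e (x := 1)
      (show (1 : ℂ) ≠ 0 from one_ne_zero) (by simp [regular_complex])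
      (by rw [A.regular_eq]; exact hm (j, 1) one_ne_zero)
    have hall : ∀ z : ℂ, z ≠ 0 → DegAt (fun z => g (j, z)) z m := fun z hz =>
      DegAt.of_isPreconnected isOpen_ne isPreconnected_compl_zero hc1 hi1
        (by simp [regular_complex]) (fun w hw => by rw [A.regular_eq]; exact hm (j, w) hw)
        (show (1 : ℂ) ∈ {z : ℂ | z ≠ 0} from one_ne_zero) hm1 hz
    -- The degree is a unit and is constant on the connected punctured plane. If it is −1,
    -- conjugation corrects it.
    rcases Int.isUnit_iff.1 (IsUnit.of_mul_eq_one_right n hmn) with rfl | rfl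
    · exact ⟨false, hall⟩
    · refine ⟨true, fun z hz => ?_⟩
      have hz' : (starRingEnd ℂ) z ≠ 0 := by simpa using hz
      have h2 := DegAt.comp (f := fun z => (starRingEnd ℂ) z) (hall _ hz')
        (degAt_complex (hasDegree_conj z))
        (hc1.continuousAt (isOpen_ne.mem_nhds hz')) Complex.continuous_conj.continuousAt
      exact h2
  choose ε hε using key
  exact ⟨ε, fun p hp => hε p.1 p.2 hp⟩

end

/-- Ends from not necessarily oriented parametrizations. -/
theorem exists_ends {A : OrientedSurface} {J : Type} [TopologicalSpace J] [DiscreteTopology J]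
    {O : Set A} {g : J × ℂ → A} (hO : IsOpen O)
    (hc : ContinuousOn g (punctured J)) (hi : InjOn g (punctured J))
    (ho : ∀ p ∈ punctured J, ∀ V ∈ 𝓝 p, g '' V ∈ 𝓝 (g p))
    (hm : ∀ p ∈ punctured J, g p ∈ A.inner) (hgO : ∀ p ∈ punctured J, g p ∈ O)
    (h₁ : IsOpen (O \ g '' (punctured J ∩ {p | ‖p.2‖ ≤ 1})))
    (h₂ : IsCompact (O \ g '' (punctured J ∩ {p | ‖p.2‖ < 1}))) :
    ∃ (E : Ends A J) (ε : J → Bool), E.O = O ∧ E.e = g ∘ flips ε ∧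
      E.outer = O \ g '' (punctured J ∩ {p | ‖p.2‖ ≤ 1}) ∧
      E.coreSet = O \ g '' (punctured J ∩ {p | ‖p.2‖ < 1}) := by
  obtain ⟨ε, hε⟩ := exists_flips_degAt hc hi ho hm
  have e1 := image_flips ε g (fun r => r ≤ 1)
  have e2 := image_flips ε g (fun r => r < 1)
  refine ⟨{ O := O
            e := g ∘ flips ε
            isOpen_O := hO
            continuousOn_e := hc.comp (continuous_flips ε).continuousOn
              (fun p hp => flips_mem_punctured.2 hp)
            injOn_e := fun p hp q hq h => (flipsHomeo ε).injective
              (hi (flips_mem_punctured.2 hp) (flips_mem_punctured.2 hq) h)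
            mem_O := fun p hp => hgO _ (flips_mem_punctured.2 hp)
            deg_e := hε
            isOpen_outer := by rw [e1]; exact h₁
            isCompact_core := by rw [e2]; exact h₂ }, ε, rfl, rfl, ?_, ?_⟩
  · exact congrArg (O \ ·) e1
  · exact congrArg (O \ ·) e2

/-! ### Polar coordinates on the two sides of a circle -/

theorem image_mem_nhds_of_inverse {X Y : Type*} [TopologicalSpace X] [TopologicalSpace Y]
    {P : X → Y} {Q : Y → X} {x : X} (hQ : ContinuousAt Q (P x)) (hx : Q (P x) = x)
    (h : ∀ᶠ y in 𝓝 (P x), P (Q y) = y) {V : Set X} (hV : V ∈ 𝓝 x) : P '' V ∈ 𝓝 (P x) := by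
  have h1 : Q ⁻¹' V ∈ 𝓝 (P x) := hQ (by rwa [hx])
  filter_upwards [h1, h] with y hy hy'
  exact ⟨Q y, hy, hy'⟩

open Classical in
/-- The direction of a complex number. -/
def dir (z : ℂ) : Circle :=
  if h : z ≠ 0 then ⟨z / ‖z‖, by simp [Submonoid.unitSphere, h]⟩ else 1

theorem coe_dir {z : ℂ} (h : z ≠ 0) : (dir z : ℂ) = z / ‖z‖ := by
  simp [dir, h]

theorem norm_mul_dir (z : ℂ) : (‖z‖ : ℂ) * dir z = z := by
  by_cases h : z = 0
  · simp [h]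
  · rw [coe_dir h, mul_div_cancel₀ _ (by simpa using h)]

theorem dir_mul {r : ℝ} (hr : 0 < r) (ζ : Circle) : dir (r * ζ) = ζ := by
  apply Subtype.ext
  have h : (r : ℂ) * ζ ≠ 0 := mul_ne_zero (by exact_mod_cast hr.ne') ζ.coe_ne_zero
  change (dir (r * ζ) : ℂ) = ζ
  rw [coe_dir h, norm_mul, Circle.norm_coe, Complex.norm_real, Real.norm_of_nonneg hr.le, mul_one,
    mul_div_cancel_left₀ _ (by exact_mod_cast hr.ne')]

theorem dir_coe (ζ : Circle) : dir ζ = ζ := by simpa using dir_mul one_pos ζ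

theorem continuousOn_dir : ContinuousOn dir {z | z ≠ 0} := by
  rw [continuousOn_iff_continuous_domRestrict]
  refine continuous_induced_rng.2 ?_
  have h : Continuous fun z : {z : ℂ | z ≠ 0} => (z : ℂ) / ‖(z : ℂ)‖ :=
    Continuous.div (by fun_prop) (by fun_prop) (fun z => by
      have hz : (z : ℂ) ≠ 0 := z.2
      simpa using hz)
  exact h.congr fun z => (coe_dir z.2).symm

/-- The sign of a side of a curve. -/
def side (b : Bool) : ℝ := if b then 1 else -1

theorem abs_side (b : Bool) : |side b| = 1 := by cases b <;> simp [side]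

/-- Polar coordinates for the two sides of a circle in an annulus. -/
def polar (p : Bool × ℂ) : Circle × ℝ := (dir p.2, side p.1 * ‖p.2‖)

theorem continuousOn_polar : ContinuousOn polar (punctured Bool) := by
  refine ContinuousOn.prodMk (continuousOn_dir.comp continuous_snd.continuousOn fun p hp => hp) ?_
  exact Continuous.continuousOn (((continuous_of_discreteTopology (f := side)).comp
    continuous_fst).mul (continuous_norm.comp continuous_snd))

/-- The inverse of the polar coordinates. -/
def polarInv (q : Circle × ℝ) : Bool × ℂ := (decide (0 < q.2), |q.2| * q.1)

theorem polarInv_polar {p : Bool × ℂ} (hp : p ∈ punctured Bool) : polarInv (polar p) = p := by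
  obtain ⟨b, z⟩ := p
  have hz : 0 < ‖z‖ := norm_pos_iff.2 hp
  refine Prod.ext ?_ ?_
  · cases b <;> simp [polarInv, polar, side, show z ≠ 0 from hp]
  · simp only [polarInv, polar, abs_mul, abs_side, one_mul, abs_norm, norm_mul_dir]

theorem polar_polarInv {q : Circle × ℝ} (hq : q.2 ≠ 0) : polar (polarInv q) = q := by
  obtain ⟨ζ, s⟩ := q
  refine Prod.ext ?_ ?_
  · exact dir_mul (abs_pos.2 hq) ζ
  · simp only [polarInv, polar, norm_mul, Circle.norm_coe, Complex.norm_real, Real.norm_eq_abs,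
      abs_abs, mul_one, side]
    by_cases h : 0 < s
    · simp [h, abs_of_pos h]
    · simp [h, abs_of_nonpos (not_lt.1 h)]

theorem polar_snd_ne_zero {p : Bool × ℂ} (hp : p ∈ punctured Bool) : (polar p).2 ≠ 0 := by
  have h1 : side p.1 ≠ 0 := by cases p.1 <;> simp [side]
  exact mul_ne_zero h1 (norm_ne_zero_iff.2 hp)

theorem polar_injOn : InjOn polar (punctured Bool) := fun p hp q hq h => by
  rw [← polarInv_polar hp, h, polarInv_polar hq]

theorem continuousAt_polarInv {q : Circle × ℝ} (hq : q.2 ≠ 0) : ContinuousAt polarInv q := by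
  refine ContinuousAt.prodMk ?_ ?_
  · have : (fun q : Circle × ℝ => decide (0 < q.2)) =ᶠ[𝓝 q] fun _ => decide (0 < q.2) := by
      rcases lt_or_gt_of_ne hq with h | h
      · filter_upwards [(isOpen_lt continuous_snd continuous_const).mem_nhds h] with r hr
        simp [not_lt.2 (le_of_lt (show r.2 < 0 from hr)), not_lt.2 h.le]
      · filter_upwards [(isOpen_lt continuous_const continuous_snd).mem_nhds h] with r hr
        simp [show 0 < r.2 from hr, h]
    exact continuousAt_const.congr this.symm
  · refine Continuous.continuousAt ?_
    exact (Complex.continuous_ofReal.comp (continuous_abs.comp continuous_snd)).mul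
      (continuous_subtype_val.comp continuous_fst)

theorem polar_image_mem_nhds {p : Bool × ℂ} (hp : p ∈ punctured Bool) {V : Set (Bool × ℂ)}
    (hV : V ∈ 𝓝 p) : polar '' V ∈ 𝓝 (polar p) := by
  refine image_mem_nhds_of_inverse (continuousAt_polarInv (polar_snd_ne_zero hp))
    (polarInv_polar hp) ?_ hV
  filter_upwards [(isOpen_ne_fun continuous_snd continuous_const).mem_nhds (polar_snd_ne_zero hp)]
    with q hq
  exact polar_polarInv hq

theorem polar_image (P : ℝ → Prop) : polar '' (punctured Bool ∩ {p | P ‖p.2‖}) =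
    {q | q.2 ≠ 0 ∧ P |q.2|} := by
  ext q
  constructor
  · rintro ⟨p, ⟨hp, hp'⟩, rfl⟩
    refine ⟨polar_snd_ne_zero hp, ?_⟩
    simpa [polar, abs_mul, abs_side] using hp'
  · rintro ⟨hq, hq'⟩
    refine ⟨polarInv q, ⟨?_, ?_⟩, polar_polarInv hq⟩
    · exact mul_ne_zero (by simpa using hq) q.1.coe_ne_zero
    · change P ‖((|q.2| : ℝ) : ℂ) * q.1‖
      rwa [norm_mul, Circle.norm_coe, mul_one, Complex.norm_real, Real.norm_eq_abs, abs_abs]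

/-- The two ends of the complement of the core of an annulus. -/
theorem exists_ends_of_annulus {A : OrientedSurface} {a : Circle × ℝ → A} (ha : IsOpenEmbedding a)
    (ha' : range a ⊆ A.inner) :
    ∃ (E : Ends A Bool) (ε : Bool → Bool), E.O = (a '' (univ ×ˢ {0}))ᶜ ∧
      E.e = a ∘ polar ∘ flips ε ∧ E.outer = (a '' (univ ×ˢ Icc (-1) 1))ᶜ ∧
      E.coreSet = (a '' (univ ×ˢ Ioo (-1) 1))ᶜ := by
  have hO : ∀ p ∈ punctured Bool, (a ∘ polar) p ∈ (a '' (univ ×ˢ {0}))ᶜ := by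
    rintro p hp ⟨q, hq, hqp⟩
    rw [ha.injective hqp] at hq
    exact polar_snd_ne_zero hp hq.2
  -- In polar coordinates, the core circle together with the punctured disks |z| ≤ 1 or |z| < 1 on
  -- both sides is the closed or the open annulus.
  have hsets : ∀ (P : ℝ → Prop) (S : Set ℝ), P 0 → (∀ s, s ∈ S ↔ P |s|) →
      (a '' (univ ×ˢ {0}))ᶜ \ (a ∘ polar) '' (punctured Bool ∩ {p | P ‖p.2‖}) =
      (a '' (univ ×ˢ S))ᶜ := by
    intro P S h0 hS
    rw [image_comp, polar_image, sdiff_eq, ← compl_union, ← image_union]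
    congr 2
    ext q
    by_cases hq : q.2 = 0
    · simp [hq, hS, h0]
    · simp [hq, hS]
  have s1 := hsets (fun r => r ≤ 1) (Icc (-1) 1) (by simp) (fun s => by rw [abs_le, mem_Icc])
  have s2 := hsets (fun r => r < 1) (Ioo (-1) 1) (by simp) (fun s => by rw [abs_lt, mem_Ioo])
  obtain ⟨E, ε, h1, h2, h3, h4⟩ := exists_ends (A := A) (J := Bool) (O := (a '' (univ ×ˢ {0}))ᶜ)
    (g := a ∘ polar)
    ((isCompact_univ.prod isCompact_singleton).image ha.continuous).isClosed.isOpen_compl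
    (ha.continuous.comp_continuousOn continuousOn_polar)
    (fun p hp q hq h => polar_injOn hp hq (ha.injective h))
    (fun p hp V hV => by
      rw [image_comp]
      exact ha.isOpenMap.image_mem_nhds (polar_image_mem_nhds hp hV))
    (fun p _ => ha' (mem_range_self _)) hO
    (by
      rw [s1]
      exact ((isCompact_univ.prod isCompact_Icc).image ha.continuous).isClosed.isOpen_compl)
    (by
      rw [s2]
      exact ((ha.isOpenMap _ (isOpen_univ.prod isOpen_Ioo)).isClosed_compl).isCompact)
  exact ⟨E, ε, h1, h2, h3.trans s1, h4.trans s2⟩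

theorem SameImage.of_eq {Z : Type} {n : ℕ} (k : DiagramKind) {α β : Fin n × Circle → Z}
    (h : ∀ p, α p = β p) : SameImage α β k := by
  obtain rfl : α = β := funext h
  exact SameImage.refl k α

/-! ### Operations are stable equivalences -/

/-- What remains of the surface after cutting out the open annulus is a surface `E.core` that
contains the diagram. The inclusion embeds it in the surface of `A`, and `φ` embeds it in that of
`B`. -/
theorem HandleRemoval.stablyEquivalent {k : DiagramKind} {A B : DoodleDiagram}
    (h : HandleRemoval k A B) : StablyEquivalent k A B := by
  obtain ⟨a, d, φ, ha, ha', hD, -, -, hφc, hφb, hφo, -, hk⟩ := h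
  obtain ⟨E, ε, -, hEe, hEo, hEc⟩ := exists_ends_of_annulus ha ha'
  rw [← hEc] at hφc hφb hφo
  have hp : ((true, 1) : Bool × ℂ) ∈ punctured Bool := one_ne_zero
  let y : E.Core := ⟨E.e (true, 1), (E.mem_coreSet_iff hp).2 (by simp)⟩
  have hAo : A.image ⊆ E.outer := by
    intro x hx
    rw [hEo]
    exact fun h => Set.disjoint_right.1 hD hx (image_subset_range _ _ h)
  have hmap := E.mapsDoodle_core y hAo
  let W := A.map (Y := E.core) _ hmap
  have hW : ∀ p, ((E.coreOph y).symm (A.curve p) : A.surface) = A.curve p := fun p =>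
    E.val_coreOph_symm y (hAo (mem_range_self p))
  have g1 : Geotopic k A W := by
    refine ⟨A.surface, id, (Subtype.val : E.Core → A.surface), isOrientedEmbedding_id _,
      E.isOrientedEmbedding_val, ?_⟩
    exact SameImage.of_eq k fun p => (hW p).symm
  have g2 : Geotopic k W B := by
    have hemb : IsOrientedEmbedding (X := E.core) (Y := B.surface)
        (φ ∘ (Subtype.val : E.Core → A.surface)) := by
      refine isOrientedEmbedding_iff.2 ⟨?_, ?_, ?_⟩
      · exact hφc.comp_continuous continuous_subtype_val (fun y => y.2)
      · exact fun y y' h => Subtype.ext (hφb.injOn y.2 y'.2 h)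
      · intro y hy
        have h1 := (E.mem_core_inner y).1 hy
        -- Interior points of the cut surface avoid the new boundary circles, so they are
        -- topologically interior to the set on which `φ` is known to preserve orientation.
        have hint : E.outer ⊆ interior E.coreSet :=
          E.isOpen_outer.subset_interior_iff.2 E.outer_subset_coreSet
        have h2 := (orientationPreservingOn_iff hφc hφb.injOn).1 hφo (Subtype.val (p := (· ∈ E.coreSet)) y) (hint h1.1) h1.2
        exact DegAt.comp (f := (Subtype.val : E.Core → A.surface)) h2 (E.degAt_val h1.1 h1.2)
          (hφc.continuousAt (mem_interior_iff_mem_nhds.1 (hint h1.1)))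
          continuous_subtype_val.continuousAt
    refine ⟨B.surface, φ ∘ (Subtype.val : E.Core → A.surface), id, hemb,
      isOrientedEmbedding_id _, ?_⟩
    exact (SameImage.of_eq k fun p => congrArg φ (hW p)).trans hk
  exact (Relation.ReflTransGen.single g1).tail g2

theorem OrientedHomeomorphic.stablyEquivalent {k : DiagramKind} {A B : DoodleDiagram}
    (h : OrientedHomeomorphic k A B) : StablyEquivalent k A B := by
  obtain ⟨h, ho, hk⟩ := h
  exact .single ⟨B.surface, h, id, ⟨h.isEmbedding, ho⟩, isOrientedEmbedding_id _, hk⟩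

theorem ComponentRemoval.stablyEquivalent {k : DiagramKind} {A B : DoodleDiagram}
    (h : ComponentRemoval k A B) : StablyEquivalent k A B := by
  obtain ⟨ι, hι, -, hk⟩ := h
  exact .single ⟨A.surface, id, ι, isOrientedEmbedding_id _, hι, hk.symm⟩

theorem Operation.stablyEquivalent {k : DiagramKind} {A B : DoodleDiagram}
    (h : Operation k A B) : StablyEquivalent k A B := by
  rcases h with h | h | h | h
  · exact (HandleRemoval.stablyEquivalent h).symm
  · exact h.stablyEquivalent
  · exact h.stablyEquivalent
  · exact h.stablyEquivalent

theorem OperationEquivalent.stablyEquivalent {k : DiagramKind} {A B : DoodleDiagram}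
    (h : OperationEquivalent k A B) : StablyEquivalent k A B := by
  induction h with
  | rel _ _ h => exact h.stablyEquivalent
  | refl _ => exact .refl
  | symm _ _ _ ih => exact ih.symm
  | trans _ _ _ _ _ ih ih' => exact ih.trans ih'

theorem IsCapping.geotopic {k : DiagramKind} {A B : DoodleDiagram} (h : IsCapping k A B) :
    Geotopic k A B := by
  obtain ⟨-, ι, -, -, hι, hk, -⟩ := h
  exact ⟨B.surface, ι, id, hι, isOrientedEmbedding_id _, hk⟩

/-! ### Compact one-dimensional manifolds -/

/-- A continuous injective function on an interval is strictly monotone, and its image contains the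
interval between the values at the ends. -/
theorem image_Icc_mem_nhds {φ : ℝ → ℝ} {t δ : ℝ} (hδ : 0 < δ)
    (hc : ContinuousOn φ (Icc (t - δ) (t + δ))) (hi : InjOn φ (Icc (t - δ) (t + δ))) :
    φ '' Icc (t - δ) (t + δ) ∈ 𝓝 (φ t) := by
  have hle : t - δ ≤ t + δ := by linarith
  have h1 : t - δ ∈ Icc (t - δ) (t + δ) := ⟨le_rfl, hle⟩
  have h2 : t + δ ∈ Icc (t - δ) (t + δ) := ⟨hle, le_rfl⟩
  have h3 : t ∈ Icc (t - δ) (t + δ) := ⟨by linarith, by linarith⟩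
  rcases hc.strictMonoOn_of_injOn_Icc' hle hi with h | h
  · exact Filter.mem_of_superset (Icc_mem_nhds (h h1 h3 (by linarith)) (h h3 h2 (by linarith)))
      (intermediate_value_Icc hle hc)
  · exact Filter.mem_of_superset (Icc_mem_nhds (h h3 h2 (by linarith)) (h h1 h3 (by linarith)))
      (intermediate_value_Icc' hle hc)

section
variable {X : Type*} [TopologicalSpace X]

/-- Invariance of domain in dimension one. -/
theorem image_mem_nhds_of_injOn {f : ℝ → X} {t : ℝ} {U : Set ℝ} (hU : U ∈ 𝓝 t)
    (hf : ContinuousOn f U) (hi : InjOn f U) (hx : ∃ k : ℝ → X, IsOpenEmbedding k ∧ f t ∈ range k)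
    {V : Set ℝ} (hV : V ∈ 𝓝 t) : f '' V ∈ 𝓝 (f t) := by
  obtain ⟨k, hk, u, hu⟩ := hx
  have h1 : f ⁻¹' range k ∈ 𝓝 t :=
    (hf.continuousAt hU) (hk.isOpen_range.mem_nhds ⟨u, hu⟩)
  obtain ⟨δ, hδ, hsub⟩ := Metric.nhds_basis_closedBall.mem_iff.1
    (Filter.inter_mem (Filter.inter_mem hV hU) h1)
  rw [Real.closedBall_eq_Icc] at hsub
  let e := hk.toOpenPartialHomeomorph
  have hke : ∀ x ∈ Icc (t - δ) (t + δ), k (e.symm (f x)) = f x := fun x hx =>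
    e.right_inv (by rw [show e.target = range k by simp [e]]; exact (hsub hx).2)
  have hsc : ContinuousOn (e.symm ∘ f) (Icc (t - δ) (t + δ)) :=
    e.continuousOn_symm.comp (hf.mono fun x hx => (hsub hx).1.2) (fun x hx => by
      rw [show e.target = range k by simp [e]]; exact (hsub hx).2)
  have hsi : InjOn (e.symm ∘ f) (Icc (t - δ) (t + δ)) := by
    intro x hx y hy hxy
    refine hi (hsub hx).1.2 (hsub hy).1.2 ?_
    rw [← hke x hx, ← hke y hy]
    exact congrArg k hxy
  have ht : t ∈ Icc (t - δ) (t + δ) := ⟨by linarith, by linarith⟩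
  have h2 := hk.isOpenMap.image_mem_nhds (image_Icc_mem_nhds hδ hsc hsi)
  rw [Function.comp_apply, hke t ht] at h2
  refine Filter.mem_of_superset h2 ?_
  rintro _ ⟨_, ⟨x, hx, rfl⟩, rfl⟩
  exact ⟨x, (hsub hx).1.1, (hke x hx).symm⟩

theorem isOpenEmbedding_line {f : ℝ → X} (hX : ∀ x : X, ∃ k : ℝ → X, IsOpenEmbedding k ∧ x ∈ range k)
    (hf : Continuous f) (hi : Function.Injective f) : IsOpenEmbedding f := by
  refine .of_continuous_injective_isOpenMap hf hi (IsOpenMap.of_nhds_le fun t V hV => ?_)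
  exact Filter.mem_of_superset (image_mem_nhds_of_injOn Filter.univ_mem hf.continuousOn hi.injOn
    (hX _) hV) (image_preimage_subset _ _)

/-- The exponential is injective on an open interval of length 2π, which reduces openness to the
case of a line. -/
theorem isOpenEmbedding_circle {f : Circle → X}
    (hX : ∀ x : X, ∃ k : ℝ → X, IsOpenEmbedding k ∧ x ∈ range k)
    (hf : Continuous f) (hi : Function.Injective f) : IsOpenEmbedding f := by
  refine .of_continuous_injective_isOpenMap hf hi (IsOpenMap.of_nhds_le fun z V hV => ?_)
  obtain ⟨t, rfl⟩ : ∃ t, Circle.exp t = z := ⟨_, Circle.exp_arg z⟩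
  have hinj : InjOn (f ∘ Circle.exp) (Ioo (t - Real.pi) (t + Real.pi)) := by
    intro x hx y hy hxy
    obtain ⟨m, hm⟩ := Circle.exp_eq_exp.1 (hi hxy)
    have h1 : |(m : ℝ)| < 1 := by
      have h2 : |(m : ℝ) * (2 * Real.pi)| < 2 * Real.pi := by
        rw [abs_lt]; constructor <;> linarith [hx.1, hx.2, hy.1, hy.2]
      rw [abs_mul, abs_of_pos Real.two_pi_pos] at h2
      exact (mul_lt_iff_lt_one_left Real.two_pi_pos).1 h2
    have h3 : m = 0 := Int.abs_lt_one_iff.1 (by exact_mod_cast h1)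
    simpa [h3] using hm
  have h1 := image_mem_nhds_of_injOn (f := f ∘ Circle.exp) (t := t)
    (Ioo_mem_nhds (by linarith [Real.pi_pos]) (by linarith [Real.pi_pos]))
    (hf.comp Circle.exp.continuous).continuousOn hinj (hX _)
    (V := Circle.exp ⁻¹' (f ⁻¹' V)) (Circle.exp.continuous.continuousAt hV)
  refine Filter.mem_of_superset h1 ?_
  rintro _ ⟨x, hx, rfl⟩
  exact hx

/-- Let a be the last parameter before x₀ at which g is outside the line h. The piece of g on (a,
x₀] corresponds to a closed interval of parameters of h. This interval is unbounded and has y₀ as an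
end, so it is a closed ray: on its way out, g runs through a whole end of h. -/
theorem exists_exit [T2Space X] {g h : ℝ → X} (hg : IsOpenEmbedding g) (hh : IsOpenEmbedding h)
    {x₀ y₀ x' : ℝ} (h₀ : g x₀ = h y₀) (hx' : x' ≤ x₀) (hx'h : g x' ∉ range h) :
    ∃ a < x₀, g a ∉ range h ∧ (∀ x ∈ Ioc a x₀, g x ∈ range h) ∧
      (h ⁻¹' (g '' Ioc a x₀) = Iic y₀ ∨ h ⁻¹' (g '' Ioc a x₀) = Ici y₀) := by
  have hS : IsClosed (Iic x₀ ∩ (g ⁻¹' range h)ᶜ) :=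
    isClosed_Iic.inter (hh.isOpen_range.preimage hg.continuous).isClosed_compl
  have hSb : BddAbove (Iic x₀ ∩ (g ⁻¹' range h)ᶜ) := ⟨x₀, fun x hx => hx.1⟩
  have haS := hS.csSup_mem ⟨x', hx', hx'h⟩ hSb
  set a := sSup (Iic x₀ ∩ (g ⁻¹' range h)ᶜ)
  have hax : a < x₀ := lt_of_le_of_ne haS.1 fun h' => haS.2 (by rw [h']; exact ⟨y₀, h₀.symm⟩)
  have hin : ∀ x ∈ Ioc a x₀, g x ∈ range h := by
    intro x hx
    by_contra hxn
    exact absurd (le_csSup hSb ⟨hx.2, hxn⟩) (not_le.2 hx.1)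
  refine ⟨a, hax, haS.2, hin, ?_⟩
  set K := h ⁻¹' (g '' Ioc a x₀)
  have hhK : h '' K = g '' Ioc a x₀ := by
    rw [image_preimage_eq_inter_range, inter_eq_left]
    rintro _ ⟨x, hx, rfl⟩
    exact hin x hx
  have hKc : IsClosed K := by
    -- Adding the endpoint changes nothing, as `g a` is not on the line `h`. The right-hand side is
    -- closed by compactness.
    have : K = h ⁻¹' (g '' Icc a x₀) := by
      ext y
      constructor
      · rintro ⟨x, hx, hxy⟩
        exact ⟨x, Ioc_subset_Icc_self hx, hxy⟩
      · rintro ⟨x, hx, hxy⟩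
        refine ⟨x, ⟨lt_of_le_of_ne hx.1 ?_, hx.2⟩, hxy⟩
        rintro rfl
        exact haS.2 ⟨y, hxy.symm⟩
    rw [this]
    exact (isCompact_Icc.image hg.continuous).isClosed.preimage hh.continuous
  have hKo : K.OrdConnected := by
    refine IsPreconnected.ordConnected ?_
    rw [← hh.isInducing.isPreconnected_image, hhK]
    exact isPreconnected_Ioc.image _ hg.continuous.continuousOn
  have hy₀ : y₀ ∈ K := ⟨x₀, ⟨hax, le_rfl⟩, h₀⟩
  -- A bounded `K` would be compact, and so would be the half-open interval `Ioc a x₀`.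
  have hunb : ¬ (BddBelow K ∧ BddAbove K) := by
    rintro ⟨⟨l, hl⟩, ⟨u, hu⟩⟩
    have h1 : IsCompact K := isCompact_Icc.of_isClosed_subset hKc fun y hy => ⟨hl hy, hu hy⟩
    have h2 := h1.image hh.continuous
    rw [hhK, ← hg.isInducing.isCompact_iff] at h2
    have h3 : a ∈ closure (Ioc a x₀) := by
      rw [closure_Ioc hax.ne]; exact ⟨le_rfl, hax.le⟩
    rw [h2.isClosed.closure_eq] at h3
    exact lt_irrefl _ h3.1
  -- If `K` contained points on both sides of `y₀`, then `Ioc a x₀` would be a neighborhood of its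
  -- right end.
  have hint : ∀ y ∈ K, ∀ y' ∈ K, y < y₀ → ¬ y₀ < y' := by
    intro y hy y' hy' h1 h2
    have h3 : h '' K ∈ 𝓝 (g x₀) := by
      rw [h₀]
      exact hh.isOpenMap.image_mem_nhds (Filter.mem_of_superset (Icc_mem_nhds h1 h2)
        (hKo.out hy hy'))
    have h4 : Ioc a x₀ ∈ 𝓝 x₀ := by
      have := hg.continuous.continuousAt h3
      rwa [hhK, Filter.mem_map, preimage_image_eq _ hg.injective] at this
    obtain ⟨l, u, hlu, hsub⟩ := mem_nhds_iff_exists_Ioo_subset.1 h4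
    have h5 := (hsub (show (x₀ + u) / 2 ∈ Ioo l u by
      constructor <;> linarith [hlu.1, hlu.2])).2
    linarith [hlu.2]
  by_cases hlow : ∃ y ∈ K, y < y₀
  · obtain ⟨y, hy, hyy⟩ := hlow
    have hup : ∀ y' ∈ K, y' ≤ y₀ := fun y' hy' => not_lt.1 (hint y hy y' hy' hyy)
    left
    refine Subset.antisymm hup fun z hz => ?_
    by_contra hzK
    exact hunb ⟨⟨z, fun w hw => by
      by_contra hwz
      exact hzK (hKo.out hw hy₀ ⟨(not_le.1 hwz).le, hz⟩)⟩, ⟨y₀, hup⟩⟩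
  · push Not at hlow
    right
    refine Subset.antisymm hlow fun z hz => ?_
    by_contra hzK
    exact hunb ⟨⟨y₀, hlow⟩, ⟨z, fun w hw => by
      by_contra hwz
      exact hzK (hKo.out hy₀ hw ⟨hz, (not_le.1 hwz).le⟩)⟩⟩

theorem exists_exit_right [T2Space X] {g h : ℝ → X} (hg : IsOpenEmbedding g)
    (hh : IsOpenEmbedding h) {x₀ y₀ x' : ℝ} (h₀ : g x₀ = h y₀) (hx' : x₀ ≤ x')
    (hx'h : g x' ∉ range h) :
    ∃ b > x₀, g b ∉ range h ∧ (∀ x ∈ Ico x₀ b, g x ∈ range h) ∧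
      (h ⁻¹' (g '' Ico x₀ b) = Iic y₀ ∨ h ⁻¹' (g '' Ico x₀ b) = Ici y₀) := by
  obtain ⟨a, ha, h1, h2, h3⟩ := exists_exit (x₀ := -x₀) (x' := -x') (g := g ∘ Neg.neg)
    (hg.comp (Homeomorph.neg ℝ).isOpenEmbedding) hh (by simpa using h₀) (by linarith)
    (by simpa using hx'h)
  have h4 : (g ∘ Neg.neg) '' Ioc a (-x₀) = g '' Ico x₀ (-a) := by
    rw [image_comp, image_neg_eq_neg, neg_Ioc, neg_neg]
  rw [h4] at h3
  refine ⟨-a, by linarith, h1, fun x hx => ?_, h3⟩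
  simpa using h2 (-x) ⟨by linarith [hx.2], by linarith [hx.1]⟩

/-- The set is an open line or an open circle. -/
def IsLineOrCircle (U : Set X) : Prop :=
  (∃ g : ℝ → X, IsOpenEmbedding g ∧ range g = U) ∨
    ∃ g : Circle → X, IsOpenEmbedding g ∧ range g = U

theorem IsLineOrCircle.isOpen {U : Set X} (h : IsLineOrCircle U) : IsOpen U := by
  rcases h with ⟨g, hg, rfl⟩ | ⟨g, hg, rfl⟩ <;> exact hg.isOpen_range

theorem IsLineOrCircle.isPreconnected {U : Set X} (h : IsLineOrCircle U) : IsPreconnected U := by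
  rcases h with ⟨g, hg, rfl⟩ | ⟨g, hg, rfl⟩ <;> exact isPreconnected_range hg.continuous

/-- The loop descends to an injective continuous map of `AddCircle T`, which is open by invariance
of domain in dimension one. -/
theorem exists_circle_of_loop (hX : ∀ x : X, ∃ k : ℝ → X, IsOpenEmbedding k ∧ x ∈ range k)
    {L : ℝ → X} {T : ℝ} (hT : 0 < T) (hL : Continuous L) (h0 : L 0 = L T)
    (hi : InjOn L (Ico 0 T)) : ∃ f : Circle → X, IsOpenEmbedding f ∧ L 0 ∈ range f := by
  have : Fact (0 < T) := ⟨hT⟩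
  have hc : Continuous (AddCircle.liftIco T 0 L) :=
    AddCircle.liftIco_continuous (by simpa using h0) hL.continuousOn
  have hz : ∀ x ∈ Ico 0 T, AddCircle.liftIco T 0 L x = L x := fun x hx =>
    AddCircle.liftIco_coe_apply (by simpa using hx)
  have hinj : Function.Injective (AddCircle.liftIco T 0 L) := by
    intro x y hxy
    rw [← AddCircle.coe_equivIco (p := T) (a := 0) (y := x),
      ← AddCircle.coe_equivIco (p := T) (a := 0) (y := y)] at hxy ⊢
    have hx : ((AddCircle.equivIco T 0 x : ℝ)) ∈ Ico 0 T := by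
      simpa using (AddCircle.equivIco T 0 x).2
    have hy : ((AddCircle.equivIco T 0 y : ℝ)) ∈ Ico 0 T := by
      simpa using (AddCircle.equivIco T 0 y).2
    rw [hz _ hx, hz _ hy] at hxy
    rw [hi hx hy hxy]
  refine ⟨AddCircle.liftIco T 0 L ∘ (AddCircle.homeomorphCircle hT.ne').symm,
    isOpenEmbedding_circle hX (hc.comp (Homeomorph.continuous _))
      (hinj.comp (Homeomorph.injective _)), ?_⟩
  refine ⟨AddCircle.homeomorphCircle hT.ne' ((0 : ℝ) : AddCircle T), ?_⟩
  rw [Function.comp_apply, Homeomorph.symm_apply_apply, hz 0 ⟨le_rfl, hT⟩]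

/-- An open circle in a Hausdorff space is also closed, so it absorbs every connected set that it
meets. -/
theorem union_eq_of_circle [T2Space X] {f : Circle → X} (hf : IsOpenEmbedding f) {U V : Set X}
    (hU : IsPreconnected U) (hV : IsPreconnected V) (hUV : (U ∩ V).Nonempty)
    (h : ((U ∪ V) ∩ range f).Nonempty) : U ∪ V ⊆ range f := by
  have hclopen : IsClopen (range f) :=
    ⟨(isCompact_range hf.continuous).isClosed, hf.isOpen_range⟩
  exact (hU.union' hUV hV).subset_isClopen hclopen h

/-- The left half of h is covered by g, and the right half of g is covered by the right half of h.
So the union consists of the left half of g and the right half of h, joined at g x₀ = h y₀. If these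
halves do not meet again, they form a line. If they do, the two arcs up to a coincidence close up to
a circle, which then contains everything. -/
theorem isLineOrCircle_union_of_exit [T2Space X]
    (hX : ∀ x : X, ∃ k : ℝ → X, IsOpenEmbedding k ∧ x ∈ range k) {g h : ℝ → X}
    (hg : IsOpenEmbedding g) (hh : IsOpenEmbedding h) {x₀ y₀ a : ℝ} (h₀ : g x₀ = h y₀)
    (hax : a < x₀) (ha : g a ∉ range h) (hK : h ⁻¹' (g '' Ioc a x₀) = Iic y₀)
    (hr : ∀ x, x₀ ≤ x → g x ∈ range h) : ∃ W, IsLineOrCircle W ∧ range g ∪ range h ⊆ W := by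
  have hinter : (range g ∩ range h).Nonempty := ⟨g x₀, mem_range_self _, y₀, h₀.symm⟩
  have hgr : ∀ x, x₀ ≤ x → ∃ y, y₀ ≤ y ∧ g x = h y := by
    intro x hx
    obtain ⟨y, hy⟩ := hr x hx
    refine ⟨y, ?_, hy.symm⟩
    by_contra hyn
    have : y ∈ h ⁻¹' (g '' Ioc a x₀) := by rw [hK]; exact (not_le.1 hyn).le
    obtain ⟨x₁, hx₁, h1⟩ := this
    have h2 := hg.injective (h1.trans hy)
    obtain rfl : x = x₀ := le_antisymm (h2 ▸ hx₁.2) hx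
    exact hyn (hh.injective (hy.trans h₀)).ge
  have hhl : ∀ y, y ≤ y₀ → ∃ x, a < x ∧ x ≤ x₀ ∧ g x = h y := by
    intro y hy
    have : y ∈ h ⁻¹' (g '' Ioc a x₀) := by rw [hK]; exact hy
    obtain ⟨x, hx, h1⟩ := this
    exact ⟨x, hx.1, hx.2, h1⟩
  by_cases hcoin : ∃ x y, x < x₀ ∧ y₀ < y ∧ g x = h y
  · obtain ⟨x₁, y₁, hx₁, hy₁, h₁⟩ := hcoin
    -- to the right of a coincidence, the line `h` is exhausted
    have key : ∀ x y, x < x₀ → y₀ < y → g x = h y → ∀ y', y ≤ y' → ∃ x', x ≤ x' ∧ x' < x₀ ∧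
        g x' = h y' := by
      intro x y hx hy hxy
      have hxa : x < a := by
        by_contra hxa
        have hxa' : x ≠ a := by rintro rfl; exact ha ⟨y, hxy.symm⟩
        have : y ∈ h ⁻¹' (g '' Ioc a x₀) := ⟨x, ⟨lt_of_le_of_ne (not_lt.1 hxa) hxa'.symm, hx.le⟩, hxy⟩
        rw [hK] at this
        exact absurd this (not_le.2 hy)
      obtain ⟨b, hb, -, hbr, hbK⟩ := exists_exit_right hg hh hxy hxa.le ha
      have hba : b ≤ a := by
        by_contra hba
        exact ha (hbr a ⟨hxa.le, not_le.1 hba⟩)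
      intro y' hy'
      rcases hbK with hbK | hbK
      · have : y₀ ∈ h ⁻¹' (g '' Ico x b) := by rw [hbK]; exact hy.le
        obtain ⟨x₂, hx₂, h2⟩ := this
        have := hg.injective (h2.trans h₀.symm)
        linarith [hx₂.2]
      · have : y' ∈ h ⁻¹' (g '' Ico x b) := by rw [hbK]; exact hy'
        obtain ⟨x₂, hx₂, h2⟩ := this
        exact ⟨x₂, hx₂.1, by linarith [hx₂.2], h2⟩
    -- The coincidence (x₁, y₁) is the only one on the two arcs: another one would force `h y₁` to
    -- be attained by `g` at a parameter at least `x`, whereas it is attained at `x₁`.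
    have key' : ∀ x y, x₁ ≤ x → x < x₀ → y₀ < y → y ≤ y₁ → g x = h y → x = x₁ ∧ y = y₁ := by
      intro x y hx hx' hy hy' hxy
      obtain ⟨x₂, h2, h2', h3⟩ := key x y hx' hy hxy y₁ hy'
      have h4 : x₁ = x₂ := hg.injective (h₁.trans h3.symm)
      have h5 : x = x₁ := le_antisymm (h4 ▸ h2) hx
      refine ⟨h5, hh.injective ?_⟩
      rw [← hxy, ← h₁, h5]
    -- The loop follows `g` from `x₁` to `x₀`, then `h` from `y₀` to `y₁`.
    let L : ℝ → X := fun t => if t ≤ x₀ - x₁ then g (x₁ + t) else h (y₀ + (t - (x₀ - x₁)))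
    have hLc : Continuous L := by
      refine Continuous.if_le (hg.continuous.comp (by fun_prop)) (hh.continuous.comp (by fun_prop))
        continuous_id continuous_const fun t ht => ?_
      have ht' : t = x₀ - x₁ := ht
      rw [ht', sub_self, add_zero, ← h₀]
      congr 1
      ring
    have hL0 : L 0 = g x₁ := by simp [L, hx₁.le]
    obtain ⟨f, hf, hfr⟩ := exists_circle_of_loop hX (L := L) (T := x₀ - x₁ + (y₁ - y₀))
      (by linarith) hLc (by
        rw [hL0, h₁]
        simp only [L]
        rw [if_neg (by linarith)]
        congr 1; ring)
      (by
        have hcross : ∀ s t, s ∈ Ico 0 (x₀ - x₁ + (y₁ - y₀)) → t ∈ Ico 0 (x₀ - x₁ + (y₁ - y₀)) →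
            s ≤ x₀ - x₁ → x₀ - x₁ < t → g (x₁ + s) = h (y₀ + (t - (x₀ - x₁))) → False := by
          intro s t hs ht h1 h2 h3
          rcases eq_or_lt_of_le h1 with h1 | h1
          · rw [h1, show x₁ + (x₀ - x₁) = x₀ by ring, h₀] at h3
            have := hh.injective h3
            linarith
          · have := (key' _ _ (by linarith [hs.1]) (by linarith) (by linarith)
              (by linarith [ht.2]) h3).2
            linarith [ht.2]
        intro s hs t ht hst
        simp only [L] at hst
        split_ifs at hst with h1 h2 h2
        · have := hg.injective hst; linarith
        · exact (hcross s t hs ht h1 (not_le.1 h2) hst).elim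
        · exact (hcross t s ht hs h2 (not_le.1 h1) hst.symm).elim
        · have := hh.injective hst; linarith)
    refine ⟨range f, Or.inr ⟨f, hf, rfl⟩, union_eq_of_circle hf
      (isPreconnected_range hg.continuous) (isPreconnected_range hh.continuous) hinter ?_⟩
    exact ⟨L 0, Or.inl (hL0 ▸ mem_range_self _), hfr⟩
  · push Not at hcoin
    let F : ℝ → X := fun t => if t ≤ x₀ then g t else h (y₀ + (t - x₀))
    have hFc : Continuous F := by
      refine Continuous.if_le hg.continuous (hh.continuous.comp (by fun_prop))
        continuous_id continuous_const fun t ht => ?_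
      have ht' : t = x₀ := ht
      rw [ht', sub_self, add_zero, ← h₀]
    have hcross : ∀ s t, s ≤ x₀ → x₀ < t → g s ≠ h (y₀ + (t - x₀)) := by
      intro s t hs ht hst
      rcases eq_or_lt_of_le hs with rfl | hs
      · have := hh.injective (h₀.symm.trans hst)
        linarith
      · exact hcoin s _ hs (by linarith) hst
    have hFi : Function.Injective F := by
      intro s t hst
      simp only [F] at hst
      split_ifs at hst with h1 h2 h2
      · exact hg.injective hst
      · exact (hcross s t h1 (not_le.1 h2) hst).elim
      · exact (hcross t s h2 (not_le.1 h1) hst.symm).elim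
      · have := hh.injective hst; linarith
    have hFg : ∀ x ≤ x₀, g x ∈ range F := fun x hx => ⟨x, if_pos hx⟩
    have hFh : ∀ y, y₀ ≤ y → h y ∈ range F := by
      intro y hy
      rcases eq_or_lt_of_le hy with rfl | hy
      · rw [← h₀]; exact hFg _ le_rfl
      · refine ⟨x₀ + (y - y₀), ?_⟩
        simp only [F]
        rw [if_neg (by linarith)]
        congr 1; ring
    refine ⟨range F, Or.inl ⟨F, isOpenEmbedding_line hX hFc hFi, rfl⟩, ?_⟩
    rintro _ (⟨x, rfl⟩ | ⟨y, rfl⟩)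
    · rcases le_total x x₀ with hx | hx
      · exact hFg x hx
      · obtain ⟨y, hy, hxy⟩ := hgr x hx
        rw [hxy]
        exact hFh y hy
    · rcases le_total y y₀ with hy | hy
      · obtain ⟨x, -, hx, hxy⟩ := hhl y hy
        rw [← hxy]
        exact hFg x hx
      · exact hFh y hy

theorem range_comp_neg {X : Type*} (g : ℝ → X) : range (g ∘ Neg.neg) = range g :=
  (Homeomorph.neg ℝ).surjective.range_comp g

theorem isLineOrCircle_union_of_left [T2Space X]
    (hX : ∀ x : X, ∃ k : ℝ → X, IsOpenEmbedding k ∧ x ∈ range k) {g h : ℝ → X}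
    (hg : IsOpenEmbedding g) (hh : IsOpenEmbedding h) {x₀ y₀ x' : ℝ} (h₀ : g x₀ = h y₀)
    (hx' : x' ≤ x₀) (hx'h : g x' ∉ range h)
    (hr : ∀ x, x₀ ≤ x → g x ∈ range h) : ∃ W, IsLineOrCircle W ∧ range g ∪ range h ⊆ W := by
  obtain ⟨a, hax, ha, -, hK | hK⟩ := exists_exit hg hh h₀ hx' hx'h
  · exact isLineOrCircle_union_of_exit hX hg hh h₀ hax ha hK hr
  · rw [← range_comp_neg h] at ha hr ⊢
    refine isLineOrCircle_union_of_exit hX hg (hh.comp (Homeomorph.neg ℝ).isOpenEmbedding)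
      (y₀ := -y₀) (by simpa using h₀) hax ha ?_ hr
    rw [preimage_comp, hK]
    ext y
    simp

/-- For two lines, the cases are how g leaves h on the two sides of a common point. If it leaves on
both sides, it runs through both ends of h and contains h. If it never leaves, it is contained in h.
If it leaves on one side only, the previous gluing applies, up to reflections. -/
theorem isLineOrCircle_union [T2Space X]
    (hX : ∀ x : X, ∃ k : ℝ → X, IsOpenEmbedding k ∧ x ∈ range k) {U V : Set X}
    (hU : IsLineOrCircle U) (hV : IsLineOrCircle V) (hUV : (U ∩ V).Nonempty) :
    ∃ W, IsLineOrCircle W ∧ U ∪ V ⊆ W := by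
  have hUc := hU.isPreconnected
  have hVc := hV.isPreconnected
  have hU' := hU
  have hV' := hV
  obtain ⟨g, hg, rfl⟩ | ⟨f, hf, rfl⟩ := hU
  · obtain ⟨h, hh, rfl⟩ | ⟨f, hf, rfl⟩ := hV
    · obtain ⟨_, ⟨x₀, rfl⟩, ⟨y₀, h₀⟩⟩ := hUV
      by_cases hl : ∃ x', x' ≤ x₀ ∧ g x' ∉ range h
      · obtain ⟨x', hx', hx'h⟩ := hl
        by_cases hr : ∃ x'', x₀ ≤ x'' ∧ g x'' ∉ range h
        · obtain ⟨x'', hx'', hx''h⟩ := hr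
          obtain ⟨a, ha, -, -, hK⟩ := exists_exit hg hh h₀.symm hx' hx'h
          obtain ⟨b, hb, -, -, hK'⟩ := exists_exit_right hg hh h₀.symm hx'' hx''h
          -- The two rays have only `y₀` in common, so they are opposite and cover the whole line
          -- `h`.
          have hdis : ∀ y, y ∈ h ⁻¹' (g '' Ioc a x₀) → y ∈ h ⁻¹' (g '' Ico x₀ b) → y = y₀ := by
            rintro y ⟨x, hx, hxy⟩ ⟨z, hz, hzy⟩
            have h1 := hg.injective (hxy.trans hzy.symm)
            have h2 : x = x₀ := le_antisymm hx.2 (h1 ▸ hz.1)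
            exact hh.injective (by rw [← hxy, h2, h₀])
          refine ⟨range g, hU', union_subset subset_rfl ?_⟩
          rintro _ ⟨y, rfl⟩
          rcases hK with hK | hK <;> rcases hK' with hK' | hK' <;> rw [hK, hK'] at hdis
          · linarith [hdis (y₀ - 1) (show y₀ - 1 ≤ y₀ by linarith) (show y₀ - 1 ≤ y₀ by linarith)]
          · rcases le_total y y₀ with hy | hy
            · rw [← mem_Iic, ← hK] at hy
              exact image_subset_range _ _ hy
            · rw [← mem_Ici, ← hK'] at hy
              exact image_subset_range _ _ hy
          · rcases le_total y y₀ with hy | hy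
            · rw [← mem_Iic, ← hK'] at hy
              exact image_subset_range _ _ hy
            · rw [← mem_Ici, ← hK] at hy
              exact image_subset_range _ _ hy
          · linarith [hdis (y₀ + 1) (show y₀ ≤ y₀ + 1 by linarith) (show y₀ ≤ y₀ + 1 by linarith)]
        · push Not at hr
          exact isLineOrCircle_union_of_left hX hg hh h₀.symm hx' hx'h hr
      · push Not at hl
        by_cases hr : ∃ x'', x₀ ≤ x'' ∧ g x'' ∉ range h
        · obtain ⟨x'', hx'', hx''h⟩ := hr
          rw [← range_comp_neg g]
          refine isLineOrCircle_union_of_left hX (hg.comp (Homeomorph.neg ℝ).isOpenEmbedding) hh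
            (x₀ := -x₀) (x' := -x'') (by simpa using h₀.symm) (by linarith) (by simpa using hx''h)
            fun x hx => hl (-x) (by linarith)
        · push Not at hr
          refine ⟨range h, hV', union_subset ?_ subset_rfl⟩
          rintro _ ⟨x, rfl⟩
          rcases le_total x x₀ with hx | hx
          · exact hl x hx
          · exact hr x hx
    · refine ⟨range f, hV', union_eq_of_circle hf hUc hVc hUV ?_⟩
      obtain ⟨x, hx, hx'⟩ := hUV
      exact ⟨x, Or.inl hx, hx'⟩
  · refine ⟨range f, hU', union_eq_of_circle hf hUc hVc hUV ?_⟩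
    obtain ⟨x, hx, hx'⟩ := hUV
    exact ⟨x, Or.inl hx, hx⟩

end

/-- A compact one-dimensional manifold is a finite disjoint union of circles. -/
theorem exists_homeomorph_circles {X : Type*} [TopologicalSpace X] [T2Space X] [CompactSpace X]
    (hX : ∀ x : X, ∃ k : ℝ → X, IsOpenEmbedding k ∧ x ∈ range k) :
    ∃ m : ℕ, Nonempty (Fin m × Circle ≃ₜ X) := by
  classical
  -- a cover by a minimal number of lines and circles
  have hex : ∃ n : ℕ, ∃ S : Finset (Set X), S.card = n ∧ (∀ U ∈ S, IsLineOrCircle U) ∧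
      ∀ x, ∃ U ∈ S, x ∈ U := by
    choose k hk hxk using hX
    obtain ⟨t, ht⟩ := isCompact_univ.elim_finite_subcover (fun x : X => range (k x))
      (fun x => (hk x).isOpen_range) (fun x _ => mem_iUnion.2 ⟨x, hxk x⟩)
    refine ⟨_, t.image fun x => range (k x), rfl, ?_, fun x => ?_⟩
    · intro U hU
      obtain ⟨x, -, rfl⟩ := Finset.mem_image.1 hU
      exact Or.inl ⟨k x, hk x, rfl⟩
    · obtain ⟨y, hy, hxy⟩ := mem_iUnion₂.1 (ht (mem_univ x))
      exact ⟨_, Finset.mem_image_of_mem _ hy, hxy⟩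
  obtain ⟨S, hSn, hS, hcov⟩ := Nat.find_spec hex
  have hmin : ∀ S' : Finset (Set X), (∀ U ∈ S', IsLineOrCircle U) → (∀ x, ∃ U ∈ S', x ∈ U) →
      S.card ≤ S'.card := fun S' h1 h2 => hSn ▸ Nat.find_min' hex ⟨S', rfl, h1, h2⟩
  -- Two different members that meet could be replaced by a single one, against minimality.
  have hdisj : ∀ U ∈ S, ∀ V ∈ S, (U ∩ V).Nonempty → U = V := by
    intro U hU V hV hUV
    by_contra hne
    obtain ⟨W, hW, hUVW⟩ := isLineOrCircle_union hX (hS U hU) (hS V hV) hUV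
    have h1 := hmin (insert W ((S.erase U).erase V)) (by
      intro U' hU'
      rcases Finset.mem_insert.1 hU' with rfl | hU'
      · exact hW
      · exact hS U' (Finset.mem_of_mem_erase (Finset.mem_of_mem_erase hU'))) (by
      intro x
      obtain ⟨U', hU', hx⟩ := hcov x
      by_cases h1 : U' = U
      · exact ⟨W, Finset.mem_insert_self _ _, hUVW (Or.inl (h1 ▸ hx))⟩
      by_cases h2 : U' = V
      · exact ⟨W, Finset.mem_insert_self _ _, hUVW (Or.inr (h2 ▸ hx))⟩
      exact ⟨U', Finset.mem_insert_of_mem (Finset.mem_erase.2 ⟨h2, Finset.mem_erase.2 ⟨h1, hU'⟩⟩), hx⟩)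
    have h2 := Finset.card_insert_le W ((S.erase U).erase V)
    have h3 := Finset.card_erase_add_one (Finset.mem_erase.2 ⟨fun h => hne h.symm, hV⟩ : V ∈ S.erase U)
    have h4 := Finset.card_erase_add_one hU
    omega
  have hclosed : ∀ U ∈ S, IsClosed U := by
    intro U hU
    have : Uᶜ = ⋃ V ∈ S.erase U, V := by
      ext x
      constructor
      · intro hx
        obtain ⟨V, hV, hxV⟩ := hcov x
        refine mem_iUnion₂.2 ⟨V, Finset.mem_erase.2 ⟨?_, hV⟩, hxV⟩
        rintro rfl
        exact hx hxV
      · intro hx hxU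
        obtain ⟨V, hV, hxV⟩ := mem_iUnion₂.1 hx
        exact (Finset.mem_erase.1 hV).1 (hdisj V (Finset.mem_of_mem_erase hV) U hU ⟨x, hxV, hxU⟩)
    rw [← isOpen_compl_iff, this]
    exact isOpen_biUnion fun V hV => (hS V (Finset.mem_of_mem_erase hV)).isOpen
  -- The members are closed, hence compact, which excludes lines.
  have hcirc : ∀ U ∈ S, ∃ g : Circle → X, IsOpenEmbedding g ∧ range g = U := by
    intro U hU
    rcases hS U hU with ⟨g, hg, hgU⟩ | h
    · exfalso
      have h1 : IsCompact (range g) := hgU ▸ (hclosed U hU).isCompact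
      rw [← image_univ, ← hg.isInducing.isCompact_iff] at h1
      exact noncompact_univ ℝ h1
    · exact h
  choose g hg hgU using hcirc
  let e := S.equivFin
  let F : Fin S.card × Circle → X := fun p => g _ (e.symm p.1).2 p.2
  have hFc : Continuous F := continuous_prod_of_discrete_left.2 fun j =>
    (hg _ (e.symm j).2).continuous
  have hFi : Function.Injective F := by
    rintro ⟨i, z⟩ ⟨j, w⟩ h
    have h1 : ((e.symm i : Set X)) = e.symm j := by
      refine hdisj _ (e.symm i).2 _ (e.symm j).2 ⟨F (i, z), ?_, ?_⟩
      · rw [← hgU _ (e.symm i).2]; exact mem_range_self z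
      · rw [h, ← hgU _ (e.symm j).2]; exact mem_range_self w
    obtain rfl : i = j := e.symm.injective (Subtype.ext h1)
    exact Prod.ext rfl ((hg _ (e.symm i).2).injective h)
  have hFs : Function.Surjective F := by
    intro x
    obtain ⟨U, hU, hx⟩ := hcov x
    rw [← hgU U hU] at hx
    obtain ⟨z, rfl⟩ := hx
    refine ⟨(e ⟨U, hU⟩, z), ?_⟩
    simp [F]
  exact ⟨S.card, ⟨hFc.homeoOfEquivCompactToT2 (f := Equiv.ofBijective F ⟨hFi, hFs⟩)⟩⟩

/-! ### Collars of the boundary -/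

section
variable {X Y : Type*} [TopologicalSpace X] [TopologicalSpace Y] {k : X → Y}

/-- Closedness of the support in the large space is essential: it makes the extended map the
identity near every point outside the open piece. -/
theorem continuous_extend (hk : IsOpenEmbedding k) {h : X → X} (hc : Continuous h) {C : Set X}
    (hC : ∀ x, x ∉ C → h x = x) (hkC : IsClosed (k '' C)) :
    Continuous (Function.extend k (k ∘ h) id) := by
  rw [continuous_iff_continuousAt]
  intro y
  by_cases hy : y ∈ range k
  · obtain ⟨x, rfl⟩ := hy
    rw [← hk.continuousAt_iff]
    have : Function.extend k (k ∘ h) id ∘ k = k ∘ h :=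
      funext fun x => hk.injective.extend_apply _ _ x
    rw [this]
    exact (hk.continuous.comp hc).continuousAt
  · have hy' : y ∈ (k '' C)ᶜ := fun h => hy (image_subset_range _ _ h)
    refine continuousAt_id.congr ?_
    filter_upwards [hkC.isOpen_compl.mem_nhds hy'] with z hz
    by_cases hzk : z ∈ range k
    · obtain ⟨x, rfl⟩ := hzk
      rw [hk.injective.extend_apply, Function.comp_apply, hC x fun hx => hz ⟨x, hx, rfl⟩]
      rfl
    · rw [Function.extend_apply' _ _ _ hzk]

/-- A homeomorphism supported in an open piece extends by the identity. -/
theorem exists_extend_homeomorph (hk : IsOpenEmbedding k) (h : X ≃ₜ X) {C : Set X}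
    (hC : ∀ x, x ∉ C → h x = x) (hkC : IsClosed (k '' C)) :
    ∃ H : Y ≃ₜ Y, (∀ x, H (k x) = k (h x)) ∧ ∀ y, y ∉ range k → H y = y := by
  have inv : ∀ h : X ≃ₜ X, ∀ y, Function.extend k (k ∘ h.symm) id
      (Function.extend k (k ∘ h) id y) = y := by
    intro h y
    by_cases hy : y ∈ range k
    · obtain ⟨x, rfl⟩ := hy
      rw [hk.injective.extend_apply, Function.comp_apply, hk.injective.extend_apply,
        Function.comp_apply, h.symm_apply_apply]
    · rw [Function.extend_apply' _ _ _ hy, id, Function.extend_apply' _ _ _ hy, id]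
  have hC' : ∀ x, x ∉ C → h.symm x = x := fun x hx => by rw [h.symm_apply_eq, hC x hx]
  refine ⟨{ toFun := Function.extend k (k ∘ h) id
            invFun := Function.extend k (k ∘ h.symm) id
            left_inv := inv h
            right_inv := inv h.symm
            continuous_toFun := continuous_extend hk h.continuous hC hkC
            continuous_invFun := continuous_extend hk h.symm.continuous hC' hkC },
    fun x => hk.injective.extend_apply _ _ x, fun y hy => Function.extend_apply' _ _ _ hy⟩

end

/-! ### Half-plane neighborhoods and the exterior collar -/

theorem exists_isOpenEmbedding_Iio {δ : ℝ≥0} (hδ : 0 < δ) :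
    ∃ φ : ℝ≥0 → ℝ≥0, IsOpenEmbedding φ ∧ φ 0 = 0 ∧ range φ = Iio δ := by
  have hr : range (fun r : ℝ≥0 => δ * (r / (1 + r))) = Iio δ := by
    ext y
    constructor
    · rintro ⟨r, rfl⟩
      have h1 : r / (1 + r) < 1 := by
        rw [div_lt_one (by positivity)]
        exact lt_add_of_pos_left _ one_pos
      calc δ * (r / (1 + r)) < δ * 1 := mul_lt_mul_of_pos_left h1 hδ
        _ = δ := mul_one δ
    · intro hy
      have hy' : y < δ := hy
      refine ⟨y / (δ - y), ?_⟩
      have h1 : 0 < δ - y := tsub_pos_of_lt hy'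
      have h2 : 1 + y / (δ - y) = δ / (δ - y) := by
        rw [eq_div_iff h1.ne', add_mul, one_mul, div_mul_cancel₀ _ h1.ne', tsub_add_cancel_of_le hy'.le]
      change δ * (y / (δ - y) / (1 + y / (δ - y))) = y
      rw [h2]
      field_simp
  have hm : StrictMono (fun r : ℝ≥0 => δ * (r / (1 + r))) := by
    intro r s hrs
    refine mul_lt_mul_of_pos_left ?_ hδ
    rw [div_lt_div_iff₀ (by positivity) (by positivity), mul_add, mul_add, mul_one, mul_one,
      mul_comm s r]
    exact add_lt_add_left hrs _
  refine ⟨_, ⟨hm.isEmbedding_of_ordConnected ?_, ?_⟩, by simp, hr⟩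
  · rw [hr]; exact ordConnected_Iio
  · rw [hr]; exact isOpen_Iio

/-- The half-plane as a product. -/
def halfPlaneHomeo : ℝ × ℝ≥0 ≃ₜ HalfPlane where
  toFun p := halfC.symm (p.2 + p.1 * Complex.I)
  invFun x := ((halfC x).im, ⟨(halfC x).re, halfC_re_nonneg x⟩)
  left_inv p := by
    have : halfC (halfC.symm (p.2 + p.1 * Complex.I)) = p.2 + p.1 * Complex.I :=
      halfC_halfC_symm (by simp)
    refine Prod.ext ?_ (Subtype.ext ?_)
    · simp only [this]; simp
    · simp only [this]; simp
  right_inv x := by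
    change halfC.symm (((halfC x).re : ℂ) + (halfC x).im * Complex.I) = x
    rw [Complex.re_add_im, halfC_symm_halfC]
  continuous_toFun := continuous_halfC_symm.comp (by fun_prop)
  continuous_invFun := (Complex.continuous_im.comp continuous_halfC).prodMk
    (Continuous.subtype_mk (Complex.continuous_re.comp continuous_halfC) _)

theorem halfC_halfPlaneHomeo_re (p : ℝ × ℝ≥0) : (halfC (halfPlaneHomeo p)).re = p.2 := by
  change (halfC (halfC.symm (p.2 + p.1 * Complex.I))).re = _
  rw [halfC_halfC_symm (by simp)]
  simp

theorem OrientedSurface.mem_bdry_iff {A : OrientedSurface} {e : OpenPartialHomeomorph A HalfPlane}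
    (he : e ∈ atlas HalfPlane A) {x : A} (hx : x ∈ e.source) :
    x ∈ A.bdry ↔ (halfC (e x)).re = 0 := by
  rw [A.bdry_eq_compl, mem_compl_iff, A.mem_inner_iff he hx, mem_planar_source]
  have : 0 ≤ (halfC (e x)).re := halfC_re_nonneg _
  change ¬ (x ∈ e.source ∧ 0 < (halfC (e x)).re) ↔ _
  constructor
  · intro h
    by_contra h'
    exact h ⟨hx, lt_of_le_of_ne this (Ne.symm h')⟩
  · rintro h ⟨-, h'⟩
    exact h'.ne' h

/-- Half-plane neighborhoods of the boundary points. -/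
theorem OrientedSurface.exists_box {A : OrientedSurface} {b : A} (hb : b ∈ A.bdry) :
    ∃ k : ℝ × ℝ≥0 → A, IsOpenEmbedding k ∧ b ∈ range k ∧ ∀ p, k p ∈ A.bdry ↔ p.2 = 0 := by
  let e := chartAt HalfPlane b
  have hbe : b ∈ e.source := mem_chart_source HalfPlane b
  have hb0 := (A.mem_bdry_iff (chart_mem_atlas HalfPlane b) hbe).1 hb
  obtain ⟨⟨c, r₀⟩, hc⟩ := halfPlaneHomeo.surjective (e b)
  obtain rfl : r₀ = 0 := by
    rw [show chartAt HalfPlane b = e from rfl, ← hc, halfC_halfPlaneHomeo_re] at hb0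
    exact_mod_cast hb0
  have hW : halfPlaneHomeo ⁻¹' e.target ∈ 𝓝 ((c, 0) : ℝ × ℝ≥0) :=
    halfPlaneHomeo.continuous.continuousAt (by
      rw [hc]; exact e.open_target.mem_nhds (e.map_source hbe))
  obtain ⟨δ, hδ, hsub⟩ := Metric.mem_nhds_iff.1 hW
  -- A product neighborhood of radius δ is reparametrized by all of ℝ × [0, ∞), and depth 0 is
  -- preserved.
  obtain ⟨φ, hφ, hφ0, hφr⟩ := exists_isOpenEmbedding_Iio (δ := ⟨δ, hδ.le⟩) hδ
  let ψ := OpenPartialHomeomorph.univBall c δ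
  have hψ : IsOpenEmbedding ψ := ψ.isOpenEmbedding (OpenPartialHomeomorph.univBall_source c δ)
  have hφlt : ∀ r, (φ r : ℝ) < δ := by
    intro r
    have : φ r ∈ Iio (⟨δ, hδ.le⟩ : ℝ≥0) := hφr ▸ mem_range_self r
    exact this
  have hi : ∀ p : ℝ × ℝ≥0, halfPlaneHomeo (ψ p.1, φ p.2) ∈ e.target := by
    intro p
    refine hsub ?_
    rw [← ball_prod_same]
    refine ⟨?_, ?_⟩
    · have : ψ p.1 ∈ ψ.target := ψ.map_source (by
        rw [show ψ.source = univ from OpenPartialHomeomorph.univBall_source c δ]; trivial)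
      rwa [show ψ.target = Metric.ball c δ from OpenPartialHomeomorph.univBall_target c hδ] at this
    · rw [Metric.mem_ball, NNReal.dist_eq]
      simpa using hφlt p.2
  have hie : IsOpenEmbedding (fun p : ℝ × ℝ≥0 => halfPlaneHomeo (ψ p.1, φ p.2)) :=
    halfPlaneHomeo.isOpenEmbedding.comp (hψ.prodMap hφ)
  have hsrc : ∀ p : ℝ × ℝ≥0, e.symm (halfPlaneHomeo (ψ p.1, φ p.2)) ∈ e.source :=
    fun p => e.map_target (hi p)
  refine ⟨fun p => e.symm (halfPlaneHomeo (ψ p.1, φ p.2)), ?_, ?_, ?_⟩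
  · refine .of_continuous_injective_isOpenMap (e.continuousOn_symm.comp_continuous hie.continuous hi)
      (fun p q h => hie.injective (e.symm.injOn (hi p) (hi q) h)) fun U hU => ?_
    have := e.symm.isOpen_image_of_subset_source (hie.isOpenMap U hU) (by
      rintro _ ⟨p, -, rfl⟩
      exact hi p)
    rwa [image_image] at this
  · refine ⟨(0, 0), ?_⟩
    change e.symm (halfPlaneHomeo (OpenPartialHomeomorph.univBall c δ 0, φ 0)) = b
    rw [OpenPartialHomeomorph.univBall_apply_zero, hφ0, hc, e.left_inv hbe]
  · intro p
    rw [A.mem_bdry_iff (chart_mem_atlas HalfPlane b) (hsrc p)]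
    change (halfC (e (e.symm (halfPlaneHomeo (ψ p.1, φ p.2))))).re = 0 ↔ _
    rw [e.right_inv (hi p), halfC_halfPlaneHomeo_re]
    change (φ p.2 : ℝ) = 0 ↔ _
    rw [NNReal.coe_eq_zero]
    exact ⟨fun h => hφ.injective (h.trans hφ0.symm), fun h => by rw [h, hφ0]⟩

/-- The clamping function to the unit interval. -/
def clamp (w : ℝ) : ℝ := max 0 (min 1 w)

theorem clamp_of_one_le {w : ℝ} (h : 1 ≤ w) : clamp w = 1 := by
  rw [clamp, min_eq_left h, max_eq_right zero_le_one]

theorem clamp_of_nonpos {w : ℝ} (h : w ≤ 0) : clamp w = 0 := by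
  rw [clamp, min_eq_right (h.trans zero_le_one), max_eq_left h]

theorem clamp_of_mem {w : ℝ} (h : 0 ≤ w) (h' : w ≤ 1) : clamp w = w := by
  rw [clamp, min_eq_right h', max_eq_right h]

theorem continuous_clamp : Continuous clamp := by unfold clamp; fun_prop

/-- The shift of the fibers of `ℝ × ℝ` over the first factor by a function, cut off above. -/
def shiftHomeo (μ : ℝ → ℝ) (hμ : Continuous μ) (h0 : ∀ s, 0 ≤ μ s) : ℝ × ℝ ≃ₜ ℝ × ℝ where
  -- The shift by μ is complete for heights u ≤ 0, absent for u ≥ 1/2 and interpolated in between.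
  -- If v is the shifted height in the middle range, then 1 − 2v = (1 + 2μ)(1 − 2u), which explains
  -- the inverse.
  toFun p := (p.1, p.2 - μ p.1 * clamp (1 - 2 * p.2))
  invFun p := (p.1, p.2 + μ p.1 * clamp ((1 - 2 * p.2) / (1 + 2 * μ p.1)))
  left_inv := by
    rintro ⟨s, u⟩
    have h := h0 s
    have h1 : 0 < 1 + 2 * μ s := by linarith
    refine Prod.ext rfl ?_
    change u - μ s * clamp (1 - 2 * u) + μ s * clamp ((1 - 2 * (u - μ s * clamp (1 - 2 * u))) /
      (1 + 2 * μ s)) = u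
    rcases le_total u 0 with hu | hu
    · rw [clamp_of_one_le (w := 1 - 2 * u) (by linarith), clamp_of_one_le]
      · ring
      · rw [le_div_iff₀ h1]; linarith
    rcases le_total u (1 / 2) with hu' | hu'
    · have h2 : (1 - 2 * (u - μ s * (1 - 2 * u))) / (1 + 2 * μ s) = 1 - 2 * u := by
        rw [div_eq_iff h1.ne']; ring
      rw [clamp_of_mem (w := 1 - 2 * u) (by linarith) (by linarith), h2,
        clamp_of_mem (by linarith) (by linarith)]
      ring
    · rw [clamp_of_nonpos (w := 1 - 2 * u) (by linarith), clamp_of_nonpos]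
      · ring
      · rw [mul_zero, sub_zero]
        exact div_nonpos_of_nonpos_of_nonneg (by linarith) h1.le
  right_inv := by
    rintro ⟨s, v⟩
    have h := h0 s
    have h1 : 0 < 1 + 2 * μ s := by linarith
    refine Prod.ext rfl ?_
    change v + μ s * clamp ((1 - 2 * v) / (1 + 2 * μ s)) - μ s * clamp (1 - 2 * (v + μ s *
      clamp ((1 - 2 * v) / (1 + 2 * μ s)))) = v
    rcases le_total v (-μ s) with hu | hu
    · rw [clamp_of_one_le (w := (1 - 2 * v) / (1 + 2 * μ s)), clamp_of_one_le]
      · ring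
      · linarith
      · rw [le_div_iff₀ h1]; linarith
    rcases le_total v (1 / 2) with hu' | hu'
    · have h3 : 0 ≤ (1 - 2 * v) / (1 + 2 * μ s) := div_nonneg (by linarith) h1.le
      have h4 : (1 - 2 * v) / (1 + 2 * μ s) ≤ 1 := by rw [div_le_one h1]; linarith
      have h2 : 1 - 2 * (v + μ s * ((1 - 2 * v) / (1 + 2 * μ s))) =
          (1 - 2 * v) / (1 + 2 * μ s) := by
        field_simp; ring
      rw [clamp_of_mem h3 h4, h2, clamp_of_mem h3 h4]
      ring
    · rw [clamp_of_nonpos (w := (1 - 2 * v) / (1 + 2 * μ s)), clamp_of_nonpos]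
      · ring
      · linarith
      · exact div_nonpos_of_nonpos_of_nonneg (by linarith) h1.le
  continuous_toFun := by
    have := continuous_clamp
    fun_prop
  continuous_invFun := by
    refine continuous_fst.prodMk (continuous_snd.add ((hμ.comp continuous_fst).mul
      (continuous_clamp.comp (Continuous.div (by fun_prop) (by fun_prop) fun p => ?_))))
    have := h0 p.1
    positivity

/-- The surface with an open exterior collar. -/
abbrev Extended (A : OrientedSurface) : Type :=
  {p : A × ℝ // p.2 ≤ 0 ∧ (p.2 = 0 ∨ p.1 ∈ A.bdry)}

section
variable {A : OrientedSurface} {k : ℝ × ℝ≥0 → A}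

/-- The extension of a half-plane neighborhood to the exterior collar. -/
def extendBox (hb : ∀ p, k p ∈ A.bdry ↔ p.2 = 0) (p : ℝ × ℝ) : Extended A :=
  ⟨(k (p.1, p.2.toNNReal), min p.2 0), min_le_right _ _, by
    rcases le_total p.2 0 with h | h
    · right; rw [hb]; exact Real.toNNReal_of_nonpos h
    · left; exact min_eq_right h⟩

/-- The depth inside the surface and the exterior height are never both non-zero, so their sum
determines both. -/
theorem mem_range_extendBox (hb : ∀ p, k p ∈ A.bdry ↔ p.2 = 0) {q : Extended A}
    {p : ℝ × ℝ≥0} (h : q.1.1 = k p) : extendBox hb (p.1, p.2 + q.1.2) = q := by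
  obtain ⟨⟨x, t⟩, ht, ht'⟩ := q
  obtain rfl : x = k p := h
  obtain ⟨s, r⟩ := p
  refine Subtype.ext (Prod.ext ?_ ?_)
  · change k (s, Real.toNNReal (r + t)) = k (s, r)
    rcases ht' with ht' | ht'
    · rw [show t = 0 from ht', add_zero, Real.toNNReal_coe]
    · obtain rfl : r = 0 := (hb _).1 ht'
      rw [NNReal.coe_zero, zero_add, Real.toNNReal_of_nonpos ht]
  · change min (r + t) 0 = t
    rcases ht' with ht' | ht'
    · rw [show t = 0 from ht', add_zero]
      exact min_eq_right r.2
    · obtain rfl : r = 0 := (hb _).1 ht'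
      rw [NNReal.coe_zero, zero_add, min_eq_left ht]

theorem isOpenEmbedding_extendBox (hk : IsOpenEmbedding k)
    (hb : ∀ p, k p ∈ A.bdry ↔ p.2 = 0) : IsOpenEmbedding (extendBox hb) := by
  have hadd : ∀ u : ℝ, (u.toNNReal : ℝ) + min u 0 = u := by
    intro u
    rcases le_total u 0 with h | h
    · rw [Real.toNNReal_of_nonpos h, min_eq_left h]; simp
    · rw [Real.coe_toNNReal _ h, min_eq_right h, add_zero]
  have hinj : Function.Injective (extendBox hb) := by
    rintro ⟨s, u⟩ ⟨s', u'⟩ h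
    have h1 := hk.injective (congrArg (fun q => q.1.1) h)
    have h2 : min u 0 = min u' 0 := congrArg (fun q => q.1.2) h
    have h3 : u.toNNReal = u'.toNNReal := congrArg Prod.snd h1
    have h4 : s = s' := congrArg Prod.fst h1
    refine Prod.ext h4 ?_
    change u = u'
    rw [← hadd u, ← hadd u', h2, h3]
  refine .of_continuous_injective_isOpenMap ?_ hinj fun U hU => ?_
  · refine Continuous.subtype_mk ((hk.continuous.comp ?_).prodMk ?_) _
    · exact continuous_fst.prodMk (continuous_real_toNNReal.comp continuous_snd)
    · fun_prop
  · let e := hk.toOpenPartialHomeomorph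
    have hke : ∀ x ∈ range k, k (e.symm x) = x := fun x hx =>
      e.right_inv (by rw [show e.target = range k by simp [e]]; exact hx)
    have hc : ContinuousOn e.symm (range k) := by
      have := e.continuousOn_symm
      rwa [show e.target = range k by simp [e]] at this
    have h1 : ContinuousOn (fun q : Extended A => ((e.symm q.1.1).1, ((e.symm q.1.1).2 : ℝ) + q.1.2))
        {q | q.1.1 ∈ range k} := by
      have h2 : ContinuousOn (fun q : Extended A => e.symm q.1.1) {q | q.1.1 ∈ range k} :=
        hc.comp (by fun_prop) fun q hq => hq
      exact (continuous_fst.comp_continuousOn h2).prodMk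
        ((NNReal.continuous_coe.comp_continuousOn (continuous_snd.comp_continuousOn h2)).add
          (by fun_prop))
    have h2 : IsOpen {q : Extended A | q.1.1 ∈ range k} :=
      hk.isOpen_range.preimage (by fun_prop)
    convert h1.isOpen_inter_preimage h2 hU using 1
    ext q
    constructor
    · rintro ⟨p, hp, rfl⟩
      have hr : (extendBox hb p).1.1 ∈ range k := mem_range_self _
      refine ⟨hr, ?_⟩
      have h3 := mem_range_extendBox hb (q := extendBox hb p) (hke _ hr).symm
      change (_, _) ∈ U
      rwa [hinj h3]
    · rintro ⟨hq, hq'⟩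
      exact ⟨_, hq', mem_range_extendBox hb (hke _ hq).symm⟩

/-- Pushing the boundary into the exterior collar, near a point. -/
theorem exists_push (hk : IsOpenEmbedding k) (hb : ∀ p, k p ∈ A.bdry ↔ p.2 = 0)
    {l : A → ℝ} (hl : Continuous l) (h0 : ∀ x, 0 ≤ l x) (hs : tsupport l ⊆ range k) :
    ∃ H : Extended A ≃ₜ Extended A, ∀ b ∈ A.bdry, ∀ q : Extended A, q.1.1 = b →
      (H q).1 = (b, q.1.2 - l b) := by
  have hμ : Continuous fun s : ℝ => l (k (s, 0)) :=
    hl.comp (hk.continuous.comp (by fun_prop))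
  let h := shiftHomeo (fun s => l (k (s, 0))) hμ fun s => h0 _
  -- The compact part of the edge that supports `l`. The shift is the identity off `K ×ˢ Iic (1 /
  -- 2)`.
  let K : Set ℝ := Prod.fst '' (k ⁻¹' (tsupport l ∩ A.bdry))
  have hK : IsCompact K := by
    refine IsCompact.image ?_ continuous_fst
    rw [hk.isInducing.isCompact_preimage_iff (inter_subset_left.trans hs)]
    exact ((isClosed_tsupport l).inter A.isClosed_bdry).isCompact
  obtain ⟨H, hH1, hH2⟩ := exists_extend_homeomorph (isOpenEmbedding_extendBox hk hb) h
    (C := K ×ˢ Iic (1 / 2)) (by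
      rintro ⟨s, u⟩ hsu
      refine Prod.ext rfl ?_
      change u - l (k (s, 0)) * clamp (1 - 2 * u) = u
      by_cases hsK : s ∈ K
      · have : 1 / 2 < u := by
          by_contra hu
          exact hsu ⟨hsK, not_lt.1 hu⟩
        rw [clamp_of_nonpos (by linarith)]
        ring
      · have : l (k (s, 0)) = 0 := by
          by_contra hne
          exact hsK ⟨(s, 0), ⟨subset_tsupport l hne, (hb _).2 rfl⟩, rfl⟩
        rw [this]
        ring)
    (by
      -- The support in the extended surface is the preimage of this set under the projection to
      -- `A`. Here `Iic (1 / 2)` consists of non-negative numbers, so it is compact.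
      have h1 : IsClosed (k '' (K ×ˢ Iic (1 / 2))) :=
        ((hK.prod (by
          rw [← Icc_bot]
          exact isCompact_Icc)).image hk.continuous).isClosed
      convert h1.preimage (show Continuous fun q : Extended A => q.1.1 by fun_prop) using 1
      ext q
      constructor
      · rintro ⟨⟨s, u⟩, ⟨hs, hu⟩, rfl⟩
        refine ⟨_, ⟨hs, ?_⟩, rfl⟩
        change u.toNNReal ≤ 1 / 2
        rw [Real.toNNReal_le_iff_le_coe]
        simpa using hu
      · rintro ⟨⟨s, r⟩, ⟨hs, hr⟩, hq⟩
        refine ⟨_, ⟨hs, ?_⟩, mem_range_extendBox hb hq.symm⟩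
        have h1 : (r : ℝ) ≤ 1 / 2 := by
          have : r ≤ 1 / 2 := hr
          exact_mod_cast this
        change (r : ℝ) + q.1.2 ≤ 1 / 2
        linarith [q.2.1])
  refine ⟨H, fun b hbA q hq => ?_⟩
  by_cases hbk : b ∈ range k
  · obtain ⟨⟨s, r⟩, rfl⟩ := hbk
    obtain rfl : r = 0 := (hb _).1 hbA
    have h1 := mem_range_extendBox hb hq
    have h2 := hH1 (s, q.1.2)
    rw [NNReal.coe_zero, zero_add] at h1
    rw [h1] at h2
    have h3 : h (s, q.1.2) = (s, q.1.2 - l (k (s, 0))) := by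
      refine Prod.ext rfl ?_
      change q.1.2 - l (k (s, 0)) * clamp (1 - 2 * q.1.2) = _
      rw [clamp_of_one_le (by linarith [q.2.1]), mul_one]
    have h4 : q.1.2 - l (k (s, 0)) ≤ 0 := by linarith [q.2.1, h0 (k (s, 0))]
    rw [h2, h3]
    refine Prod.ext ?_ ?_
    · change k (s, (q.1.2 - l (k (s, 0))).toNNReal) = _
      rw [Real.toNNReal_of_nonpos h4]
    · exact min_eq_left h4
  · have h1 : l b = 0 := by
      by_contra hne
      exact hbk (hs (subset_tsupport l hne))
    rw [hH2 q, h1, sub_zero, ← hq]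
    rintro ⟨p, rfl⟩
    exact hbk (hq ▸ mem_range_self _)

end

/-- Connelly's argument for collars: the local pushes are weighted by a partition of unity on the
boundary and composed. Each keeps the exterior fibers and shifts them by its weight, so the shifts
add up to 1. -/
theorem OrientedSurface.exists_push (A : OrientedSurface) :
    ∃ H : Extended A ≃ₜ Extended A, ∀ q : Extended A, q.1.1 ∈ A.bdry →
      (H q).1 = (q.1.1, q.1.2 - 1) := by
  classical
  have hbox : ∀ b : A.bdry, ∃ k : ℝ × ℝ≥0 → A, IsOpenEmbedding k ∧ (b : A) ∈ range k ∧
      ∀ p, k p ∈ A.bdry ↔ p.2 = 0 := fun b => A.exists_box b.2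
  choose k hk hbk hb using hbox
  obtain ⟨t, ht⟩ := A.isClosed_bdry.isCompact.elim_finite_subcover (fun b : A.bdry => range (k b))
    (fun b => (hk b).isOpen_range) (fun b hbA => mem_iUnion.2 ⟨⟨b, hbA⟩, hbk ⟨b, hbA⟩⟩)
  obtain ⟨f, hf⟩ := PartitionOfUnity.exists_isSubordinate A.isClosed_bdry
    (fun b : t => range (k b)) (fun b => (hk b).isOpen_range) (by
      intro x hx
      obtain ⟨b, hbt, hxb⟩ := mem_iUnion₂.1 (ht hx)
      exact mem_iUnion.2 ⟨⟨b, hbt⟩, hxb⟩)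
  have hsum : ∀ S : Finset t, ∃ H : Extended A ≃ₜ Extended A, ∀ q : Extended A, q.1.1 ∈ A.bdry →
      (H q).1 = (q.1.1, q.1.2 - ∑ i ∈ S, f i q.1.1) := by
    intro S
    induction S using Finset.induction_on with
    | empty => exact ⟨Homeomorph.refl _, fun q _ => by simp⟩
    | insert i S hi ih =>
      obtain ⟨H, hH⟩ := ih
      obtain ⟨G, hG⟩ := Doodle.exists_push (hk i) (hb i) (f i).continuous (f.nonneg i) (hf i)
      refine ⟨H.trans G, fun q hq => ?_⟩
      rw [Homeomorph.trans_apply, hG _ hq (H q) (by rw [hH q hq]), hH q hq, Finset.sum_insert hi]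
      refine Prod.ext rfl ?_
      change _ - _ - _ = _ - (_ + _)
      ring
  obtain ⟨H, hH⟩ := hsum Finset.univ
  refine ⟨H, fun q hq => ?_⟩
  rw [hH q hq, ← finsum_eq_sum_of_fintype, f.sum_eq_one hq]

/-- The boundary of a surface has a collar. -/
theorem OrientedSurface.exists_collar_bdry (A : OrientedSurface) :
    ∃ c : A.bdry × ℝ≥0 → A, IsOpenEmbedding c ∧ ∀ b : A.bdry, c (b, 0) = b := by
  obtain ⟨H, hH⟩ := A.exists_push
  have hneg : ∀ r : ℝ≥0, -(1 / (1 + (r : ℝ))) < 0 := fun r => by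
    have : 0 < 1 / (1 + (r : ℝ)) := by positivity
    linarith
  -- The heights −1/(1+r) run from −1 at r = 0 up towards 0. This is the exterior part that `H`
  -- covers with points of the surface itself; its preimage under `H` is the collar.
  let i : A.bdry × ℝ≥0 → Extended A := fun p =>
    ⟨(p.1, -(1 / (1 + (p.2 : ℝ)))), (hneg p.2).le, Or.inr p.1.2⟩
  let j : A → Extended A := fun x => ⟨(x, 0), le_rfl, Or.inl rfl⟩
  have hic : Continuous i := by
    refine Continuous.subtype_mk (Continuous.prodMk (by fun_prop) ?_) _
    refine (Continuous.div continuous_const (by fun_prop) fun p => ?_).neg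
    positivity
  have hjc : Continuous j := Continuous.subtype_mk (by fun_prop) _
  -- A point of negative height is moved by `H` to a height below −1, which `i` does not attain.
  have h1 : ∀ p, ((H.symm (i p)).1).2 = 0 := by
    intro p
    by_contra hne
    have hq := (H.symm (i p)).2
    have h2 := hH _ (hq.2.resolve_left hne)
    rw [H.apply_symm_apply] at h2
    have h3 : -(1 / (1 + (p.2 : ℝ))) = ((H.symm (i p)).1).2 - 1 := congrArg Prod.snd h2
    have h4 : ((H.symm (i p)).1).2 < 0 := lt_of_le_of_ne hq.1 hne
    have h5 : 1 / (1 + (p.2 : ℝ)) ≤ 1 := by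
      rw [div_le_one (by positivity)]
      linarith [p.2.2]
    linarith
  have h2 : ∀ p, j (H.symm (i p)).1.1 = H.symm (i p) := fun p =>
    Subtype.ext (Prod.ext rfl (h1 p).symm)
  have hW : ∀ x : {x : A | (H (j x)).1.2 < 0}, (H (j x)).1.1 ∈ A.bdry := fun x =>
    (H (j x)).2.2.resolve_left (show (H (j x)).1.2 < 0 from x.2).ne
  -- A point of height below −1 is the image of the exterior point one unit above it, so it is not
  -- the image of a point of height 0.
  have h3 : ∀ x : {x : A | (H (j x)).1.2 < 0}, -1 ≤ (H (j x)).1.2 := by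
    intro x
    by_contra hlt
    let q : Extended A := ⟨((H (j x)).1.1, (H (j x)).1.2 + 1), by
      change _ + 1 ≤ (0 : ℝ); linarith, Or.inr (hW x)⟩
    have h4 : H q = H (j x) := Subtype.ext ((hH q (hW x)).trans (Prod.ext rfl (by
      change _ + 1 - 1 = _; ring)))
    have h5 : (H (j x)).1.2 + 1 = 0 := congrArg (fun q => q.1.2) (H.injective h4)
    linarith
  let c : A.bdry × ℝ≥0 ≃ₜ {x : A | (H (j x)).1.2 < 0} :=
    { toFun := fun p => ⟨(H.symm (i p)).1.1, by
        change (H (j (H.symm (i p)).1.1)).1.2 < 0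
        rw [h2, H.apply_symm_apply]
        exact hneg p.2⟩
      invFun := fun x => (⟨(H (j x)).1.1, hW x⟩, (-(1 / (H (j x)).1.2) - 1).toNNReal)
      left_inv := by
        rintro ⟨b, r⟩
        simp only [h2, H.apply_symm_apply]
        refine Prod.ext rfl ?_
        change (-(1 / -(1 / (1 + (r : ℝ)))) - 1).toNNReal = r
        rw [div_neg, neg_neg, one_div_one_div, add_sub_cancel_left, Real.toNNReal_coe]
      right_inv := by
        intro x
        apply Subtype.ext
        have hx : (H (j x)).1.2 < 0 := x.2
        have h4 : 0 ≤ -(1 / (H (j x)).1.2) - 1 := by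
          have : 1 ≤ 1 / (-(H (j x)).1.2) := by
            rw [le_div_iff₀ (by linarith)]
            linarith [h3 x]
          rw [div_neg] at this
          linarith
        have h5 : i (⟨(H (j x)).1.1, hW x⟩, (-(1 / (H (j x)).1.2) - 1).toNNReal) = H (j x) := by
          refine Subtype.ext (Prod.ext rfl ?_)
          change -(1 / (1 + ((-(1 / (H (j x)).1.2) - 1).toNNReal : ℝ))) = _
          rw [Real.coe_toNNReal _ h4, add_sub_cancel, one_div, one_div, inv_neg, inv_inv, neg_neg]
        change (H.symm (i _)).1.1 = (x : A)
        rw [h5, H.symm_apply_apply]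
      continuous_toFun := continuous_induced_rng.2 (continuous_fst.comp
        (continuous_subtype_val.comp (H.symm.continuous.comp hic)))
      continuous_invFun := by
        refine Continuous.prodMk (Continuous.subtype_mk (by fun_prop) _)
          (continuous_real_toNNReal.comp ?_)
        refine ((Continuous.div continuous_const (by fun_prop) fun x => ?_).neg).sub
          continuous_const
        exact (show (H (j x)).1.2 < 0 from x.2).ne }
  have hopen : IsOpen {x : A | (H (j x)).1.2 < 0} := isOpen_lt (by fun_prop) continuous_const
  refine ⟨fun p => c p, hopen.isOpenEmbedding_subtypeVal.comp c.isOpenEmbedding, fun b => ?_⟩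
  have h4 : H (j b) = i (b, 0) := by
    refine Subtype.ext ((hH (j b) b.2).trans (Prod.ext rfl ?_))
    change (0 : ℝ) - 1 = -(1 / (1 + ((0 : ℝ≥0) : ℝ)))
    simp
  change (H.symm (i (b, 0))).1.1 = b
  rw [← h4, H.symm_apply_apply]

/-- The boundary of a surface consists of finitely many circles, and it has a collar. -/
theorem OrientedSurface.exists_collar (A : OrientedSurface) :
    ∃ (m : ℕ) (c : (Fin m × Circle) × ℝ≥0 → A), IsOpenEmbedding c ∧
      (∀ p, c p ∈ A.bdry ↔ p.2 = 0) ∧ A.bdry ⊆ range c := by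
  have hc : CompactSpace A.bdry := isCompact_iff_compactSpace.1 A.isClosed_bdry.isCompact
  -- The edges of the half-plane neighborhoods are the open lines that make the boundary a
  -- 1-manifold.
  obtain ⟨m, ⟨θ⟩⟩ := exists_homeomorph_circles (X := A.bdry) (by
    intro b
    obtain ⟨k, hk, ⟨⟨s, r⟩, hsr⟩, hb⟩ := A.exists_box b.2
    have hr : r = 0 := (hb (s, r)).1 (hsr ▸ b.2)
    refine ⟨fun s => ⟨k (s, 0), (hb _).2 rfl⟩, ?_, ⟨s, Subtype.ext (by rw [← hsr, hr])⟩⟩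
    refine .of_continuous_injective_isOpenMap
      (Continuous.subtype_mk (hk.continuous.comp (by fun_prop)) _) (fun s t h => ?_)
      fun U hU => ?_
    · exact congrArg Prod.fst (hk.injective (congrArg Subtype.val h))
    · convert (hk.isOpenMap _ (hU.prod isOpen_univ)).preimage continuous_subtype_val using 1
      ext x
      constructor
      · rintro ⟨s, hs, rfl⟩
        exact ⟨(s, 0), ⟨hs, trivial⟩, rfl⟩
      · rintro ⟨⟨s, r⟩, ⟨hs, -⟩, hsx⟩
        have hr : r = 0 := (hb (s, r)).1 (hsx ▸ x.2)
        exact ⟨s, hs, Subtype.ext (by rw [← hsx, hr])⟩)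
  obtain ⟨c, hc, hc0⟩ := A.exists_collar_bdry
  have hemb : IsOpenEmbedding fun p : (Fin m × Circle) × ℝ≥0 => c (θ p.1, p.2) :=
    hc.comp (θ.isOpenEmbedding.prodMap .id)
  refine ⟨m, _, hemb, fun p => ⟨fun h => ?_, fun h => ?_⟩, fun b hb => ?_⟩
  · have h1 := hc.injective (hc0 ⟨_, h⟩)
    exact (congrArg Prod.snd h1).symm
  · rw [h, hc0]
    exact (θ p.1).2
  · refine ⟨(θ.symm ⟨b, hb⟩, 0), ?_⟩
    change c (θ (θ.symm ⟨b, hb⟩), 0) = b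
    rw [θ.apply_symm_apply, hc0]

/-! ### Collars as ends -/

/-- The identity or the inversion of the circle. -/
def flipCircle (b : Bool) (ζ : Circle) : Circle := if b then ζ⁻¹ else ζ

theorem flipCircle_flipCircle (b : Bool) (ζ : Circle) : flipCircle b (flipCircle b ζ) = ζ := by
  unfold flipCircle; split_ifs <;> simp

theorem continuous_flipCircle (b : Bool) : Continuous (flipCircle b) := by
  cases b
  · exact continuous_id
  · exact continuous_inv

theorem dir_flip {b : Bool} {z : ℂ} (hz : z ≠ 0) : dir (flip b z) = flipCircle b (dir z) := by
  cases b
  · rfl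
  · apply Subtype.ext
    change (dir (flip true z) : ℂ) = ((dir z)⁻¹ : Circle)
    rw [coe_dir (flip_ne_zero.2 hz), norm_flip, Circle.coe_inv_eq_conj, coe_dir hz]
    simp [flip]

/-- Fiberwise inversion of circles. -/
def flipCirclesHomeo {m : ℕ} (ε : Fin m → Bool) : Fin m × Circle ≃ₜ Fin m × Circle where
  toFun p := (p.1, flipCircle (ε p.1) p.2)
  invFun p := (p.1, flipCircle (ε p.1) p.2)
  left_inv p := by simp [flipCircle_flipCircle]
  right_inv p := by simp [flipCircle_flipCircle]
  continuous_toFun := continuous_prod_of_discrete_left.2 fun j =>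
    continuous_const.prodMk (continuous_flipCircle (ε j))
  continuous_invFun := continuous_prod_of_discrete_left.2 fun j =>
    continuous_const.prodMk (continuous_flipCircle (ε j))

/-- Polar coordinates for planes. -/
def planePolar {J : Type*} (p : J × ℂ) : (J × Circle) × ℝ≥0 := ((p.1, dir p.2), ‖p.2‖₊)

/-- The inverse of the polar coordinates. -/
def planePolarInv {J : Type*} (q : (J × Circle) × ℝ≥0) : J × ℂ := (q.1.1, (q.2 : ℝ) * q.1.2)

section
variable {J : Type*}

theorem planePolarInv_planePolar (p : J × ℂ) : planePolarInv (planePolar p) = p :=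
  Prod.ext rfl (norm_mul_dir p.2)

theorem planePolar_planePolarInv {q : (J × Circle) × ℝ≥0} (hq : q.2 ≠ 0) :
    planePolar (planePolarInv q) = q := by
  obtain ⟨⟨j, ζ⟩, r⟩ := q
  have hr : 0 < r := pos_iff_ne_zero.2 hq
  refine Prod.ext (Prod.ext rfl ?_) (Subtype.ext ?_)
  · exact dir_mul hr ζ
  · change ‖((r : ℝ) : ℂ) * ζ‖ = r
    rw [norm_mul, Circle.norm_coe, mul_one, Complex.norm_real, Real.norm_of_nonneg r.coe_nonneg]

theorem planePolar_snd_ne_zero {p : J × ℂ} (hp : p ∈ punctured J) : (planePolar p).2 ≠ 0 :=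
  nnnorm_ne_zero_iff.2 hp

theorem planePolarInv_mem_punctured {q : (J × Circle) × ℝ≥0} (hq : q.2 ≠ 0) :
    planePolarInv q ∈ punctured J :=
  mul_ne_zero (by exact_mod_cast hq) q.1.2.coe_ne_zero

theorem planePolar_image (P : ℝ → Prop) : planePolar '' (punctured J ∩ {p | P ‖p.2‖}) =
    {q | q.2 ≠ 0 ∧ P q.2} := by
  ext q
  constructor
  · rintro ⟨p, ⟨hp, hp'⟩, rfl⟩
    exact ⟨planePolar_snd_ne_zero hp, hp'⟩
  · rintro ⟨hq, hq'⟩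
    refine ⟨planePolarInv q, ⟨planePolarInv_mem_punctured hq, ?_⟩, planePolar_planePolarInv hq⟩
    have h : ‖(planePolarInv q).2‖ = q.2 :=
      congrArg (fun q => (q.2 : ℝ)) (planePolar_planePolarInv hq)
    change P _
    rwa [h]

variable [TopologicalSpace J]

theorem continuousOn_planePolar : ContinuousOn (planePolar : J × ℂ → _) (punctured J) :=
  ContinuousOn.prodMk (continuous_fst.continuousOn.prodMk
    (continuousOn_dir.comp continuous_snd.continuousOn fun _ hp => hp))
    (continuous_nnnorm.comp continuous_snd).continuousOn

theorem continuous_planePolarInv : Continuous (planePolarInv : _ → J × ℂ) := by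
  unfold planePolarInv
  fun_prop

theorem planePolar_image_mem_nhds {p : J × ℂ} (hp : p ∈ punctured J) {V : Set (J × ℂ)}
    (hV : V ∈ 𝓝 p) : planePolar '' V ∈ 𝓝 (planePolar p) := by
  refine image_mem_nhds_of_inverse continuous_planePolarInv.continuousAt
    (planePolarInv_planePolar p) ?_ hV
  filter_upwards [(isOpen_ne_fun continuous_snd continuous_const).mem_nhds
    (planePolar_snd_ne_zero hp)] with q hq
  exact planePolar_planePolarInv hq

end

/-- A collar of the boundary of the ambient surface of a diagram, disjoint from the diagram, and
such that its orientation is the standard one. -/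
structure Collar (A : DoodleDiagram) (m : ℕ) where
  c : (Fin m × Circle) × ℝ≥0 → A.surface
  isOpenEmbedding : IsOpenEmbedding c
  mem_bdry_iff : ∀ p, c p ∈ A.surface.bdry ↔ p.2 = 0
  bdry_subset : A.surface.bdry ⊆ range c
  disjoint : Disjoint (range c) A.image
  ends : Ends A.surface (Fin m)
  ends_O : ends.O = A.surface.inner
  ends_e : ∀ p ∈ punctured (Fin m), ends.e p = c (planePolar p)

theorem OrientedSurface.mem_inner_iff_notMem {A : OrientedSurface} {x : A} :
    x ∈ A.inner ↔ x ∉ A.bdry := by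
  rw [A.bdry_eq_compl, notMem_compl_iff]

/-- The tube lemma gives a uniform depth up to which the collar avoids the compact diagram, and this
part is reparametrized to infinite depth. Reversing some boundary circles makes the punctured planes
given by the collar positively oriented. -/
theorem exists_collar (A : DoodleDiagram) : ∃ m, Nonempty (Collar A m) := by
  obtain ⟨m, c₀, hc₀, hb₀, hs₀⟩ := A.surface.exists_collar
  -- shrink the collar
  obtain ⟨δ, hδ, hδA⟩ : ∃ δ : ℝ≥0, 0 < δ ∧ ∀ p, p.2 < δ → c₀ p ∉ A.image := by
    have hcl : IsClosed (c₀ ⁻¹' A.image) :=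
      (isCompact_range A.continuous_curve).isClosed.preimage hc₀.continuous
    have hU : (univ : Set (Fin m × Circle)) ×ˢ ({0} : Set ℝ≥0) ⊆ (c₀ ⁻¹' A.image)ᶜ := by
      rintro ⟨p, r⟩ ⟨-, hr⟩ ⟨q, hq⟩
      have h1 := A.curve_mem_inner q
      rw [hq, OrientedSurface.mem_inner_iff_notMem, hb₀] at h1
      exact h1 hr
    obtain ⟨u, v, -, hv, hu, h0, huv⟩ := generalized_tube_lemma isCompact_univ isCompact_singleton
      hcl.isOpen_compl hU
    obtain ⟨δ, hδ, hsub⟩ := Metric.mem_nhds_iff.1 (hv.mem_nhds (h0 rfl))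
    refine ⟨⟨δ, hδ.le⟩, hδ, fun p hp => ?_⟩
    have : p ∈ u ×ˢ v := by
      refine ⟨hu trivial, hsub ?_⟩
      rw [Metric.mem_ball, NNReal.dist_eq]
      have hp' : (p.2 : ℝ) < δ := hp
      simpa using hp'
    exact huv this
  obtain ⟨φ, hφ, hφ0, hφr⟩ := exists_isOpenEmbedding_Iio hδ
  let c₁ : (Fin m × Circle) × ℝ≥0 → A.surface := fun p => c₀ (p.1, φ p.2)
  have hc₁ : IsOpenEmbedding c₁ := hc₀.comp (IsOpenEmbedding.id.prodMap hφ)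
  have hb₁ : ∀ p, c₁ p ∈ A.surface.bdry ↔ p.2 = 0 := by
    intro p
    rw [hb₀]
    exact ⟨fun h => hφ.injective (h.trans hφ0.symm), fun h => by
      change φ p.2 = 0
      rw [h, hφ0]⟩
  have hs₁ : A.surface.bdry ⊆ range c₁ := by
    intro b hb
    obtain ⟨⟨p, r⟩, rfl⟩ := hs₀ hb
    obtain rfl : r = 0 := (hb₀ _).1 hb
    exact ⟨(p, 0), by simp [c₁, hφ0]⟩
  have hd₁ : Disjoint (range c₁) A.image := by
    rw [Set.disjoint_left]
    rintro _ ⟨p, rfl⟩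
    refine hδA _ ?_
    have : φ p.2 ∈ Iio δ := hφr ▸ mem_range_self _
    exact this
  have hinner : ∀ p, c₁ p ∈ A.surface.inner ↔ p.2 ≠ 0 := fun p => by
    rw [OrientedSurface.mem_inner_iff_notMem, hb₁]
  have hsets : ∀ (P : ℝ → Prop) (S : Set ℝ≥0), 0 ∈ S → (∀ s : ℝ≥0, s ∈ S ↔ P s) →
      A.surface.inner \ (c₁ ∘ planePolar) '' (punctured (Fin m) ∩ {p | P ‖p.2‖}) =
      (c₁ '' (univ ×ˢ S))ᶜ := by
    intro P S h0 hS
    rw [image_comp, planePolar_image]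
    ext x
    constructor
    · rintro ⟨hx, hx'⟩ ⟨p, ⟨-, hp⟩, rfl⟩
      exact hx' ⟨p, ⟨(hinner p).1 hx, (hS _).1 hp⟩, rfl⟩
    · intro hx
      refine ⟨?_, ?_⟩
      · rw [OrientedSurface.mem_inner_iff_notMem]
        intro hxb
        obtain ⟨p, rfl⟩ := hs₁ hxb
        refine hx ⟨p, ⟨trivial, ?_⟩, rfl⟩
        rw [(hb₁ p).1 hxb]
        exact h0
      · rintro ⟨p, ⟨-, hp⟩, rfl⟩
        exact hx ⟨p, ⟨trivial, (hS _).2 hp⟩, rfl⟩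
  have s1 := hsets (fun r => r ≤ 1) (Iic 1) (by simp) (fun s => by simp)
  have s2 := hsets (fun r => r < 1) (Iio 1) (by simp) (fun s => by simp)
  obtain ⟨E, ε, hEO, hEe, -, -⟩ := exists_ends (A := A.surface) (J := Fin m)
    (O := A.surface.inner) (g := c₁ ∘ planePolar) A.surface.isOpen_inner
    (hc₁.continuous.comp_continuousOn continuousOn_planePolar)
    (fun p hp q hq h => by
      have := hc₁.injective h
      rw [← planePolarInv_planePolar p, this, planePolarInv_planePolar])
    (fun p hp V hV => by
      rw [image_comp]
      exact hc₁.isOpenMap.image_mem_nhds (planePolar_image_mem_nhds hp hV))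
    (fun p hp => (hinner _).2 (planePolar_snd_ne_zero hp))
    (fun p hp => (hinner _).2 (planePolar_snd_ne_zero hp))
    (by
      rw [s1]
      have : IsCompact (Iic (1 : ℝ≥0)) := by rw [← Icc_bot]; exact isCompact_Icc
      exact ((isCompact_univ.prod this).image hc₁.continuous).isClosed.isOpen_compl)
    (by
      rw [s2]
      exact ((hc₁.isOpenMap _ (isOpen_univ.prod isOpen_Iio)).isClosed_compl).isCompact)
  -- Conjugating a punctured plane amounts to reversing its boundary circle, which does not change
  -- the range of the collar.
  have hrange : range (c₁ ∘ Prod.map (flipCirclesHomeo ε) id) = range c₁ :=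
    ((flipCirclesHomeo ε).surjective.prodMap Function.surjective_id).range_comp c₁
  exact ⟨m, ⟨{
    c := c₁ ∘ Prod.map (flipCirclesHomeo ε) id
    isOpenEmbedding := hc₁.comp ((flipCirclesHomeo ε).isOpenEmbedding.prodMap .id)
    mem_bdry_iff := fun p => hb₁ _
    bdry_subset := by rw [hrange]; exact hs₁
    disjoint := by rw [hrange]; exact hd₁
    ends := E
    ends_O := hEO
    ends_e := fun p hp => by
      rw [hEe]
      change c₁ ((p.1, dir (flip (ε p.1) p.2)), ‖flip (ε p.1) p.2‖₊) = _
      rw [dir_flip hp, show ‖flip (ε p.1) p.2‖₊ = ‖p.2‖₊ from Subtype.ext (norm_flip _ _)]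
      rfl }⟩⟩

/-! ### Squeezing the collar -/

/-- A reparametrization of the line by the positive reals. -/
def squeeze (s : ℝ) : ℝ≥0 :=
  -- This is e^s for s ≤ 0 and max(s, 1 + s/2) for s ≥ 0. It maps (−∞, 0] onto (0, 1] and [0, ∞)
  -- onto [1, ∞), and it is the identity from 2 on.
  ⟨Real.exp (min s 0) + (max (max s (1 + s / 2)) 1 - 1), by
    have h1 := Real.exp_pos (min s 0)
    have h2 : (1 : ℝ) ≤ max (max s (1 + s / 2)) 1 := le_max_right _ _
    linarith⟩

theorem squeeze_of_nonpos {s : ℝ} (hs : s ≤ 0) : (squeeze s : ℝ) = Real.exp s := by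
  change Real.exp (min s 0) + (max (max s (1 + s / 2)) 1 - 1) = _
  rw [min_eq_left hs, max_eq_right (max_le (by linarith) (by linarith))]
  ring

theorem squeeze_of_nonneg {s : ℝ} (hs : 0 ≤ s) : (squeeze s : ℝ) = max s (1 + s / 2) := by
  change Real.exp (min s 0) + (max (max s (1 + s / 2)) 1 - 1) = _
  rw [min_eq_right hs, max_eq_left (le_max_of_le_right (by linarith)), Real.exp_zero]
  ring

theorem squeeze_zero : squeeze 0 = 1 := NNReal.eq (by
  rw [squeeze_of_nonpos le_rfl, Real.exp_zero, NNReal.coe_one])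

theorem squeeze_of_two_le {s : ℝ≥0} (hs : 2 ≤ s) : squeeze s = s := NNReal.eq (by
  have hs' : (2 : ℝ) ≤ s := hs
  rw [squeeze_of_nonneg s.coe_nonneg, max_eq_left (by linarith)])

theorem squeeze_pos (s : ℝ) : 0 < squeeze s := by
  have h1 := Real.exp_pos (min s 0)
  have h2 : (1 : ℝ) ≤ max (max s (1 + s / 2)) 1 := le_max_right _ _
  change 0 < Real.exp (min s 0) + (max (max s (1 + s / 2)) 1 - 1)
  linarith

theorem continuous_squeeze : Continuous squeeze :=
  Continuous.subtype_mk (by fun_prop) _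

theorem strictMono_squeeze : StrictMono squeeze := by
  have h1 : StrictMonoOn squeeze (Iic 0) := by
    intro s hs t ht hst
    change (squeeze s : ℝ) < squeeze t
    rw [squeeze_of_nonpos hs, squeeze_of_nonpos ht]
    exact Real.exp_strictMono hst
  have h2 : StrictMonoOn squeeze (Ici 0) := by
    intro s hs t ht hst
    change (squeeze s : ℝ) < squeeze t
    rw [squeeze_of_nonneg hs, squeeze_of_nonneg ht]
    exact max_lt_max hst (by linarith)
  exact h1.Iic_union_Ici h2

theorem one_le_squeeze_iff {s : ℝ} : 1 ≤ squeeze s ↔ 0 ≤ s := by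
  rw [← squeeze_zero, strictMono_squeeze.le_iff_le]

theorem range_squeeze : range squeeze = Ioi 0 := by
  ext y
  constructor
  · rintro ⟨s, rfl⟩
    exact squeeze_pos s
  · intro hy
    have hy' : (0 : ℝ) < y := hy
    rcases le_total (y : ℝ) 1 with h | h
    · refine ⟨Real.log y, NNReal.eq ?_⟩
      rw [squeeze_of_nonpos (Real.log_nonpos hy'.le h), Real.exp_log hy']
    rcases le_total (y : ℝ) 2 with h' | h'
    · refine ⟨2 * (y - 1), NNReal.eq ?_⟩
      rw [squeeze_of_nonneg (by linarith), max_eq_right (by linarith)]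
      ring
    · exact ⟨y, squeeze_of_two_le h'⟩

theorem isOpenEmbedding_squeeze : IsOpenEmbedding squeeze :=
  ⟨strictMono_squeeze.isEmbedding_of_ordConnected (by rw [range_squeeze]; exact ordConnected_Ioi),
    by rw [range_squeeze]; exact isOpen_Ioi⟩

namespace Collar

variable {A : DoodleDiagram} {m : ℕ} (C : Collar A m)

theorem mem_inner_iff (p : (Fin m × Circle) × ℝ≥0) : C.c p ∈ A.surface.inner ↔ p.2 ≠ 0 := by
  rw [OrientedSurface.mem_inner_iff_notMem, C.mem_bdry_iff]

theorem mem_inner_of_notMem {x : A.surface} (hx : x ∉ range C.c) : x ∈ A.surface.inner := by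
  rw [OrientedSurface.mem_inner_iff_notMem]
  exact fun h => hx (C.bdry_subset h)

/-- The embedding of the surface into its interior which squeezes the collar. -/
def push : A.surface → A.surface :=
  Function.extend C.c (C.c ∘ Prod.map id fun r : ℝ≥0 => squeeze r) id

theorem push_c (p : (Fin m × Circle) × ℝ≥0) : C.push (C.c p) = C.c (p.1, squeeze p.2) :=
  C.isOpenEmbedding.injective.extend_apply _ _ p

theorem push_of_notMem {x : A.surface} (hx : x ∉ range C.c) : C.push x = x :=
  Function.extend_apply' _ _ _ hx

theorem push_curve (p : Fin A.n × Circle) : C.push (A.curve p) = A.curve p :=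
  C.push_of_notMem (Set.disjoint_right.1 C.disjoint (mem_range_self p))

theorem map_eq_of_notMem {p : (Fin m × Circle) × ℝ≥0} (hp : p ∉ (univ ×ˢ Iic (2 : ℝ≥0))) :
    Prod.map id (fun r : ℝ≥0 => squeeze r) p = p := by
  refine Prod.ext rfl (squeeze_of_two_le ?_)
  by_contra h
  exact hp ⟨trivial, (not_le.1 h).le⟩

theorem isClosed_image (r : ℝ≥0) : IsClosed (C.c '' (univ ×ˢ Iic r)) := by
  have : IsCompact (Iic r) := by rw [← Icc_bot]; exact isCompact_Icc
  exact ((isCompact_univ.prod this).image C.isOpenEmbedding.continuous).isClosed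

theorem continuous_push : Continuous C.push :=
  continuous_extend C.isOpenEmbedding (continuous_id.prodMap
    (continuous_squeeze.comp NNReal.continuous_coe)) (fun _ => map_eq_of_notMem)
    (C.isClosed_image 2)

theorem push_injective : Function.Injective C.push := by
  intro x y h
  by_cases hx : x ∈ range C.c <;> by_cases hy : y ∈ range C.c
  · obtain ⟨⟨p, r⟩, rfl⟩ := hx
    obtain ⟨⟨q, s⟩, rfl⟩ := hy
    rw [push_c, push_c] at h
    have h1 := C.isOpenEmbedding.injective h
    have h2 : r = s := NNReal.coe_injective (strictMono_squeeze.injective (congrArg Prod.snd h1))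
    have h3 : p = q := congrArg Prod.fst h1
    rw [h2, h3]
  · obtain ⟨p, rfl⟩ := hx
    rw [push_c, C.push_of_notMem hy] at h
    exact (hy (h ▸ mem_range_self _)).elim
  · obtain ⟨p, rfl⟩ := hy
    rw [push_c, C.push_of_notMem hx] at h
    exact (hx (h ▸ mem_range_self _)).elim
  · rwa [C.push_of_notMem hx, C.push_of_notMem hy] at h

theorem push_mem_inner (x : A.surface) : C.push x ∈ A.surface.inner := by
  by_cases hx : x ∈ range C.c
  · obtain ⟨p, rfl⟩ := hx
    rw [push_c, mem_inner_iff]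
    exact (squeeze_pos _).ne'
  · rw [C.push_of_notMem hx]
    exact C.mem_inner_of_notMem hx

theorem degAt_push_of_notMem {x : A.surface} (hx : x ∈ A.surface.inner)
    (hx' : x ∉ C.c '' (univ ×ˢ Iic 2)) : DegAt C.push x 1 := by
  refine (degAt_id (by rwa [A.surface.regular_eq])).congr ?_
  filter_upwards [(C.isClosed_image 2).isOpen_compl.mem_nhds hx'] with y hy
  by_cases hyc : y ∈ range C.c
  · obtain ⟨p, rfl⟩ := hyc
    exact congrArg C.c (map_eq_of_notMem fun hp => hy ⟨p, hp, rfl⟩).symm |>.trans (C.push_c p).symm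
  · exact (C.push_of_notMem hyc).symm

/-- Along a component of the collar without its boundary the degree is constant, and at depth 3 the
map is the identity nearby. -/
theorem degAt_push {x : A.surface} (hx : x ∈ A.surface.inner) : DegAt C.push x 1 := by
  by_cases hxc : x ∈ range C.c
  · obtain ⟨⟨⟨j, ζ⟩, r⟩, rfl⟩ := hxc
    have hr := (C.mem_inner_iff _).1 hx
    let U : Set A.surface := C.c '' (({j} ×ˢ univ) ×ˢ Ioi 0)
    have hUo : IsOpen U := C.isOpenEmbedding.isOpenMap _
      (((isOpen_discrete _).prod isOpen_univ).prod isOpen_Ioi)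
    have hUc : IsPreconnected U :=
      ((isPreconnected_singleton.prod isPreconnected_univ).prod isPreconnected_Ioi).image _
        C.isOpenEmbedding.continuous.continuousOn
    have hUi : U ⊆ A.surface.inner := by
      rintro _ ⟨p, hp, rfl⟩
      exact (C.mem_inner_iff p).2 (ne_of_gt hp.2)
    refine DegAt.of_isPreconnected hUo hUc C.continuous_push.continuousOn C.push_injective.injOn
      (by rwa [A.surface.regular_eq])
      (fun y _ => by rw [A.surface.regular_eq]; exact C.push_mem_inner y)
      (x := C.c ((j, ζ), 3)) ⟨((j, ζ), 3), ⟨⟨rfl, trivial⟩, by simp⟩, rfl⟩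
      (C.degAt_push_of_notMem ((C.mem_inner_iff _).2 (by simp)) ?_)
      ⟨((j, ζ), r), ⟨⟨rfl, trivial⟩, pos_iff_ne_zero.2 hr⟩, rfl⟩
    rintro ⟨p, ⟨-, hp⟩, hpe⟩
    rw [C.isOpenEmbedding.injective hpe] at hp
    have : (3 : ℝ≥0) ≤ 2 := hp
    norm_num at this
  · exact C.degAt_push_of_notMem hx fun h => hxc (image_subset_range _ _ h)

/-! ### The canonical capped surface -/

/-- The embedding into the capped surface. -/
def toCap (x : A.surface) : C.ends.cap :=
  C.ends.inl ⟨C.push x, by rw [C.ends_O]; exact C.push_mem_inner x⟩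

theorem isOrientedEmbedding_toCap : IsOrientedEmbedding C.toCap := by
  refine isOrientedEmbedding_iff.2 ⟨?_, ?_, ?_⟩
  · exact C.ends.continuous_inl.comp (Continuous.subtype_mk C.continuous_push _)
  · intro x y h
    exact C.push_injective (congrArg Subtype.val (C.ends.inl_injective h))
  · intro x hx
    have hO : ∀ y, C.push y ∈ C.ends.O := fun y => by rw [C.ends_O]; exact C.push_mem_inner y
    have h1 := DegAt.comp (f := C.push) (C.ends.degAt_projOph_symm (C.toCap x)
      (x := ⟨_, hO x⟩) (C.push_mem_inner x)) (C.degAt_push hx)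
      ((C.ends.projOph (C.toCap x)).continuousAt_symm ((C.ends.projOph_target _).symm ▸ hO x))
      C.continuous_push.continuousAt
    exact h1.congr (Filter.Eventually.of_forall fun y =>
      C.ends.projOph_symm_apply (C.toCap x) ⟨_, hO y⟩)

/-- The diagram in the canonical capped surface. -/
def capped : DoodleDiagram := A.map (Y := C.ends.cap) C.toCap C.isOrientedEmbedding_toCap.mapsDoodle

theorem disk_planePolarInv {q : (Fin m × Circle) × ℝ≥0} (hq : q.2 ≠ 0)
    (h : C.c q ∈ C.ends.O) : C.ends.disk (planePolarInv q) = C.ends.inl ⟨C.c q, h⟩ := by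
  rw [C.ends.disk_of_ne (planePolarInv_mem_punctured hq)]
  refine congrArg C.ends.inl (Subtype.ext ?_)
  change C.ends.e _ = _
  rw [C.ends_e _ (planePolarInv_mem_punctured hq), planePolar_planePolarInv hq]

theorem norm_planePolarInv (q : (Fin m × Circle) × ℝ≥0) : ‖(planePolarInv q).2‖ = q.2 := by
  change ‖((q.2 : ℝ) : ℂ) * q.1.2‖ = _
  rw [norm_mul, Circle.norm_coe, mul_one, Complex.norm_real, Real.norm_of_nonneg q.2.coe_nonneg]

theorem inl_eq_disk {x : C.ends.O} {p : Fin m × ℂ} (h : C.ends.disk p = C.ends.inl x) :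
    p ∈ punctured (Fin m) ∧ (x : A.surface) = C.c (planePolar p) := by
  have hp : p ∈ punctured (Fin m) := by
    by_contra hp
    rw [C.ends.disk_of_eq hp] at h
    exact C.ends.inl_ne_inr _ _ h.symm
  refine ⟨hp, ?_⟩
  rw [C.ends.disk_of_ne hp] at h
  rw [← C.ends_e _ hp]
  exact (congrArg Subtype.val (C.ends.inl_injective h)).symm

theorem bdry_cap : C.ends.cap.bdry = ∅ := C.ends.bdry_cap (by rw [C.ends_O])

/-- Squeezing maps the depths r ≥ 0 onto the depths r ≥ 1, so the squeezed surface is exactly the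
complement of the open unit disks at the ends, and its boundary goes to the unit circles. -/
theorem isCapping (k : DiagramKind) : IsCapping k A C.capped := by
  have hO : ∀ {q : (Fin m × Circle) × ℝ≥0}, q.2 ≠ 0 → C.c q ∈ C.ends.O := fun hq => by
    rw [C.ends_O]; exact (C.mem_inner_iff _).2 hq
  refine ⟨C.bdry_cap, C.toCap, m, C.ends.disk, C.isOrientedEmbedding_toCap, SameImage.refl k _,
    C.ends.continuous_disk.continuousOn, C.ends.disk_injective.injOn, ?_, ?_, ?_⟩
  · refine eq_univ_of_forall fun y => ?_
    rcases C.ends.eq_inl_or_inr y with ⟨x, rfl⟩ | ⟨j, rfl⟩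
    · by_cases hx : (x : A.surface) ∈ range C.c
      · obtain ⟨⟨p, r⟩, hpx⟩ := hx
        have hr : r ≠ 0 := by
          have h1 : (x : A.surface) ∈ A.surface.inner := C.ends_O ▸ x.2
          rw [← hpx] at h1
          exact (C.mem_inner_iff _).1 h1
        have hx' : C.ends.inl x = C.ends.inl ⟨C.c (p, r), hO hr⟩ :=
          congrArg C.ends.inl (Subtype.ext hpx.symm)
        rcases le_total 1 r with h1 | h1
        · left
          obtain ⟨s, hs⟩ : r ∈ range squeeze := by
            rw [range_squeeze]; exact pos_iff_ne_zero.2 hr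
          have hs0 : 0 ≤ s := by rwa [← one_le_squeeze_iff, hs]
          refine ⟨C.c (p, ⟨s, hs0⟩), ?_⟩
          rw [hx']
          refine congrArg C.ends.inl (Subtype.ext ?_)
          change C.push _ = _
          rw [push_c]
          change C.c (p, squeeze s) = _
          rw [hs]
        · right
          refine ⟨planePolarInv (p, r), ⟨trivial, ?_⟩, ?_⟩
          · rw [mem_closedBall_zero_iff, norm_planePolarInv]
            exact h1
          · exact (C.disk_planePolarInv (q := (p, r)) hr (hO hr)).trans hx'.symm
      · exact Or.inl ⟨x, congrArg C.ends.inl (Subtype.ext (C.push_of_notMem hx))⟩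
    · exact Or.inr ⟨(j, 0), by simp, C.ends.disk_zero j⟩
  · rw [Set.disjoint_left]
    rintro _ ⟨x, rfl⟩ ⟨p, ⟨-, hp⟩, hpx⟩
    obtain ⟨-, h2⟩ := C.inl_eq_disk hpx
    change C.push x = _ at h2
    by_cases hx : x ∈ range C.c
    · obtain ⟨q, rfl⟩ := hx
      rw [push_c] at h2
      have h3 : squeeze q.2 = ‖p.2‖₊ := congrArg Prod.snd (C.isOpenEmbedding.injective h2)
      have h4 : 1 ≤ squeeze q.2 := one_le_squeeze_iff.2 q.2.2
      rw [h3] at h4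
      rw [mem_ball_zero_iff] at hp
      exact absurd hp (not_lt.2 h4)
    · rw [C.push_of_notMem hx] at h2
      exact hx (h2 ▸ mem_range_self _)
  · ext y
    constructor
    · rintro ⟨b, hb, rfl⟩
      obtain ⟨⟨p, r⟩, rfl⟩ := C.bdry_subset hb
      obtain rfl : r = 0 := (C.mem_bdry_iff _).1 hb
      refine ⟨planePolarInv (p, 1), ⟨trivial, ?_⟩, ?_⟩
      · rw [mem_sphere_zero_iff_norm, norm_planePolarInv]
        simp
      · refine (C.disk_planePolarInv (q := (p, 1)) one_ne_zero (hO one_ne_zero)).trans ?_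
        refine congrArg C.ends.inl (Subtype.ext ?_)
        change _ = C.push _
        rw [push_c, NNReal.coe_zero, squeeze_zero]
    · rintro ⟨p, ⟨-, hp⟩, rfl⟩
      rw [mem_sphere_zero_iff_norm] at hp
      have hp0 : p ∈ punctured (Fin m) := by
        change p.2 ≠ 0
        rw [← norm_pos_iff, hp]
        exact one_pos
      refine ⟨C.c ((p.1, dir p.2), 0), (C.mem_bdry_iff _).2 rfl, ?_⟩
      rw [C.ends.disk_of_ne hp0]
      refine congrArg C.ends.inl (Subtype.ext ?_)
      change C.push _ = C.ends.e p
      rw [push_c, NNReal.coe_zero, squeeze_zero, C.ends_e _ hp0, planePolar,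
        show ‖p.2‖₊ = 1 from Subtype.ext hp]

end Collar

/-! ### Surgery -/

theorem OperationEquivalent.of_orientedHomeomorphic {k : DiagramKind} {A B : DoodleDiagram}
    (h : OrientedHomeomorphic k A B) : OperationEquivalent k A B :=
  .rel _ _ (Or.inr (Or.inr (Or.inr h)))

theorem flip_zero (b : Bool) : flip b 0 = 0 := by cases b <;> simp [flip]

/-- Surgery along an annulus. The map `r` is the identification of the complement of the core of
the annulus with the complement of two points, and `δ` is the disk around one of them. -/
theorem exists_surgery (A : DoodleDiagram) {a : Circle × ℝ → A.surface} (ha : IsOpenEmbedding a)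
    (ha' : range a ⊆ A.surface.inner) (hA : Disjoint (range a) A.image) :
    ∃ (W : OrientedSurface) (r : A.surface → W) (δ : ℂ → W),
      ContinuousOn r (a '' (univ ×ˢ {0}))ᶜ ∧ InjOn r (a '' (univ ×ˢ {0}))ᶜ ∧
      (∀ x ∈ (a '' (univ ×ˢ {0}))ᶜ, x ∈ A.surface.inner → DegAt r x 1) ∧
      (∀ V, IsOpen V → V ⊆ (a '' (univ ×ˢ {0}))ᶜ → IsOpen (r '' V)) ∧
      Continuous δ ∧ (∀ w, δ w ∈ W.inner) ∧ (∀ x ∈ (a '' (univ ×ˢ {0}))ᶜ, r x ≠ δ 0) ∧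
      (∀ w, w ≠ 0 → δ w = r (a (dir w, ‖w‖))) ∧ (A.surface.bdry = ∅ → W.bdry = ∅) ∧
      ∀ (k : DiagramKind) (U : Set A.surface) (h : MapsDoodle A r U),
        HandleRemoval k A (A.map r h) := by
  obtain ⟨E, ε, hEO, hEe, hEo, hEc⟩ := exists_ends_of_annulus ha ha'
  let r : A.surface → E.Cap := (E.projOph (E.inr true)).symm
  have hr : ∀ {x} (hx : x ∈ E.O), r x = E.inl ⟨x, hx⟩ := fun hx => E.projOph_symm_apply _ ⟨_, hx⟩
  have hrc : ContinuousOn r E.O := by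
    have := (E.projOph (E.inr true)).continuousOn_symm
    rwa [Ends.projOph_target] at this
  have hri : InjOn r E.O := fun x hx y hy h => by
    rw [hr hx, hr hy] at h
    exact congrArg Subtype.val (E.inl_injective h)
  have hrd : ∀ x ∈ E.O, x ∈ A.surface.inner → DegAt r x 1 := fun x hx hx' =>
    E.degAt_projOph_symm _ (x := ⟨x, hx⟩) hx'
  have hcO : E.coreSet ⊆ E.O := fun x hx => hx.1
  have hdisk : ∀ p ∈ punctured Bool, E.disk (flips ε p) = r (a (polar p)) := by
    intro p hp
    have h1 := flips_mem_punctured (ε := ε).2 hp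
    rw [E.disk_of_ne h1, ← hr]
    rw [hEe]
    simp only [Function.comp_apply, flips_flips]
  rw [← hEO]
  -- The disk on the positive side of the annulus is conjugated if necessary, so that it continues
  -- the given polar coordinates. It may thus reverse the orientation, and no degree is claimed for
  -- it.
  refine ⟨E.cap, r, fun w => E.disk (true, flip (ε true) w), hrc, hri, hrd, ?_, ?_, ?_, ?_, ?_, ?_, ?_⟩
  · intro V hV hVO
    exact (E.projOph (E.inr true)).symm.isOpen_image_of_subset_source hV (by
      change V ⊆ (E.projOph (E.inr true)).target
      rwa [Ends.projOph_target])
  · exact E.continuous_disk.comp (continuous_const.prodMk (continuous_flip _))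
  · exact fun w => E.disk_mem_inner _
  · intro x hx
    have h1 : E.disk (true, flip (ε true) 0) = E.inr true := by rw [flip_zero, E.disk_zero]
    exact fun h => E.inl_ne_inr ⟨x, hx⟩ true (((hr hx).symm.trans h).trans h1)
  · intro w hw
    refine (hdisk (true, w) hw).trans ?_
    simp [polar, side]
  · intro hb
    refine E.bdry_cap fun x _ => ?_
    rw [OrientedSurface.mem_inner_iff_notMem, hb]
    exact notMem_empty x
  · intro k U h
    refine ⟨a, E.disk ∘ flips ε, r, ha, ha', hA,
      E.isOpenEmbedding_disk.comp (flipsHomeo ε).isOpenEmbedding, ?_, ?_⟩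
    · rintro _ ⟨p, rfl⟩
      exact E.disk_mem_inner _
    rw [← hEc]
    have himage : (E.disk ∘ flips ε) '' (univ ×ˢ Metric.ball 0 1) =
        E.disk '' (univ ×ˢ Metric.ball 0 1) := by
      rw [image_comp]
      congr 1
      ext p
      constructor
      · rintro ⟨q, ⟨-, hq⟩, rfl⟩
        refine ⟨trivial, ?_⟩
        rw [mem_ball_zero_iff] at hq ⊢
        exact (norm_flip _ _).trans_lt hq
      · rintro ⟨-, hp⟩
        refine ⟨flips ε p, ⟨trivial, ?_⟩, flips_flips ε p⟩
        rw [mem_ball_zero_iff] at hp ⊢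
        exact (norm_flip _ _).trans_lt hp
    refine ⟨hrc.mono hcO, ⟨?_, hri.mono hcO, ?_⟩, ?_, ?_, SameImage.refl k _⟩
    · intro x hx
      refine fun hxd => ?_
      have hxd' : r x ∈ E.disk '' (univ ×ˢ Metric.ball 0 1) := himage ▸ hxd
      obtain ⟨p, ⟨-, hp⟩, hpx⟩ := hxd'
      rw [hr (hcO hx)] at hpx
      by_cases hp0 : p ∈ punctured Bool
      · rw [E.disk_of_ne hp0] at hpx
        have h1 : E.e p = x := congrArg Subtype.val (E.inl_injective hpx)
        rw [← h1, E.mem_coreSet_iff hp0] at hx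
        rw [mem_ball_zero_iff] at hp
        exact absurd hp (not_lt.2 hx)
      · rw [E.disk_of_eq hp0] at hpx
        exact E.inl_ne_inr _ _ hpx.symm
    · intro y hy
      replace hy : y ∉ E.disk '' (univ ×ˢ Metric.ball 0 1) := fun h => hy (himage.symm ▸ h)
      rcases E.eq_inl_or_inr y with ⟨x, rfl⟩ | ⟨j, rfl⟩
      · refine ⟨x, ⟨x.2, ?_⟩, hr x.2⟩
        rintro ⟨p, ⟨hp, hp'⟩, hpx⟩
        refine hy ⟨p, ⟨trivial, mem_ball_zero_iff.2 hp'⟩, ?_⟩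
        rw [E.disk_of_ne hp]
        exact congrArg E.inl (Subtype.ext hpx)
      · exact (hy ⟨(j, 0), by simp, E.disk_zero j⟩).elim
    · exact (orientationPreservingOn_iff (Y := E.cap) (hrc.mono hcO) (hri.mono hcO)).2
        fun x hx hx' => hrd x (hcO (interior_subset hx)) hx'
    · intro z
      have h1 : ∀ b : Bool, ((b, (z : ℂ)) : Bool × ℂ) ∈ punctured Bool := fun b => z.coe_ne_zero
      constructor
      · refine Eq.trans ?_ (hdisk _ (h1 true)).symm
        simp only [polar, side, dir_coe, Circle.norm_coe]
        norm_num
        rfl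
      · refine Eq.trans ?_ (hdisk _ (h1 false)).symm
        simp only [polar, side, dir_coe, Circle.norm_coe]
        norm_num
        rfl

section
variable {Y : DoodleDiagram} {m : ℕ}

/-- The complement of the centers of some disks. -/
def offCenters (D : Fin m × ℂ → Y.surface) (T : Finset (Fin m)) : Set Y.surface :=
  ((fun j => D (j, 0)) '' (T : Set (Fin m)))ᶜ

/-- A map from a closed surface, defined outside the centers of some disks, which near these
centers parametrizes one half of an annulus. -/
structure IsSpreading (D : Fin m × ℂ → Y.surface) (T : Finset (Fin m)) {Z : OrientedSurface}
    (F : Y.surface → Z) (a : Fin m → Circle × ℝ → Z) : Prop where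
  maps : MapsDoodle Y F (offCenters D T)
  isOpenEmbedding : ∀ j ∈ T, IsOpenEmbedding (a j)
  disjoint : ∀ i ∈ T, ∀ j ∈ T, i ≠ j → Disjoint (range (a i)) (range (a j))
  of_pos : ∀ j ∈ T, ∀ (ζ : Circle) (s : ℝ), 0 < s → a j (ζ, s) = F (D (j, s * ζ))
  of_nonpos : ∀ j ∈ T, ∀ (ζ : Circle) (s : ℝ), s ≤ 0 → ∀ y ∈ offCenters D T, a j (ζ, s) ≠ F y

variable {D : Fin m × ℂ → Y.surface}

theorem center_mem_offCenters (hD : IsOpenEmbedding D) {T : Finset (Fin m)} {j : Fin m} {z : ℂ}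
    (h : z ≠ 0 ∨ j ∉ T) : D (j, z) ∈ offCenters D T := by
  rintro ⟨i, hi, hij⟩
  have := hD.injective hij
  rcases h with h | h
  · exact h (congrArg Prod.snd this).symm
  · have hij' : i = j := congrArg Prod.fst this
    exact h (hij' ▸ hi)

theorem isOpenEmbedding_slice {J X : Type*} [TopologicalSpace J] [DiscreteTopology J]
    [TopologicalSpace X] {D : J × ℂ → X} (hD : IsOpenEmbedding D) (j : J) :
    IsOpenEmbedding fun z => D (j, z) :=
  hD.comp (.of_continuous_injective_isOpenMap (by fun_prop)
    (Prod.mk_right_injective j) fun U hU => by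
      have : Prod.mk j '' U = {j} ×ˢ U := by ext ⟨a, b⟩; simp [eq_comm, and_comm]
      rw [this]
      exact (isOpen_discrete _).prod hU)

/-- Surgery along the annulus of `j₀` replaces its core by two points. The positive half of the
annulus is the image of the punctured disk of `j₀`, so the map extends continuously by sending the
center of this disk to the new point on the positive side. The other half of the annulus avoids the
image, which keeps the extension injective. -/
theorem IsSpreading.exists_surgery (hY : Y.surface.bdry = ∅) (hD : IsOpenEmbedding D)
    (hDY : Disjoint (range D) Y.image) {T : Finset (Fin m)} {j₀ : Fin m} (hj₀ : j₀ ∉ T)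
    {Z : OrientedSurface} (hZ : Z.bdry = ∅) {F : Y.surface → Z} {a : Fin m → Circle × ℝ → Z}
    (h : IsSpreading D (insert j₀ T) F a) (k : DiagramKind) :
    ∃ (W : OrientedSurface) (G : Y.surface → W) (b : Fin m → Circle × ℝ → W),
      W.bdry = ∅ ∧ ∃ h' : IsSpreading D T G b,
        OperationEquivalent k (Y.map F h.maps) (Y.map G h'.maps) := by
  classical
  have hinner : ∀ {X : OrientedSurface}, X.bdry = ∅ → ∀ x, x ∈ X.inner := fun hX x => by
    rw [OrientedSurface.mem_inner_iff_notMem, hX]; exact notMem_empty x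
  have hjm := Finset.mem_insert_self j₀ T
  have hTm : ∀ {j}, j ∈ T → j ∈ insert j₀ T := Finset.mem_insert_of_mem
  have hYoff : ∀ S, Y.image ⊆ offCenters D S := by
    rintro S x hx ⟨i, -, rfl⟩
    exact Set.disjoint_right.1 hDY hx (mem_range_self _)
  have hsub : offCenters D (insert j₀ T) = offCenters D T \ {D (j₀, 0)} := by
    ext y
    simp only [offCenters, Finset.coe_insert, image_insert_eq, mem_compl_iff, mem_insert_iff,
      Set.mem_sdiff, mem_singleton_iff]
    tauto
  obtain ⟨W, r, δ, hrc, hri, hrd, hro, hδc, hδi, hδ0, hδ, hWb, hW⟩ :=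
    Doodle.exists_surgery (Y.map F h.maps) (h.isOpenEmbedding j₀ hjm)
      (fun x _ => hinner hZ x) (by
        rw [Set.disjoint_left]
        rintro _ ⟨⟨ζ, s⟩, rfl⟩ ⟨p, hp⟩
        have hp' : F (Y.curve p) = a j₀ (ζ, s) := hp
        rcases lt_or_ge 0 s with hs | hs
        · rw [h.of_pos j₀ hjm ζ s hs] at hp'
          have h1 := h.maps.injOn (hYoff _ (mem_range_self p)) (center_mem_offCenters hD (Or.inl
            (mul_ne_zero (by exact_mod_cast hs.ne') ζ.coe_ne_zero))) hp'
          exact Set.disjoint_left.1 hDY (mem_range_self _) ⟨p, h1⟩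
        · exact h.of_nonpos j₀ hjm ζ s hs _ (hYoff _ (mem_range_self p)) hp'.symm)
  set O : Set Z := (a j₀ '' (univ ×ˢ {0}))ᶜ
  change Z → W at r
  have hOo : IsOpen O :=
    ((isCompact_univ.prod isCompact_singleton).image
      (h.isOpenEmbedding j₀ hjm).continuous).isClosed.isOpen_compl
  have hFO : ∀ y ∈ offCenters D (insert j₀ T), F y ∈ O := by
    rintro y hy ⟨⟨ζ, s⟩, ⟨-, hs⟩, hsy⟩
    exact h.of_nonpos j₀ hjm ζ s (le_of_eq hs) y hy hsy
  have haO : ∀ j ∈ T, ∀ q, a j q ∈ O := by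
    rintro j hj q ⟨q', -, hq⟩
    have hne : j₀ ≠ j := by rintro rfl; exact hj₀ hj
    exact Set.disjoint_left.1 (h.disjoint j₀ hjm j (hTm hj) hne) ⟨q', hq⟩ (mem_range_self q)
  -- On the whole disk of `j₀` this is `δ`, hence continuous at the center although it is defined by
  -- cases.
  let G : Y.surface → W := fun y => if y = D (j₀, 0) then δ 0 else r (F y)
  have hG : ∀ {y}, y ≠ D (j₀, 0) → G y = r (F y) := fun hy => if_neg hy
  have hGD : ∀ w, G (D (j₀, w)) = δ w := by
    intro w
    by_cases hw : w = 0
    · rw [hw]; exact if_pos rfl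
    · have hne : D (j₀, w) ≠ D (j₀, 0) := fun h' => hw (congrArg Prod.snd (hD.injective h'))
      rw [hG hne, hδ w hw, h.of_pos j₀ hjm _ _ (norm_pos_iff.2 hw), norm_mul_dir]
  have hDj := isOpenEmbedding_slice hD j₀
  have hoffO : IsOpen (offCenters D T) := ((T.finite_toSet.image _).isClosed).isOpen_compl
  have hGc : ContinuousOn G (offCenters D T) := by
    intro y hy
    refine ContinuousAt.continuousWithinAt ?_
    by_cases hy0 : y = D (j₀, 0)
    · rw [hy0]
      refine (hDj.continuousAt_iff (x := 0)).1 ?_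
      exact (hδc.congr fun w => (hGD w).symm).continuousAt
    · have hy' : y ∈ offCenters D (insert j₀ T) := by rw [hsub]; exact ⟨hy, hy0⟩
      have h1 : ContinuousAt (r ∘ F) y :=
        ContinuousAt.comp (hrc.continuousAt (hOo.mem_nhds (hFO y hy')))
          (h.maps.continuousOn.continuousAt (h.maps.isOpen.mem_nhds hy'))
      refine h1.congr ?_
      filter_upwards [isOpen_ne.mem_nhds hy0] with z hz
      exact (hG hz).symm
  have hGi : InjOn G (offCenters D T) := by
    intro y hy z hz hyz
    by_cases hy0 : y = D (j₀, 0) <;> by_cases hz0 : z = D (j₀, 0)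
    · rw [hy0, hz0]
    · rw [hy0, hGD, hG hz0] at hyz
      exact (hδ0 _ (hFO z (by rw [hsub]; exact ⟨hz, hz0⟩)) hyz.symm).elim
    · rw [hz0, hGD, hG hy0] at hyz
      exact (hδ0 _ (hFO y (by rw [hsub]; exact ⟨hy, hy0⟩)) hyz).elim
    · rw [hG hy0, hG hz0] at hyz
      have hy' : y ∈ offCenters D (insert j₀ T) := by rw [hsub]; exact ⟨hy, hy0⟩
      have hz' : z ∈ offCenters D (insert j₀ T) := by rw [hsub]; exact ⟨hz, hz0⟩
      exact h.maps.injOn hy' hz' (hri (hFO y hy') (hFO z hz') hyz)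
  have hGd' : ∀ y ∈ offCenters D (insert j₀ T), DegAt G y 1 := by
    intro y hy
    have hy0 : y ≠ D (j₀, 0) := by rw [hsub] at hy; exact hy.2
    have h1 : DegAt (r ∘ F) y 1 := DegAt.comp (hrd _ (hFO y hy) (hinner hZ _)) (h.maps.deg y hy)
      (hrc.continuousAt (hOo.mem_nhds (hFO y hy)))
      (h.maps.continuousOn.continuousAt (h.maps.isOpen.mem_nhds hy))
    refine h1.congr ?_
    filter_upwards [isOpen_ne.mem_nhds hy0] with z hz
    exact (hG hz).symm
  have hGd : ∀ y ∈ offCenters D T, DegAt G y 1 := by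
    intro y hy
    -- At the center the degree is found by constancy along the disk, from its known value at
    -- another point of the disk.
    by_cases hy0 : y = D (j₀, 0)
    · rw [hy0]
      have hUT : range (fun z => D (j₀, z)) ⊆ offCenters D T := by
        rintro _ ⟨z, rfl⟩
        exact center_mem_offCenters hD (Or.inr hj₀)
      refine DegAt.of_isPreconnected (U := range fun z => D (j₀, z)) hDj.isOpen_range
        (isPreconnected_range hDj.continuous) (hGc.mono hUT) (hGi.mono hUT) ?_ ?_
        (mem_range_self 1) (hGd' _ (center_mem_offCenters hD (Or.inl one_ne_zero)))
        (mem_range_self 0)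
      · intro z _
        rw [Y.surface.regular_eq]
        exact hinner hY z
      · rintro _ ⟨z, rfl⟩
        rw [W.regular_eq, hGD]
        exact hδi z
    · exact hGd' y (by rw [hsub]; exact ⟨hy, hy0⟩)
  have hmaps : MapsDoodle Y G (offCenters D T) := ⟨hoffO, hYoff T, hGc, hGi, hGd⟩
  refine ⟨W, G, fun j => r ∘ a j, hWb hZ, ⟨hmaps, ?_, ?_, ?_, ?_⟩, ?_⟩
  · intro j hj
    have hja := h.isOpenEmbedding j (hTm hj)
    refine .of_continuous_injective_isOpenMap (hrc.comp_continuous hja.continuous (haO j hj))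
      (fun p q hpq => hja.injective (hri (haO j hj p) (haO j hj q) hpq)) fun U hU => ?_
    rw [image_comp]
    refine hro _ (hja.isOpenMap U hU) ?_
    rintro _ ⟨q, -, rfl⟩
    exact haO j hj q
  · intro i hi j hj hij
    rw [Set.disjoint_left]
    rintro _ ⟨p, rfl⟩ ⟨q, hq⟩
    have h1 := hri (haO j hj q) (haO i hi p) hq
    exact Set.disjoint_left.1 (h.disjoint i (hTm hi) j (hTm hj) hij) (mem_range_self p)
      (h1 ▸ mem_range_self q)
  · intro j hj ζ s hs
    have hne : D (j, s * ζ) ≠ D (j₀, 0) := fun h' => by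
      have h1 : j = j₀ := congrArg Prod.fst (hD.injective h')
      exact hj₀ (h1 ▸ hj)
    rw [hG hne, Function.comp_apply, h.of_pos j (hTm hj) ζ s hs]
  · intro j hj ζ s hs y hy hjy
    by_cases hy0 : y = D (j₀, 0)
    · rw [hy0, hGD] at hjy
      exact hδ0 _ (haO j hj _) hjy
    · rw [hG hy0] at hjy
      have hy' : y ∈ offCenters D (insert j₀ T) := by rw [hsub]; exact ⟨hy, hy0⟩
      exact h.of_nonpos j (hTm hj) ζ s hs y hy' (hri (haO j hj _) (hFO y hy') hjy)
  · have hne : ∀ p, Y.curve p ≠ D (j₀, 0) := fun p hp =>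
      Set.disjoint_left.1 hDY (mem_range_self _) ⟨p, hp⟩
    have hmr : MapsDoodle (Y.map F h.maps) r O := by
      refine ⟨hOo, ?_, hrc, hri, fun x hx => hrd x hx (hinner hZ x)⟩
      rintro _ ⟨p, rfl⟩
      exact hFO _ (hYoff _ (mem_range_self p))
    -- The surgery produces the image under `r` of the image under `F`. On the curves, which avoid
    -- the centers, this agrees with `G`.
    refine .trans _ _ _ (.rel _ _ (Or.inr (Or.inl (hW k O hmr)))) (.rel _ _ (Or.inr (Or.inr (Or.inr ?_))))
    exact ⟨Homeomorph.refl _, (isOrientedEmbedding_id W).2,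
      SameImage.of_eq k fun p => (hG (hne p)).symm⟩

/-- After all centers are filled in, the map is an oriented embedding defined on the whole closed
surface. Its image is open by invariance of domain, so the rest of the target consists of components
that miss the diagram. -/
theorem IsSpreading.operationEquivalent (hY : Y.surface.bdry = ∅) (hD : IsOpenEmbedding D)
    (hDY : Disjoint (range D) Y.image) (k : DiagramKind) (T : Finset (Fin m)) :
    ∀ {Z : OrientedSurface} (_ : Z.bdry = ∅) {F : Y.surface → Z} {a : Fin m → Circle × ℝ → Z}
      (h : IsSpreading D T F a), OperationEquivalent k (Y.map F h.maps) Y := by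
  classical
  induction T using Finset.induction_on with
  | empty =>
    intro Z hZ F a h
    have hU : offCenters D ∅ = univ := by simp [offCenters]
    have hemb : IsOrientedEmbedding F := by
      refine isOrientedEmbedding_iff.2 ⟨?_, ?_, fun x _ => h.maps.deg x (by rw [hU]; trivial)⟩
      · rw [← continuousOn_univ, ← hU]; exact h.maps.continuousOn
      · rw [← injOn_univ, ← hU]; exact h.maps.injOn
    refine .rel _ _ (Or.inr (Or.inr (Or.inl ⟨F, hemb, ?_, SameImage.refl k _⟩)))
    refine isOpen_iff_mem_nhds.2 ?_
    rintro _ ⟨x, rfl⟩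
    refine (congrArg (· ∈ 𝓝 (F x)) (image_univ (f := F))).mp ?_
    exact (h.maps.deg x (by rw [hU]; trivial)).image_mem_nhds one_ne_zero Filter.univ_mem
      hemb.1.continuous.continuousOn Filter.univ_mem
  | insert j T hj ih =>
    intro Z hZ F a h
    obtain ⟨W, G, b, hW, h', hop⟩ := h.exists_surgery hY hD hDY hj hZ k
    exact .trans _ _ _ hop (ih hW h')

end

/-! ### Closed surfaces containing a diagram -/

/-- The capped surface without the centers of the caps is the interior of the surface of `A`, and it
is mapped to Z by squeezing the collar and applying `f`. The image of each collar without the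
boundary is an annulus in Z around a boundary-parallel curve, and surgery along these annuli fills
in the centers. -/
theorem Collar.operationEquivalent {A : DoodleDiagram} {m : ℕ} (C : Collar A m) {k : DiagramKind}
    {Z : DoodleDiagram} (hZ : Z.surface.bdry = ∅) {f : A.surface → Z.surface}
    (hf : IsOrientedEmbedding f) (hk : Carries k A Z f) : OperationEquivalent k Z C.capped := by
  have hf' := isOrientedEmbedding_iff.1 hf
  let F : C.ends.Cap → Z.surface := fun y => f (C.push (C.ends.proj y))
  have hFl : ∀ x : C.ends.O, F (C.ends.inl x) = f (C.push x) := fun x => rfl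
  -- The core s = 0 lies at depth 1. Parameters s > 0 give the squeezed images of points at depth s;
  -- parameters s ≤ 0 give depths at most 1, which squeezed interior points do not reach.
  let a : Fin m → Circle × ℝ → Z.surface := fun j q => f (C.c ((j, q.1), squeeze q.2))
  have hoff : ∀ y ∈ offCenters (Y := C.capped) C.ends.disk Finset.univ, ∃ x, y = C.ends.inl x := by
    intro y hy
    rcases C.ends.eq_inl_or_inr y with h | ⟨j, rfl⟩
    · exact h
    · exact (hy ⟨j, by simp, C.ends.disk_zero j⟩).elim
  have hinner : ∀ x : C.ends.O, (x : A.surface) ∈ A.surface.inner := fun x => C.ends_O ▸ x.2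
  have hdisj : Disjoint (α := Set C.capped.surface) (range C.ends.disk) C.capped.image := by
    refine Set.disjoint_left.2 ?_
    rintro _ ⟨p, rfl⟩ ⟨q, hq⟩
    have h1 := (C.inl_eq_disk hq.symm).2
    exact Set.disjoint_left.1 C.disjoint (mem_range_self _)
      ⟨q, (C.push_curve q).symm.trans h1⟩
  have hopen : ∀ V, IsOpen V → V ⊆ A.surface.inner → IsOpen (f '' V) := by
    intro V hV hVi
    rw [isOpen_iff_mem_nhds]
    rintro _ ⟨x, hx, rfl⟩
    exact (hf'.2.2 x (hVi hx)).image_mem_nhds one_ne_zero Filter.univ_mem hf'.1.continuousOn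
      (hV.mem_nhds hx)
  have hmaps : MapsDoodle C.capped F (offCenters (Y := C.capped) C.ends.disk Finset.univ) := by
    refine ⟨((Finset.finite_toSet _).image _).isClosed.isOpen_compl, ?_, ?_, ?_, ?_⟩
    · rintro x hx ⟨i, -, rfl⟩
      exact Set.disjoint_right.1 hdisj hx (mem_range_self _)
    · intro y hy
      obtain ⟨x, rfl⟩ := hoff y hy
      exact ((hf'.1.comp C.continuous_push).continuousAt.comp
        (C.ends.continuousAt_proj x)).continuousWithinAt
    · intro y hy y' hy' h
      obtain ⟨x, rfl⟩ := hoff y hy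
      obtain ⟨x', rfl⟩ := hoff y' hy'
      exact congrArg C.ends.inl (Subtype.ext (C.push_injective (hf'.2.1 h)))
    · intro y hy
      obtain ⟨x, rfl⟩ := hoff y hy
      have h1 : DegAt (f ∘ C.push) (C.ends.proj (C.ends.inl x)) 1 :=
        DegAt.comp (f := C.push) (hf'.2.2 _ (C.push_mem_inner x)) (C.degAt_push (hinner x))
          hf'.1.continuousAt C.continuous_push.continuousAt
      exact DegAt.comp (f := C.ends.proj) h1 (C.ends.degAt_proj (hinner x))
        (hf'.1.comp C.continuous_push).continuousAt (C.ends.continuousAt_proj x)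
  have hspread : IsSpreading (Y := C.capped) C.ends.disk Finset.univ F a := by
    refine ⟨hmaps, ?_, ?_, ?_, ?_⟩
    · intro j _
      have h1 : IsOpenEmbedding fun q : Circle × ℝ => C.c ((j, q.1), squeeze q.2) := by
        refine C.isOpenEmbedding.comp (IsOpenEmbedding.prodMap (f := Prod.mk j) ?_
          isOpenEmbedding_squeeze)
        refine .of_continuous_injective_isOpenMap (by fun_prop) (Prod.mk_right_injective j)
          fun U hU => ?_
        have : Prod.mk j '' U = {j} ×ˢ U := by ext ⟨a, b⟩; simp [eq_comm, and_comm]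
        rw [this]
        exact (isOpen_discrete _).prod hU
      refine .of_continuous_injective_isOpenMap (hf'.1.comp h1.continuous)
        (hf'.2.1.comp h1.injective) fun U hU => ?_
      rw [show a j '' U = f '' ((fun q : Circle × ℝ => C.c ((j, q.1), squeeze q.2)) '' U) from
        image_comp f _ U]
      refine hopen _ (h1.isOpenMap U hU) ?_
      rintro _ ⟨q, -, rfl⟩
      exact (C.mem_inner_iff _).2 (squeeze_pos _).ne'
    · intro i _ j _ hij
      rw [Set.disjoint_left]
      rintro _ ⟨p, rfl⟩ ⟨q, hq⟩
      have h1 := C.isOpenEmbedding.injective (hf'.2.1 hq)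
      exact hij (congrArg (fun p => p.1.1) h1).symm
    · intro j _ ζ s hs
      have hs' : (⟨s, hs.le⟩ : ℝ≥0) ≠ 0 := fun h => hs.ne' (congrArg NNReal.toReal h)
      have h1 := C.disk_planePolarInv (q := ((j, ζ), ⟨s, hs.le⟩)) hs'
        (by rw [C.ends_O]; exact (C.mem_inner_iff _).2 hs')
      have h2 := congrArg F h1
      rw [hFl, C.push_c] at h2
      exact h2.symm
    · intro j _ ζ s hs y hy h
      obtain ⟨x, rfl⟩ := hoff y hy
      have h1 : C.c ((j, ζ), squeeze s) = C.push x := hf'.2.1 h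
      by_cases hx : (x : A.surface) ∈ range C.c
      · obtain ⟨⟨p, t⟩, hpx⟩ := hx
        have ht : t ≠ 0 := (C.mem_inner_iff (p, t)).1 (hpx ▸ hinner x)
        rw [← hpx, C.push_c] at h1
        have h2 : squeeze s = squeeze t := congrArg Prod.snd (C.isOpenEmbedding.injective h1)
        have h3 : s = t := strictMono_squeeze.injective h2
        exact ht (le_antisymm (by rw [← NNReal.coe_le_coe, ← h3]; exact hs) bot_le)
      · rw [C.push_of_notMem hx] at h1
        exact hx (h1 ▸ mem_range_self _)
  -- The diagram of `Z` and the image of the capped diagram have the same image on the same surface,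
  -- since squeezing fixes the curves; the identity relates them.
  refine .trans _ _ _ (OperationEquivalent.of_orientedHomeomorphic
    (B := C.capped.map F hmaps) ?_)
    (hspread.operationEquivalent C.bdry_cap C.ends.isOpenEmbedding_disk hdisj k Finset.univ hZ)
  refine ⟨Homeomorph.refl _, (isOrientedEmbedding_id Z.surface).2, ?_⟩
  refine SameImage.trans (SameImage.symm hk) (SameImage.of_eq k fun p => ?_)
  change f (A.curve p) = f (C.push (C.push (A.curve p)))
  rw [C.push_curve, C.push_curve]

theorem exists_isCapping (k : DiagramKind) (A : DoodleDiagram) : ∃ B, IsCapping k A B := by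
  obtain ⟨m, ⟨C⟩⟩ := exists_collar A
  exact ⟨C.capped, C.isCapping k⟩

/-- The surface of `B` is closed and contains the one of `A`, so that the diagrams correspond. -/
def ClosedExtension (k : DiagramKind) (A B : DoodleDiagram) : Prop :=
  B.surface.bdry = ∅ ∧ ∃ f : A.surface → B.surface, IsOrientedEmbedding f ∧ Carries k A B f

theorem IsCapping.closedExtension {k : DiagramKind} {A B : DoodleDiagram} (h : IsCapping k A B) :
    ClosedExtension k A B := by
  obtain ⟨hB, ι, -, -, hι, hk, -⟩ := h
  exact ⟨hB, ι, hι, hk⟩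

/-- Both extensions are compared with the canonical capping given by one collar of `A`. -/
theorem ClosedExtension.operationEquivalent {k : DiagramKind} {A B B' : DoodleDiagram}
    (h : ClosedExtension k A B) (h' : ClosedExtension k A B') : OperationEquivalent k B B' := by
  obtain ⟨m, ⟨C⟩⟩ := exists_collar A
  obtain ⟨hB, f, hf, hk⟩ := h
  obtain ⟨hB', f', hf', hk'⟩ := h'
  exact .trans _ _ _ (C.operationEquivalent hB hf hk) (.symm _ _ (C.operationEquivalent hB' hf' hk'))

/-- The third surface of the geotopy may have boundary. Capping it gives a closed surface that
contains both ambient surfaces. -/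
theorem Geotopic.exists_closedExtension {k : DiagramKind} {A B : DoodleDiagram}
    (h : Geotopic k A B) : ∃ V, ClosedExtension k A V ∧ ClosedExtension k B V := by
  obtain ⟨W, f, g, hf, hg, hk⟩ := h
  obtain ⟨V, hV, ι, -, -, hι, hc, -⟩ := exists_isCapping k (A.map f hf.mapsDoodle)
  refine ⟨V, ⟨hV, ι ∘ f, hι.comp hf, hc⟩, ⟨hV, ι ∘ g, hι.comp hg, ?_⟩⟩
  exact SameImage.trans (SameImage.map hk.symm ι) hc

theorem StablyEquivalent.operationEquivalent {k : DiagramKind} {A B A' B' : DoodleDiagram}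
    (h : StablyEquivalent k A B) (hA : ClosedExtension k A A') (hB : ClosedExtension k B B') :
    OperationEquivalent k A' B' := by
  induction h generalizing B' with
  | refl => exact hA.operationEquivalent hB
  | tail _ h ih =>
    obtain ⟨V, hV, hV'⟩ := Geotopic.exists_closedExtension h
    exact .trans _ _ _ (ih hV) (hV'.operationEquivalent hB)

end Doodle

end

/-! ### The main theorem -/

theorem mainTheorem8 (k : Doodle.DiagramKind) (A B : Doodle.DoodleDiagram) :
    (∃ A₁ : Doodle.DoodleDiagram, Doodle.IsCapping k A A₁) ∧
    (∃ B₁ : Doodle.DoodleDiagram, Doodle.IsCapping k B B₁) ∧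
    ∀ A₁ B₁ : Doodle.DoodleDiagram, Doodle.IsCapping k A A₁ → Doodle.IsCapping k B B₁ →
      (Doodle.StablyEquivalent k A B ↔ Doodle.OperationEquivalent k A₁ B₁) := by
  refine ⟨Doodle.exists_isCapping k A, Doodle.exists_isCapping k B, fun A₁ B₁ hA hB =>
    ⟨fun h => h.operationEquivalent hA.closedExtension hB.closedExtension, fun h => ?_⟩⟩
  -- Cappings are geotopies, so the chain between the capped diagrams is prolonged at both ends.
  exact (h.stablyEquivalent.head hA.geotopic).tail hB.geotopic.symm
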